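/- Let $r\ge 1$ and $m$ be integers and put $n=m+r$. Consider $2$-nondegenerate CR structures $H$ of hypersurface type in dimension $2n+1$ whose Levi kernel $K$ is a distribution of rank $r$: $H\subset\mathbb C TM$ is an involutive complex distribution of rank $n$ with $H\cap\overline H=0$, $K$ is the kernel of the Levi form $\mathcal L(X,Y)=\frac i2[X,\overline Y]\bmod H\oplus\overline H$ on $H$, and for every nonzero $v\in K_p$ the operator $\mathrm{ad}_v:\overline H_p/\overline K_p\to H_p/K_p$, $y\mapsto[V,Y]_p\bmod K_p\oplus\overline H_p$ (with $V\in\Gamma(K)$, $Y\in\Gamma(\overline H)$ extending $v$, $y$) is nonzero. The CR symbol of $H$ at $p$ is the isomorphism class of the pair consisting of the real line spanned by the reduced Levi form $\ell$ on $H_p/K_p$ and of the complex vector space of the $\ell$-self-adjoint antilinear operators $x\mapsto \mathrm{ad}_v(\overline x)$, $v\in K_p$. In a basis of $H_p/K_p$ it is given by a nondegenerate Hermitian $m\times m$ matrix $G=(\ell(e_i,e_j))$ and an $r$-dimensional complex space $W$ of $m\times m$ matrices $C$ (representing $x\mapsto C\overline x$) with $C^{T}G$ symmetric; all such pairs $(G,W)$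 are regarded as CR symbols. A CR symbol is associated with a homogeneous model if it is the symbol, at some point, of a CR structure as above on some open set $U\subset\mathbb R^{2n+1}$ that is homogeneous in the sense that its infinitesimal symmetries (the smooth real vector fields $X$ on $U$ with $[X,\Gamma(H)]\subset\Gamma(H)$) span the tangent space at each point of $U$. **Theorem.** Assume that $2n+1>4r+1$ and let $G$ be a nondegenerate Hermitian $m\times m$ matrix, of arbitrary signature if $r>1$, and definite (the pseudoconvex case) if $r=1$. Then, among the CR symbols with reduced Levi form $G$, those that are not associated with any homogeneous model are generic: there is a real polynomial $P$ in the real and imaginary parts of the entries of $r$-tuples $(C_1,\dots,C_r)$ of $m\times m$ matrices such that $P(C_1,\dots,C_r)\ne0$ for some basis $(C_1,\dots,C_r)$ of the space $W$ of some CR symbol $(G,W)$, and such that every CR symbol $(G,W)$ for which $W$ has a basis $(C_1,\dots,C_r)$ with $P(C_1,\dots,C_r)\neq0$ is not associated with any homogeneous model. -/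

import Mathlib

open scoped ContDiff Matrix ComplexOrder

namespace CRGeom

/-! ## Complex vector fields and distributions on open subsets of `ℝ^N` -/

/-- A complex vector field on `ℝ^N`, i.e. a section of the complexified tangent bundle
`ℂTℝ^N = ℝ^N × ℂ^N`. Only its values on a given open set matter. -/
abbrev VField (N : ℕ) : Type := (Fin N → ℝ) → (Fin N → ℂ)

/-- A field of complex subspaces of the complexified tangent spaces. -/
abbrev Distr (N : ℕ) : Type := (Fin N → ℝ) → Submodule ℂ (Fin N → ℂ)

/-- The derivative of `W` at `x` in the direction of the complex tangent vector `v`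
(the differential of `W` at `x`, extended complex linearly). -/
noncomputable def dirDeriv {N : ℕ} (W : VField N) (x : Fin N → ℝ) (v : Fin N → ℂ) :
    Fin N → ℂ :=
  fderiv ℝ W x (fun k => (v k).re) + Complex.I • fderiv ℝ W x (fun k => (v k).im)

/-- The Lie bracket `[V, W]` of complex vector fields. -/
noncomputable def lieBr {N : ℕ} (V W : VField N) : VField N :=
  fun x => dirDeriv W x (V x) - dirDeriv V x (W x)

/-- The complex conjugate of a complex vector field. -/
noncomputable def conjField {N : ℕ} (V : VField N) : VField N := fun x => star (V x)

/-- A real tangent vector, seen as a complex one. -/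
def toComplex {N : ℕ} (v : Fin N → ℝ) : Fin N → ℂ := fun k => (v k : ℂ)

/-- The complex conjugate of a complex subspace of `ℂ^N`. -/
def conjSub {N : ℕ} (W : Submodule ℂ (Fin N → ℂ)) : Submodule ℂ (Fin N → ℂ) where
  carrier := {v | star v ∈ W}
  add_mem' := by
    intro a b ha hb
    simpa using W.add_mem ha hb
  zero_mem' := by simp
  smul_mem' := by
    intro c a ha
    simpa using W.smul_mem (star c) ha

/-- `V ∈ Γ(D)`: a smooth complex vector field on `U` with values in `D`. -/
def IsSection {N : ℕ} (U : TopologicalSpace.Opens (Fin N → ℝ)) (D : Distr N) (V : VField N) :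
    Prop :=
  ContDiffOn ℝ ∞ V U ∧ ∀ x ∈ U, V x ∈ D x

/-- `D` is a smooth complex distribution of rank `k` on `U`. (For a field of subspaces of
constant dimension, smoothness means that every vector of `D x` extends to a smooth section.) -/
structure IsDistribution {N : ℕ} (U : TopologicalSpace.Opens (Fin N → ℝ)) (D : Distr N) (k : ℕ) :
    Prop where
  rank : ∀ x ∈ U, Module.finrank ℂ (D x) = k
  smooth : ∀ x ∈ U, ∀ v ∈ D x, ∃ V : VField N, IsSection U D V ∧ V x = v

/-! ## CR structures of hypersurface type -/

/-- A CR structure of hypersurface type on the open set `U` of `ℝ^(2n+1)`: a smooth complex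
distribution `H` of rank `n` with `[H, H] ⊆ H` and `H ∩ conj H = 0`. -/
structure IsCRStructure {n : ℕ} (U : TopologicalSpace.Opens (Fin (2 * n + 1) → ℝ))
    (H : Distr (2 * n + 1)) : Prop where
  distribution : IsDistribution U H n
  involutive : ∀ V W : VField (2 * n + 1), IsSection U H V → IsSection U H W →
    ∀ x ∈ U, lieBr V W x ∈ H x
  totallyReal : ∀ x ∈ U, H x ⊓ conjSub (H x) = ⊥

/-- `(i/2) [X, conj Y]` at a point. Its class modulo `H ⊕ conj H` is the value of the Levi form at
`X, Y ∈ Γ(H)`. -/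
noncomputable def leviBr {N : ℕ} (X Y : VField N) : VField N :=
  fun x => (Complex.I / 2) • lieBr X (conjField Y) x

theorem lieBr_add_left {N : ℕ} {V V' W : VField N} {x : Fin N → ℝ}
    (hV : DifferentiableAt ℝ V x) (hV' : DifferentiableAt ℝ V' x) :
    lieBr (V + V') W x = lieBr V W x + lieBr V' W x := by
  have h1 : fderiv ℝ (V + V') x = fderiv ℝ V x + fderiv ℝ V' x := fderiv_add hV hV'
  have h2 : (fun k => ((V + V') x k).re) = (fun k => (V x k).re) + (fun k => (V' x k).re) := by
    ext k; simp
  have h3 : (fun k => ((V + V') x k).im) = (fun k => (V x k).im) + (fun k => (V' x k).im) := by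
    ext k; simp
  simp only [lieBr, dirDeriv, h1, h2, h3, map_add, add_apply, smul_add]
  abel

theorem lieBr_smul_left {N : ℕ} {V W : VField N} {x : Fin N → ℝ} (c : ℂ)
    (hV : DifferentiableAt ℝ V x) :
    lieBr (c • V) W x = c • lieBr V W x := by
  have h1 : fderiv ℝ (c • V) x = c • fderiv ℝ V x := fderiv_const_smul hV c
  have h2 : (fun k => ((c • V) x k).re)
      = c.re • (fun k => (V x k).re) - c.im • (fun k => (V x k).im) := by
    ext k; simp
  have h3 : (fun k => ((c • V) x k).im)
      = c.re • (fun k => (V x k).im) + c.im • (fun k => (V x k).re) := by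
    ext k; simp
  simp only [lieBr, dirDeriv, h1, h2, h3, map_add, map_sub, map_smul]
  ext k
  apply Complex.ext <;> simp <;> ring

theorem leviBr_add_left {N : ℕ} {V V' W : VField N} {x : Fin N → ℝ}
    (hV : DifferentiableAt ℝ V x) (hV' : DifferentiableAt ℝ V' x) :
    leviBr (V + V') W x = leviBr V W x + leviBr V' W x := by
  simp only [leviBr, lieBr_add_left hV hV', smul_add]

theorem leviBr_smul_left {N : ℕ} {V W : VField N} {x : Fin N → ℝ} (c : ℂ)
    (hV : DifferentiableAt ℝ V x) :
    leviBr (c • V) W x = c • leviBr V W x := by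
  simp only [leviBr, lieBr_smul_left c hV, smul_comm c]

theorem IsSection.differentiableAt {N : ℕ} {U : TopologicalSpace.Opens (Fin N → ℝ)} {D : Distr N}
    {V : VField N} (hV : IsSection U D V) {x : Fin N → ℝ} (hx : x ∈ U) :
    DifferentiableAt ℝ V x :=
  (hV.1.contDiffAt (U.isOpen.mem_nhds hx)).differentiableAt (by simp)

/-- The kernel `K` of the Levi form: `v ∈ H_x` lies in `K_x` if it extends to a section `V` of `H`
with `(i/2) [V, conj Y]_x ∈ H_x ⊕ conj H_x` for all `Y ∈ Γ(H)` (the class of this bracket does not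
depend on the extension). By convention it is zero outside of `U`. -/
noncomputable def leviKernel {N : ℕ} (U : TopologicalSpace.Opens (Fin N → ℝ)) (H : Distr N) :
    Distr N := fun x =>
  { carrier := {v | v = 0 ∨ (x ∈ U ∧ ∃ V : VField N, IsSection U H V ∧ V x = v ∧
      ∀ Y : VField N, IsSection U H Y → leviBr V Y x ∈ H x ⊔ conjSub (H x))}
    add_mem' := by
      rintro a b (rfl | ⟨hx, V, hV, rfl, h⟩) hb
      · simpa using hb
      · rcases hb with rfl | ⟨-, V', hV', rfl, h'⟩
        · exact Or.inr ⟨hx, V, hV, by simp, h⟩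
        · refine Or.inr ⟨hx, V + V', ⟨hV.1.add hV'.1,
            fun y hy => (H y).add_mem (hV.2 y hy) (hV'.2 y hy)⟩, rfl, fun Y hY => ?_⟩
          rw [leviBr_add_left (hV.differentiableAt hx) (hV'.differentiableAt hx)]
          exact Submodule.add_mem _ (h Y hY) (h' Y hY)
    zero_mem' := Or.inl rfl
    smul_mem' := by
      rintro c a (rfl | ⟨hx, V, hV, rfl, h⟩)
      · exact Or.inl (by simp)
      · refine Or.inr ⟨hx, c • V, ⟨hV.1.const_smul c,
          fun y hy => (H y).smul_mem c (hV.2 y hy)⟩, rfl, fun Y hY => ?_⟩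
        rw [leviBr_smul_left c (hV.differentiableAt hx)]
        exact Submodule.smul_mem _ c (h Y hY) }

/-- 2-nondegeneracy at `x`: `K_x ≠ 0`, and for every `V ∈ Γ(K)` with `V_x ≠ 0` the operator
`ad_{V_x} : conj H_x / conj K_x → H_x / K_x`, `conj Y ↦ [V, conj Y] mod K_x ⊕ conj H_x`,
is not zero. -/
def TwoNondegenerateAt {N : ℕ} (U : TopologicalSpace.Opens (Fin N → ℝ)) (H : Distr N)
    (x : Fin N → ℝ) : Prop :=
  leviKernel U H x ≠ ⊥ ∧
  ∀ V : VField N, IsSection U (leviKernel U H) V → V x ≠ 0 →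
    ∃ Y : VField N, IsSection U H Y ∧
      lieBr V (conjField Y) x ∉ leviKernel U H x ⊔ conjSub (H x)

/-- An infinitesimal symmetry of `H` on `U`: a smooth real vector field `X` on `U` with
`[X, Γ(H)] ⊆ Γ(H)`. -/
def IsInfinitesimalSymmetry {N : ℕ} (U : TopologicalSpace.Opens (Fin N → ℝ)) (H : Distr N)
    (X : (Fin N → ℝ) → (Fin N → ℝ)) : Prop :=
  ContDiffOn ℝ ∞ X U ∧
  ∀ V : VField N, IsSection U H V → ∀ x ∈ U, lieBr (fun y => toComplex (X y)) V x ∈ H x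

/-- Homogeneity (in the local, infinitesimal sense): the infinitesimal symmetries of `H` span the
tangent space at every point of `U`. This holds in each coordinate chart of a CR manifold on which
a Lie group acts transitively by symmetries. -/
def IsLocallyHomogeneous {N : ℕ} (U : TopologicalSpace.Opens (Fin N → ℝ)) (H : Distr N) : Prop :=
  ∀ x ∈ U, ∀ v : Fin N → ℝ, ∃ X : (Fin N → ℝ) → (Fin N → ℝ),
    IsInfinitesimalSymmetry U H X ∧ X x = v

/-! ## CR symbols -/

/-- A CR symbol, written in a basis `e_1, …, e_m` of `𝔤_{-1,1} = H_x / K_x`: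
* the nondegenerate Hermitian matrix `levi`, with entries `ℓ(e_i, e_j)`, of the reduced Levi form;
* the `r`-dimensional space `ops` of the matrices `C` that represent the antilinear operators
  `A w = C (conj w)` on `𝔤_{-1,1}` given by the elements of `𝔤_{0,2}`. They are `ℓ`-self-adjoint:
  `ℓ(A w, w') = ℓ(A w', w)`, that is, `Cᵀ levi` is a symmetric matrix. -/
structure CRSymbol (m r : ℕ) where
  levi : Matrix (Fin m) (Fin m) ℂ
  levi_hermitian : levi.IsHermitian
  levi_nondegenerate : IsUnit levi.det
  ops : Submodule ℂ (Matrix (Fin m) (Fin m) ℂ)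
  ops_selfAdjoint : ∀ C ∈ ops, (Cᵀ * levi).IsSymm
  finrank_ops : Module.finrank ℂ ops = r

/-- The symbol at `p` of the CR structure `H`, with Levi kernel `K` of rank `r`, is (isomorphic to)
`σ`: there are sections `e_i` of `H` that give a basis of `H_p / K_p`, sections `k_s` of `K` that
give a basis of `K_p`, and a real vector `z` transversal to `H_p ⊕ conj H_p` such that
* `(i/2) [e_i, conj e_j]_p ≡ levi_{ij} z` modulo `H_p ⊕ conj H_p`, and
* `ad_{k_s} (conj e_j) ≡ ∑_i (C_s)_{ij} e_i` modulo `K_p ⊕ conj H_p`, where the `C_s` span `ops`.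
The choice of `z` reflects that the reduced Levi form is defined up to a nonzero real factor. -/
def HasSymbolAt {m r : ℕ} (U : TopologicalSpace.Opens (Fin (2 * (m + r) + 1) → ℝ))
    (H : Distr (2 * (m + r) + 1)) (p : Fin (2 * (m + r) + 1) → ℝ) (σ : CRSymbol m r) : Prop :=
  ∃ (e : Fin m → VField (2 * (m + r) + 1)) (k : Fin r → VField (2 * (m + r) + 1))
    (z : Fin (2 * (m + r) + 1) → ℝ) (C : Fin r → Matrix (Fin m) (Fin m) ℂ),
    (∀ i, IsSection U H (e i)) ∧ (∀ s, IsSection U (leviKernel U H) (k s)) ∧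
    LinearIndependent ℂ (Sum.elim (fun i => e i p) (fun s => k s p)) ∧
    toComplex z ∉ H p ⊔ conjSub (H p) ∧
    (∀ i j, leviBr (e i) (e j) p - σ.levi i j • toComplex z ∈ H p ⊔ conjSub (H p)) ∧
    Submodule.span ℂ (Set.range C) = σ.ops ∧
    (∀ s j, lieBr (k s) (conjField (e j)) p - ∑ i, C s i j • e i p
      ∈ leviKernel U H p ⊔ conjSub (H p))

/-- The symbol `σ` is associated with a homogeneous model: it is the symbol, at some point, of a
locally homogeneous, 2-nondegenerate CR structure of hypersurface type in dimension `2 (m + r) + 1`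
whose Levi kernel is a distribution of rank `r`. -/
def CRSymbol.HasHomogeneousModel {m r : ℕ} (σ : CRSymbol m r) : Prop :=
  ∃ (U : TopologicalSpace.Opens (Fin (2 * (m + r) + 1) → ℝ)) (H : Distr (2 * (m + r) + 1)),
    IsCRStructure U H ∧ IsDistribution U (leviKernel U H) r ∧
    (∀ x ∈ U, TwoNondegenerateAt U H x) ∧ IsLocallyHomogeneous U H ∧
    ∃ p ∈ U, HasSymbolAt U H p σ

/-! ## Genericity -/

/-- The real and imaginary parts of the entries of a tuple of matrices. -/
noncomputable def realCoords {m r : ℕ} (C : Fin r → Matrix (Fin m) (Fin m) ℂ) :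
    Fin r × Fin m × Fin m × Bool → ℝ :=
  fun t => if t.2.2.2 then (C t.1 t.2.1 t.2.2.1).im else (C t.1 t.2.1 t.2.2.1).re

/-- `C` is a basis of the space of operators of the symbol `σ`. -/
def CRSymbol.IsOpsBasis {m r : ℕ} (σ : CRSymbol m r) (C : Fin r → Matrix (Fin m) (Fin m) ℂ) :
    Prop :=
  LinearIndependent ℂ C ∧ Submodule.span ℂ (Set.range C) = σ.ops

/-- A set `S` of CR symbols is generic among the CR symbols with reduced Levi form `G`: it contains
all such symbols outside of a proper real algebraic subset, that is, there is a real polynomial `P`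
in the real and imaginary parts of the entries of tuples `(C_1, …, C_r)` that does not vanish
identically on the tuples that come from such symbols, and `S` contains every such symbol with a
basis `(C_1, …, C_r)` at which `P` does not vanish. -/
def IsGenericForLevi {m r : ℕ} (G : Matrix (Fin m) (Fin m) ℂ) (S : Set (CRSymbol m r)) : Prop :=
  ∃ P : MvPolynomial (Fin r × Fin m × Fin m × Bool) ℝ,
    (∃ (σ : CRSymbol m r) (C : Fin r → Matrix (Fin m) (Fin m) ℂ),
      σ.levi = G ∧ σ.IsOpsBasis C ∧ MvPolynomial.eval (realCoords C) P ≠ 0) ∧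
    ∀ (σ : CRSymbol m r) (C : Fin r → Matrix (Fin m) (Fin m) ℂ),
      σ.levi = G → σ.IsOpsBasis C → MvPolynomial.eval (realCoords C) P ≠ 0 → σ ∈ S

end CRGeom

/-! Fix a point p of a homogeneous structure, a frame e_i of H/K and a frame k_s of K. Homogeneity
gives complexified symmetries X_s with X_s(p) = k_s(p). The field E_s = k_s − X_s vanishes at p, so
it acts linearly on tangent vectors at p. It preserves K ⊕ K̄ and acts on (H ⊕ H̄)/(K ⊕ K̄), in the
basis e, ē, by a block matrix with rows (A_s, C_s) and (0, D_s). The corner C_s is the symbol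
operator, because symmetries preserve H̄ and contribute nothing there; A_sᵀG + G D_s is a multiple
of G, because the Levi form is preserved up to scale. A symmetry that vanishes at p acts by a block
diagonal matrix diag(P, Q).

The bracket [Ē_t, E_s] also vanishes at p. As K ⊕ K̄ is involutive and invariant under symmetries,
this bracket is the symmetry [X̄_t, X_s] plus a section of K ⊕ K̄. Its linear part, a commutator of
block matrices, is therefore a combination of those of the E_u, the Ē_u and a symmetry vanishing at
p. Comparing blocks gives algebraic conditions on the symbol (`IsLeviFrame.structure_equations`).

For r > 1, suppose that the infinitesimal stabilizer of W = span(C_s) consists of scalars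
(`HasScalarStabilizer`). The equations first make all D_t, A_s and P scalar, and then also every C_s
C̄_t (`HasScalarStabilizer.mul_conj_mem`). If W contains an invertible operator, this forces dim W ≤
1, a contradiction (`finrank_le_one_of_mul_conj_scalar`). Both requirements are implied by the
non-vanishing of polynomials, and a tuple of diagonal forms with entries i ^ s shows that these are
not identically zero (`powerTuple_hasScalarStabilizer`).

For r = 1 and G definite, work in an orthonormal basis and put N = C Cᴴ. Taking traces of the
equations gives m tr N² ≤ (tr N)², while Cauchy–Schwarz gives the reverse inequality
(`trace_sq_of_commutator`). So m tr N² − (tr N)² vanishes for every invertible symbol of a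
homogeneous model, but not for C = diag(2, 1, …, 1) when m > 1. -/

namespace CRGeom

/-! ## Calculus of complex vector fields -/

section Calculus

variable {N : ℕ}

/-- Componentwise real part. -/
noncomputable def rePart (N : ℕ) : (Fin N → ℂ) →L[ℝ] (Fin N → ℝ) :=
  ContinuousLinearMap.pi fun k => Complex.reCLM.comp (ContinuousLinearMap.proj k)

/-- Componentwise imaginary part. -/
noncomputable def imPart (N : ℕ) : (Fin N → ℂ) →L[ℝ] (Fin N → ℝ) :=
  ContinuousLinearMap.pi fun k => Complex.imCLM.comp (ContinuousLinearMap.proj k)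

/-- Componentwise complex conjugation. -/
noncomputable def starPart (N : ℕ) : (Fin N → ℂ) →L[ℝ] (Fin N → ℂ) :=
  ContinuousLinearMap.pi fun k =>
    (Complex.conjCLE : ℂ →L[ℝ] ℂ).comp (ContinuousLinearMap.proj k)

theorem starPart_apply (v : Fin N → ℂ) : starPart N v = star v := by
  ext k; simp [starPart]

theorem rePart_star (v : Fin N → ℂ) : rePart N (star v) = rePart N v := by
  ext k; simp [rePart]

theorem imPart_star (v : Fin N → ℂ) : imPart N (star v) = -imPart N v := by
  ext k; simp [imPart]

theorem rePart_smul (c : ℂ) (v : Fin N → ℂ) :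
    rePart N (c • v) = c.re • rePart N v - c.im • imPart N v := by
  ext k; simp [rePart, imPart]

theorem imPart_smul (c : ℂ) (v : Fin N → ℂ) :
    imPart N (c • v) = c.re • imPart N v + c.im • rePart N v := by
  ext k; simp [rePart, imPart]

theorem dirDeriv_eq (W : VField N) (x : Fin N → ℝ) (v : Fin N → ℂ) :
    dirDeriv W x v = fderiv ℝ W x (rePart N v) + Complex.I • fderiv ℝ W x (imPart N v) := rfl

/-- The differential of a complex vector field, as a complex linear map. -/
noncomputable def dirDerivL (W : VField N) (x : Fin N → ℝ) :
    (Fin N → ℂ) →ₗ[ℂ] (Fin N → ℂ) where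
  toFun := dirDeriv W x
  map_add' a b := by
    simp only [dirDeriv_eq, map_add, smul_add]; abel
  map_smul' c a := by
    simp only [dirDeriv_eq, rePart_smul, imPart_smul, map_add, map_sub, map_smul]
    ext k
    apply Complex.ext <;> simp <;> ring

theorem dirDerivL_apply (W : VField N) (x : Fin N → ℝ) (v : Fin N → ℂ) :
    dirDerivL W x v = dirDeriv W x v := rfl

theorem dirDeriv_add {V W : VField N} {x : Fin N → ℝ} (hV : DifferentiableAt ℝ V x)
    (hW : DifferentiableAt ℝ W x) (v : Fin N → ℂ) :
    dirDeriv (V + W) x v = dirDeriv V x v + dirDeriv W x v := by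
  simp only [dirDeriv_eq, fderiv_add hV hW, add_apply, smul_add]; abel

theorem dirDeriv_sub {V W : VField N} {x : Fin N → ℝ} (hV : DifferentiableAt ℝ V x)
    (hW : DifferentiableAt ℝ W x) (v : Fin N → ℂ) :
    dirDeriv (V - W) x v = dirDeriv V x v - dirDeriv W x v := by
  simp only [dirDeriv_eq, fderiv_sub hV hW, sub_apply, smul_sub]; abel

theorem dirDeriv_smul {V : VField N} {x : Fin N → ℝ} (c : ℂ) (hV : DifferentiableAt ℝ V x)
    (v : Fin N → ℂ) : dirDeriv (c • V) x v = c • dirDeriv V x v := by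
  have : fderiv ℝ (c • V) x = c • fderiv ℝ V x := fderiv_const_smul hV c
  simp only [dirDeriv_eq, this, smul_apply, smul_add, smul_comm c]

theorem conjField_eq (V : VField N) : conjField V = fun x => starPart N (V x) := by
  funext x; rw [starPart_apply]; rfl

@[simp] theorem conjField_apply (V : VField N) (x : Fin N → ℝ) :
    conjField V x = star (V x) := rfl

@[simp] theorem conjField_conjField (V : VField N) : conjField (conjField V) = V := by
  funext x; simp

theorem dirDeriv_conjField {V : VField N} {x : Fin N → ℝ} (hV : DifferentiableAt ℝ V x)
    (v : Fin N → ℂ) : dirDeriv (conjField V) x v = star (dirDeriv V x (star v)) := by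
  have h : fderiv ℝ (conjField V) x = (starPart N).comp (fderiv ℝ V x) := by
    rw [conjField_eq]
    exact (starPart N).hasFDerivAt.comp x hV.hasFDerivAt |>.fderiv
  simp only [dirDeriv_eq, h, ContinuousLinearMap.comp_apply, starPart_apply, rePart_star,
    imPart_star, map_neg, star_add, star_smul]
  simp

theorem _root_.DifferentiableAt.conjField {V : VField N} {x : Fin N → ℝ}
    (hV : DifferentiableAt ℝ V x) : DifferentiableAt ℝ (conjField V) x := by
  rw [conjField_eq]
  exact (starPart N).differentiableAt.comp x hV

theorem _root_.ContDiffOn.conjField {V : VField N} {s : Set (Fin N → ℝ)}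
    (hV : ContDiffOn ℝ ∞ V s) : ContDiffOn ℝ ∞ (conjField V) s := by
  rw [conjField_eq]
  exact (starPart N).contDiff.comp_contDiffOn hV

theorem lieBr_swap (V W : VField N) (x : Fin N → ℝ) : lieBr V W x = -lieBr W V x := by
  simp [lieBr]

theorem lieBr_sub_left {V V' W : VField N} {x : Fin N → ℝ}
    (hV : DifferentiableAt ℝ V x) (hV' : DifferentiableAt ℝ V' x) :
    lieBr (V - V') W x = lieBr V W x - lieBr V' W x := by
  simp only [lieBr, dirDeriv_sub hV hV', Pi.sub_apply, ← dirDerivL_apply, map_sub]; abel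

theorem lieBr_add_right {V W W' : VField N} {x : Fin N → ℝ}
    (hW : DifferentiableAt ℝ W x) (hW' : DifferentiableAt ℝ W' x) :
    lieBr V (W + W') x = lieBr V W x + lieBr V W' x := by
  rw [lieBr_swap, lieBr_add_left hW hW', lieBr_swap W, lieBr_swap W']; abel

theorem lieBr_sub_right {V W W' : VField N} {x : Fin N → ℝ}
    (hW : DifferentiableAt ℝ W x) (hW' : DifferentiableAt ℝ W' x) :
    lieBr V (W - W') x = lieBr V W x - lieBr V W' x := by
  rw [lieBr_swap, lieBr_sub_left hW hW', lieBr_swap W, lieBr_swap W']; abel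

theorem lieBr_smul_right {V W : VField N} {x : Fin N → ℝ} (c : ℂ)
    (hW : DifferentiableAt ℝ W x) : lieBr V (c • W) x = c • lieBr V W x := by
  rw [lieBr_swap, lieBr_smul_left c hW, lieBr_swap W, smul_neg, neg_neg]

theorem lieBr_conjField {V W : VField N} {x : Fin N → ℝ}
    (hV : DifferentiableAt ℝ V x) (hW : DifferentiableAt ℝ W x) :
    lieBr (conjField V) (conjField W) x = star (lieBr V W x) := by
  simp [lieBr, dirDeriv_conjField hV, dirDeriv_conjField hW]

theorem lieBr_of_left_eq_zero {V : VField N} {x : Fin N → ℝ} (hV : V x = 0) (W : VField N) :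
    lieBr V W x = -dirDerivL V x (W x) := by
  simp only [lieBr, hV, ← dirDerivL_apply, map_zero, zero_sub]

/-- The second derivative of a complex vector field, extended complex bilinearly. -/
noncomputable def hessC (W : VField N) (x : Fin N → ℝ) (u v : Fin N → ℂ) : Fin N → ℂ :=
  (fderiv ℝ (fderiv ℝ W) x (rePart N u) (rePart N v)
    - fderiv ℝ (fderiv ℝ W) x (imPart N u) (imPart N v))
  + Complex.I • (fderiv ℝ (fderiv ℝ W) x (rePart N u) (imPart N v)
    + fderiv ℝ (fderiv ℝ W) x (imPart N u) (rePart N v))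

theorem hessC_symm {W : VField N} {x : Fin N → ℝ} (hW : ContDiffAt ℝ ∞ W x)
    (u v : Fin N → ℂ) : hessC W x u v = hessC W x v u := by
  have h : IsSymmSndFDerivAt ℝ W x :=
    hW.isSymmSndFDerivAt (by simpa using WithTop.coe_le_coe.2 (le_top (a := (2 : ℕ∞))))
  simp only [hessC]
  rw [h.eq (rePart N u), h.eq (imPart N u), h.eq (rePart N u), h.eq (imPart N u)]
  congr 2; abel

theorem fderiv_dirDeriv {V W : VField N} {x : Fin N → ℝ} (hW : ContDiffAt ℝ ∞ W x)
    (hV : DifferentiableAt ℝ V x) (u : Fin N → ℝ) :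
    fderiv ℝ (fun y => dirDeriv W y (V y)) x u
      = fderiv ℝ (fderiv ℝ W) x u (rePart N (V x))
        + Complex.I • fderiv ℝ (fderiv ℝ W) x u (imPart N (V x))
        + dirDeriv W x (fderiv ℝ V x u) := by
  have h1 : DifferentiableAt ℝ (fderiv ℝ W) x :=
    (hW.fderiv_right (m := 1) (by norm_cast)).differentiableAt (by simp)
  have hr : HasFDerivAt (fun y => rePart N (V y)) ((rePart N).comp (fderiv ℝ V x)) x :=
    (rePart N).hasFDerivAt.comp x hV.hasFDerivAt
  have hi : HasFDerivAt (fun y => imPart N (V y)) ((imPart N).comp (fderiv ℝ V x)) x :=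
    (imPart N).hasFDerivAt.comp x hV.hasFDerivAt
  have h := (h1.hasFDerivAt.clm_apply hr).add ((h1.hasFDerivAt.clm_apply hi).const_smul Complex.I)
  have h' : fderiv ℝ (fun y => dirDeriv W y (V y)) x = _ := h.fderiv
  rw [h']
  simp [dirDeriv_eq]
  abel

theorem dirDeriv_dirDeriv {V W : VField N} {x : Fin N → ℝ} (hW : ContDiffAt ℝ ∞ W x)
    (hV : DifferentiableAt ℝ V x) (u : Fin N → ℂ) :
    dirDeriv (fun y => dirDeriv W y (V y)) x u
      = hessC W x u (V x) + dirDeriv W x (dirDeriv V x u) := by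
  rw [dirDeriv_eq, fderiv_dirDeriv hW hV, fderiv_dirDeriv hW hV, dirDeriv_eq V,
    ← dirDerivL_apply W x (_ + _), map_add, map_smul, dirDerivL_apply, dirDerivL_apply, hessC]
  ext k
  apply Complex.ext <;> simp <;> ring

theorem contDiffOn_dirDeriv {V W : VField N} {s : Set (Fin N → ℝ)} (hs : IsOpen s)
    (hW : ContDiffOn ℝ ∞ W s) (hV : ContDiffOn ℝ ∞ V s) :
    ContDiffOn ℝ ∞ (fun y => dirDeriv W y (V y)) s := by
  have h1 : ContDiffOn ℝ ∞ (fderiv ℝ W) s := hW.fderiv_of_isOpen hs (by simp)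
  exact (h1.clm_apply ((rePart N).contDiff.comp_contDiffOn hV)).add
    ((h1.clm_apply ((imPart N).contDiff.comp_contDiffOn hV)).const_smul Complex.I)

theorem contDiffOn_lieBr {V W : VField N} {s : Set (Fin N → ℝ)} (hs : IsOpen s)
    (hV : ContDiffOn ℝ ∞ V s) (hW : ContDiffOn ℝ ∞ W s) : ContDiffOn ℝ ∞ (lieBr V W) s :=
  (contDiffOn_dirDeriv hs hW hV).sub (contDiffOn_dirDeriv hs hV hW)

theorem dirDeriv_lieBr {V W : VField N} {x : Fin N → ℝ} (hV : ContDiffAt ℝ ∞ V x)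
    (hW : ContDiffAt ℝ ∞ W x) (u : Fin N → ℂ) :
    dirDeriv (lieBr V W) x u = (hessC W x u (V x) + dirDeriv W x (dirDeriv V x u))
      - (hessC V x u (W x) + dirDeriv V x (dirDeriv W x u)) := by
  have key : ∀ {V W : VField N}, ContDiffAt ℝ ∞ V x → ContDiffAt ℝ ∞ W x →
      DifferentiableAt ℝ (fun y => dirDeriv W y (V y)) x := by
    intro V W hV hW
    have h1 : DifferentiableAt ℝ (fderiv ℝ W) x :=
      (hW.fderiv_right (m := 1) (by norm_cast)).differentiableAt (by simp)
    have h2 : DifferentiableAt ℝ V x := hV.differentiableAt (by simp)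
    exact (h1.clm_apply ((rePart N).differentiableAt.comp x h2)).add
      ((h1.clm_apply ((imPart N).differentiableAt.comp x h2)).const_smul Complex.I)
  rw [← dirDeriv_dirDeriv hW (hV.differentiableAt (by simp)),
    ← dirDeriv_dirDeriv hV (hW.differentiableAt (by simp)),
    ← dirDeriv_sub (key hV hW) (key hW hV)]
  rfl

/-- The Jacobi identity. -/
theorem lieBr_lieBr {X V W : VField N} {x : Fin N → ℝ} (hX : ContDiffAt ℝ ∞ X x)
    (hV : ContDiffAt ℝ ∞ V x) (hW : ContDiffAt ℝ ∞ W x) :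
    lieBr X (lieBr V W) x = lieBr (lieBr X V) W x + lieBr V (lieBr X W) x := by
  have e : ∀ A B : VField N, lieBr A B x = dirDeriv B x (A x) - dirDeriv A x (B x) :=
    fun _ _ => rfl
  rw [e X, e (lieBr X V) W, e V (lieBr X W), dirDeriv_lieBr hV hW,
    dirDeriv_lieBr hX hV, dirDeriv_lieBr hX hW,
    e V W, e X V, e X W]
  simp only [← dirDerivL_apply, map_sub]
  -- The second-order terms cancel in pairs that differ only in the order of their two arguments.
  rw [hessC_symm hX (V x), hessC_symm hV (W x), hessC_symm hW (X x)]
  abel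

/-- At a common zero the second derivatives are evaluated on a zero vector and drop out, so that
brackets become commutators. The reversed order of composition is absorbed by the sign in `linPart`.
-/
theorem dirDerivL_lieBr {V W : VField N} {x : Fin N → ℝ} (hV : ContDiffAt ℝ ∞ V x)
    (hW : ContDiffAt ℝ ∞ W x) (hV0 : V x = 0) (hW0 : W x = 0) :
    dirDerivL (lieBr V W) x
      = dirDerivL W x ∘ₗ dirDerivL V x - dirDerivL V x ∘ₗ dirDerivL W x := by
  have h0 : ∀ (A : VField N) (u : Fin N → ℂ), hessC A x u 0 = 0 := by
    intro A u; simp [hessC]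
  refine LinearMap.ext fun u => ?_
  simp [dirDerivL_apply, dirDeriv_lieBr hV hW, hV0, hW0, h0]

end Calculus

/-! ## Sections of distributions -/

section Sections

variable {N : ℕ} {U : TopologicalSpace.Opens (Fin N → ℝ)} {D D' : Distr N} {V W : VField N}
  {x : Fin N → ℝ}

/-- The complex conjugate of a distribution. -/
def conjDistr (D : Distr N) : Distr N := fun x => conjSub (D x)

theorem mem_conjSub {S : Submodule ℂ (Fin N → ℂ)} {v : Fin N → ℂ} :
    v ∈ conjSub S ↔ star v ∈ S := Iff.rfl

theorem IsSection.contDiffAt (hV : IsSection U D V) (hx : x ∈ U) : ContDiffAt ℝ ∞ V x :=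
  hV.1.contDiffAt (U.isOpen.mem_nhds hx)

theorem IsSection.add (hV : IsSection U D V) (hW : IsSection U D W) : IsSection U D (V + W) :=
  ⟨hV.1.add hW.1, fun x hx => (D x).add_mem (hV.2 x hx) (hW.2 x hx)⟩

theorem IsSection.sub (hV : IsSection U D V) (hW : IsSection U D W) : IsSection U D (V - W) :=
  ⟨hV.1.sub hW.1, fun x hx => (D x).sub_mem (hV.2 x hx) (hW.2 x hx)⟩

theorem IsSection.smul (c : ℂ) (hV : IsSection U D V) : IsSection U D (c • V) :=
  ⟨hV.1.const_smul c, fun x hx => (D x).smul_mem c (hV.2 x hx)⟩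

theorem IsSection.zero : IsSection U D (0 : VField N) :=
  ⟨contDiffOn_const, fun x _ => (D x).zero_mem⟩

theorem IsSection.sum {ι : Type*} (s : Finset ι) {F : ι → VField N}
    (hF : ∀ i ∈ s, IsSection U D (F i)) : IsSection U D (∑ i ∈ s, F i) :=
  Finset.sum_induction _ (IsSection U D) (fun _ _ => IsSection.add) IsSection.zero hF

theorem IsSection.mono (h : ∀ x ∈ U, D x ≤ D' x) (hV : IsSection U D V) : IsSection U D' V :=
  ⟨hV.1, fun x hx => h x hx (hV.2 x hx)⟩

theorem IsSection.conj (hV : IsSection U D V) : IsSection U (conjDistr D) (conjField V) :=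
  ⟨hV.1.conjField, fun x hx => by simpa [conjDistr, mem_conjSub] using hV.2 x hx⟩

theorem IsSection.of_conj (hV : IsSection U (conjDistr D) V) : IsSection U D (conjField V) :=
  ⟨hV.1.conjField, fun x hx => hV.2 x hx⟩

theorem finrank_conjSub (S : Submodule ℂ (Fin N → ℂ)) :
    Module.finrank ℂ (conjSub S) = Module.finrank ℂ S := by
  -- Conjugation is only semilinear, so the ranks are compared along a pair of bijections, one of
  -- scalars and one of vectors.
  have h := rank_eq_of_equiv_equiv (R := ℂ) (R' := ℂ) (M := conjSub S) (M₁ := S) (star : ℂ → ℂ)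
    { toFun := fun v => ⟨star v.1, v.2⟩
      invFun := fun v => ⟨star v.1, by rw [mem_conjSub, star_star]; exact v.2⟩
      left_inv := fun v => by ext1; simp
      right_inv := fun v => by ext1; simp
      map_add' := fun v w => by ext1; simp } star_involutive.bijective
    (fun c v => by ext1; simp)
  exact congrArg Cardinal.toNat h

theorem IsDistribution.conj {k : ℕ} (hD : IsDistribution U D k) :
    IsDistribution U (conjDistr D) k where
  rank x hx := (finrank_conjSub _).trans (hD.rank x hx)
  smooth x hx v hv := by
    obtain ⟨V, hV, h⟩ := hD.smooth x hx (star v) hv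
    exact ⟨conjField V, hV.conj, by simp [h]⟩

theorem IsDistribution.sup {k k' : ℕ} (hD : IsDistribution U D k) (hD' : IsDistribution U D' k')
    (h : ∀ x ∈ U, D x ⊓ D' x = ⊥) : IsDistribution U (fun x => D x ⊔ D' x) (k + k') where
  rank x hx := by
    have := Submodule.finrank_sup_add_finrank_inf_eq (D x) (D' x)
    rwa [h x hx, finrank_bot, add_zero, hD.rank x hx, hD'.rank x hx] at this
  smooth x hx v hv := by
    obtain ⟨a, ha, b, hb, rfl⟩ := Submodule.mem_sup.1 hv
    obtain ⟨A, hA, rfl⟩ := hD.smooth x hx a ha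
    obtain ⟨B, hB, rfl⟩ := hD'.smooth x hx b hb
    exact ⟨A + B, (hA.mono fun _ _ => le_sup_left).add (hB.mono fun _ _ => le_sup_right), rfl⟩

/-- The differential of a section of `D` at one of its zeros takes values in `D`. -/
theorem IsDistribution.fderiv_mem {k : ℕ} (hD : IsDistribution U D k) (hV : IsSection U D V)
    (hx : x ∈ U) (hV0 : V x = 0) (u : Fin N → ℝ) : fderiv ℝ V x u ∈ D x := by
  -- Otherwise the quotients t⁻¹ V(x + tu), which tend to the derivative, together with a frame of D
  -- would give k + 1 vectors of D(x + tu). They would be independent for small t ≠ 0, because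
  -- independence is an open condition, against the rank k.
  by_contra hu
  let b := Module.finBasisOfFinrankEq ℂ (D x) (hD.rank x hx)
  choose d hd hdx using fun i => hD.smooth x hx (b i) (b i).2
  have hb : LinearIndependent ℂ (fun i => d i x) := by
    have : (fun i => d i x) = (D x).subtype ∘ b := by funext i; simp [hdx]
    rw [this]
    exact b.linearIndependent.map' _ (Submodule.ker_subtype _)
  have hspan : Submodule.span ℂ (Set.range fun i => d i x) ≤ D x := by
    rw [Submodule.span_le]
    rintro _ ⟨i, rfl⟩
    exact (hd i).2 x hx
  have hli : LinearIndependent ℂ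
      (fun o : Option (Fin k) => o.elim (fderiv ℝ V x u) (fun i => d i x)) := by
    rw [linearIndependent_option]
    exact ⟨hb, fun h => hu (hspan h)⟩
  have hline : Filter.Tendsto (fun t : ℝ => x + t • u) (nhdsWithin 0 {0}ᶜ) (nhds x) := by
    have : Filter.Tendsto (fun t : ℝ => x + t • u) (nhds 0) (nhds (x + (0 : ℝ) • u)) :=
      Continuous.tendsto (by fun_prop) 0
    rw [zero_smul, add_zero] at this
    exact this.mono_left nhdsWithin_le_nhds
  have hlim : Filter.Tendsto (fun (t : ℝ) (o : Option (Fin k)) =>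
      o.elim (t⁻¹ • V (x + t • u)) (fun i => d i (x + t • u))) (nhdsWithin 0 {0}ᶜ)
      (nhds (fun o : Option (Fin k) => o.elim (fderiv ℝ V x u) (fun i => d i x))) := by
    rw [tendsto_pi_nhds]
    rintro (_ | i)
    · have h := ((hV.differentiableAt hx).hasFDerivAt.hasLineDerivAt u)
      have h2 := h.tendsto_slope_zero
      simpa [hV0] using h2
    · exact ((hd i).contDiffAt hx).continuousAt.tendsto.comp hline
  have hev := hlim.eventually (isOpen_setOfPred_linearIndependent.mem_nhds hli)
  have hU := hline.eventually (U.isOpen.mem_nhds hx)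
  obtain ⟨t, ht, htU⟩ := (hev.and hU).exists
  let w : Option (Fin k) → D (x + t • u) := fun o => o.elim
    ⟨t⁻¹ • V (x + t • u), by
      have := (D (x + t • u)).smul_mem ((t⁻¹ : ℝ) : ℂ) (hV.2 _ htU)
      rwa [Complex.coe_smul] at this⟩
    (fun i => ⟨d i (x + t • u), (hd i).2 _ htU⟩)
  have hw : LinearIndependent ℂ w := by
    refine LinearIndependent.of_comp (D (x + t • u)).subtype ?_
    have e : (D (x + t • u)).subtype ∘ w
        = fun o => o.elim (t⁻¹ • V (x + t • u)) (fun i => d i (x + t • u)) := by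
      funext o
      cases o <;> rfl
    rw [e]
    exact ht
  have := hw.fintype_card_le_finrank
  rw [hD.rank _ htU] at this
  simp at this

theorem IsDistribution.dirDeriv_mem {k : ℕ} (hD : IsDistribution U D k) (hV : IsSection U D V)
    (hx : x ∈ U) (hV0 : V x = 0) (u : Fin N → ℂ) : dirDeriv V x u ∈ D x :=
  (D x).add_mem (hD.fderiv_mem hV hx hV0 _)
    ((D x).smul_mem _ (hD.fderiv_mem hV hx hV0 _))

/-- This plays the role of tensoriality: modulo D, a bracket at x with a section of D depends only
on the value of that section at x. Sections can then be replaced by any others with the same value,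
without local frames. -/
theorem IsDistribution.lieBr_mem_of_eq_zero {k : ℕ} (hD : IsDistribution U D k)
    (hV : IsSection U D V) (hx : x ∈ U) (hV0 : V x = 0) (W : VField N) :
    lieBr V W x ∈ D x := by
  rw [lieBr_of_left_eq_zero hV0]
  exact (D x).neg_mem (hD.dirDeriv_mem hV hx hV0 _)

theorem IsDistribution.lieBr_mem_of_right_eq_zero {k : ℕ} (hD : IsDistribution U D k)
    (hV : IsSection U D V) (hx : x ∈ U) (hV0 : V x = 0) (W : VField N) :
    lieBr W V x ∈ D x := by
  rw [lieBr_swap]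
  exact (D x).neg_mem (hD.lieBr_mem_of_eq_zero hV hx hV0 _)

/-- Membership of a bracket with a section of `D ⊔ D'` can be tested on sections of `D` and
of `D'`. -/
theorem IsDistribution.lieBr_mem_of_sup {k k' l : ℕ} (hD : IsDistribution U D k)
    (hD' : IsDistribution U D' k') (hs : IsDistribution U (fun x => D x ⊔ D' x) l)
    (hV : IsSection U (fun x => D x ⊔ D' x) V) (hx : x ∈ U) {X : VField N}
    {S : Submodule ℂ (Fin N → ℂ)} (hS : D x ⊔ D' x ≤ S)
    (h : ∀ A, IsSection U D A → lieBr X A x ∈ S) (h' : ∀ A, IsSection U D' A → lieBr X A x ∈ S) :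
    lieBr X V x ∈ S := by
  obtain ⟨a, ha, b, hb, hab⟩ := Submodule.mem_sup.1 (hV.2 x hx)
  obtain ⟨A, hA, rfl⟩ := hD.smooth x hx a ha
  obtain ⟨B, hB, rfl⟩ := hD'.smooth x hx b hb
  have hAB : IsSection U (fun x => D x ⊔ D' x) (A + B) :=
    (hA.mono fun _ _ => le_sup_left).add (hB.mono fun _ _ => le_sup_right)
  -- V and A + B need to agree only at x; their difference is a section of the sum that vanishes
  -- there.
  have h0 : lieBr X (V - (A + B)) x ∈ S :=
    hS (hs.lieBr_mem_of_right_eq_zero (hV.sub hAB) hx (by simp [← hab]) X)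
  rw [lieBr_sub_right (hV.differentiableAt hx) (hAB.differentiableAt hx),
    lieBr_add_right (hA.differentiableAt hx) (hB.differentiableAt hx)] at h0
  have := S.add_mem h0 (S.add_mem (h A hA) (h' B hB))
  simpa using this

end Sections

theorem lieBr_congr_left {N : ℕ} {V V' W : VField N} {x : Fin N → ℝ} (h : V =ᶠ[nhds x] V') :
    lieBr V W x = lieBr V' W x := by
  simp only [lieBr, dirDeriv_eq]
  rw [h.fderiv_eq, h.eq_of_nhds]

/-! ## The Levi kernel and symmetries -/

section LeviKernel

variable {n : ℕ} {U : TopologicalSpace.Opens (Fin (2 * n + 1) → ℝ)} {H : Distr (2 * n + 1)}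
  {V W X E k : VField (2 * n + 1)} {x : Fin (2 * n + 1) → ℝ} {r : ℕ}

/-- The complexified contact distribution `H ⊕ conj H`. -/
def contactDistr {N : ℕ} (H : Distr N) : Distr N := fun x => H x ⊔ conjDistr H x

theorem star_mem_sup_conj {N : ℕ} {S : Submodule ℂ (Fin N → ℂ)} {v : Fin N → ℂ}
    (h : v ∈ S ⊔ conjSub S) : star v ∈ S ⊔ conjSub S := by
  obtain ⟨a, ha, b, hb, rfl⟩ := Submodule.mem_sup.1 h
  rw [star_add]
  exact Submodule.add_mem _ (Submodule.mem_sup_right (by rwa [mem_conjSub, star_star]))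
    (Submodule.mem_sup_left hb)

theorem IsCRStructure.contact (hC : IsCRStructure U H) :
    IsDistribution U (contactDistr H) (n + n) :=
  hC.distribution.sup hC.distribution.conj hC.totallyReal

theorem leviBr_mem_iff {N : ℕ} {V Y : VField N} {x : Fin N → ℝ} {S : Submodule ℂ (Fin N → ℂ)} :
    leviBr V Y x ∈ S ↔ lieBr V (conjField Y) x ∈ S :=
  S.smul_mem_iff (by simp)

theorem leviKernel_le (hx : x ∈ U) : leviKernel U H x ≤ H x := by
  rintro v (rfl | ⟨-, V, hV, rfl, -⟩)
  · exact (H x).zero_mem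
  · exact hV.2 x hx

theorem mem_leviKernel (hx : x ∈ U) (hV : IsSection U H V)
    (h : ∀ Y, IsSection U H Y → lieBr V (conjField Y) x ∈ contactDistr H x) :
    V x ∈ leviKernel U H x :=
  Or.inr ⟨hx, V, hV, rfl, fun Y hY => leviBr_mem_iff.2 (h Y hY)⟩

theorem IsSection.of_leviKernel (hk : IsSection U (leviKernel U H) k) : IsSection U H k :=
  hk.mono fun _ hx => leviKernel_le hx

theorem IsSection.conj_of_leviKernel (hk : IsSection U (conjDistr (leviKernel U H)) k) :
    IsSection U (conjDistr H) k := by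
  have := hk.of_conj.of_leviKernel.conj
  rwa [conjField_conjField] at this

theorem IsSection.to_contact (hV : IsSection U H V) : IsSection U (contactDistr H) V :=
  hV.mono fun _ _ => le_sup_left

theorem IsSection.conj_to_contact (hV : IsSection U (conjDistr H) V) :
    IsSection U (contactDistr H) V :=
  hV.mono fun _ _ => le_sup_right

/-- The definition of `leviKernel` provides only one good extension of the vector. Any other
extension differs from it by a section of H vanishing at x, and brackets of the latter at x stay in
H. -/
theorem IsCRStructure.lieBr_mem_contact_of_leviKernel (hC : IsCRStructure U H) (hx : x ∈ U)
    (hk : IsSection U H k) (hkx : k x ∈ leviKernel U H x) (hV : IsSection U H V) :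
    lieBr k (conjField V) x ∈ contactDistr H x := by
  have key : ∀ k' : VField (2 * n + 1), IsSection U H k' → k' x = 0 →
      lieBr k' (conjField V) x ∈ contactDistr H x := fun k' h h0 =>
    Submodule.mem_sup_left (hC.distribution.lieBr_mem_of_eq_zero h hx h0 _)
  rcases hkx with h0 | ⟨-, A, hA, hAx, h⟩
  · exact key k hk h0
  · have h1 := key (k - A) (hk.sub hA) (by simp [hAx])
    rw [lieBr_sub_left (hk.differentiableAt hx) (hA.differentiableAt hx)] at h1
    simpa using Submodule.add_mem _ h1 (leviBr_mem_iff.1 (h V hV))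

theorem IsCRStructure.lieBr_leviKernel_conj (hC : IsCRStructure U H) (hx : x ∈ U)
    (hk : IsSection U (leviKernel U H) k) (hV : IsSection U (conjDistr H) V) :
    lieBr k V x ∈ contactDistr H x := by
  have := hC.lieBr_mem_contact_of_leviKernel hx hk.of_leviKernel (hk.2 x hx) hV.of_conj
  rwa [conjField_conjField] at this

theorem IsCRStructure.lieBr_conj_leviKernel (hC : IsCRStructure U H) (hx : x ∈ U)
    (hk : IsSection U (conjDistr (leviKernel U H)) k) (hV : IsSection U H V) :
    lieBr k V x ∈ contactDistr H x := by
  have h := star_mem_sup_conj (hC.lieBr_leviKernel_conj hx hk.of_conj hV.conj)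
  rw [lieBr_conjField (hk.differentiableAt hx) (hV.differentiableAt hx), star_star] at h
  exact h

theorem IsCRStructure.lieBr_conj_conj (hC : IsCRStructure U H) (hx : x ∈ U)
    (hV : IsSection U (conjDistr H) V) (hW : IsSection U (conjDistr H) W) :
    lieBr V W x ∈ conjDistr H x := by
  have h := hC.involutive _ _ hV.of_conj hW.of_conj x hx
  rw [lieBr_conjField (hV.differentiableAt hx) (hW.differentiableAt hx)] at h
  exact h

theorem IsCRStructure.lieBr_leviKernel_contact (hC : IsCRStructure U H) (hx : x ∈ U)
    (hk : IsSection U (leviKernel U H) k) (hV : IsSection U (contactDistr H) V) :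
    lieBr k V x ∈ contactDistr H x :=
  hC.distribution.lieBr_mem_of_sup hC.distribution.conj hC.contact hV hx le_rfl
    (fun _ hA => Submodule.mem_sup_left (hC.involutive _ _ hk.of_leviKernel hA x hx))
    (fun _ hA => hC.lieBr_leviKernel_conj hx hk hA)

theorem IsCRStructure.lieBr_conj_leviKernel_contact (hC : IsCRStructure U H) (hx : x ∈ U)
    (hk : IsSection U (conjDistr (leviKernel U H)) k) (hV : IsSection U (contactDistr H) V) :
    lieBr k V x ∈ contactDistr H x :=
  hC.distribution.lieBr_mem_of_sup hC.distribution.conj hC.contact hV hx le_rfl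
    (fun _ hA => hC.lieBr_conj_leviKernel hx hk hA)
    (fun _ hA => Submodule.mem_sup_right (hC.lieBr_conj_conj hx
      hk.conj_of_leviKernel hA))

theorem IsSection.lieBr {N : ℕ} {U : TopologicalSpace.Opens (Fin N → ℝ)} {D D₁ D₂ : Distr N}
    {V W : VField N} (hV : IsSection U D₁ V) (hW : IsSection U D₂ W)
    (h : ∀ x ∈ U, lieBr V W x ∈ D x) : IsSection U D (lieBr V W) :=
  ⟨contDiffOn_lieBr U.isOpen hV.1 hW.1, h⟩

/-- The Levi kernel is involutive. -/
theorem IsCRStructure.lieBr_leviKernel_leviKernel (hC : IsCRStructure U H) (hx : x ∈ U)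
    (hk : IsSection U (leviKernel U H) k) (hV : IsSection U (leviKernel U H) V) :
    lieBr k V x ∈ leviKernel U H x := by
  have hkV : IsSection U H (CRGeom.lieBr k V) :=
    hk.lieBr hV fun y hy => hC.involutive _ _ hk.of_leviKernel hV.of_leviKernel y hy
  refine mem_leviKernel hx hkV fun Y hY => ?_
  -- Jacobi: [[k, V], Ȳ] = [k, [V, Ȳ]] − [V, [k, Ȳ]], and sections of K preserve H ⊕ H̄.
  have h := lieBr_lieBr (hk.contDiffAt hx) (hV.contDiffAt hx) (hY.conj.contDiffAt hx)
  have h1 := hC.lieBr_leviKernel_contact hx hk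
    (hV.lieBr hY.conj fun y hy => hC.lieBr_leviKernel_conj hy hV hY.conj)
  have h2 := hC.lieBr_leviKernel_contact hx hV
    (hk.lieBr hY.conj fun y hy => hC.lieBr_leviKernel_conj hy hk hY.conj)
  rw [eq_sub_of_add_eq h.symm]
  exact Submodule.sub_mem _ h1 h2

/-- The sum `K ⊕ conj K` is involutive. -/
theorem IsCRStructure.lieBr_leviKernel_conj_leviKernel (hC : IsCRStructure U H) (hx : x ∈ U)
    (hk : IsSection U (leviKernel U H) k) (hV : IsSection U (leviKernel U H) V) :
    lieBr k (conjField V) x ∈ contactDistr (leviKernel U H) x := by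
  -- The H-component A of [k, V̄] lies in K. Indeed [[k, V̄], Ȳ] lies in H ⊕ H̄ by the Jacobi
  -- identity, and [B, Ȳ] lies in H̄ by involutivity, which leaves [A, Ȳ].
  have key : ∀ {k V : VField (2 * n + 1)}, IsSection U (leviKernel U H) k →
      IsSection U (leviKernel U H) V → ∀ {A B : VField (2 * n + 1)}, IsSection U H A →
      IsSection U (conjDistr H) B → A x + B x = CRGeom.lieBr k (conjField V) x →
      A x ∈ leviKernel U H x := by
    intro k V hk hV A B hA hB hAB
    have hkV : IsSection U (contactDistr H) (CRGeom.lieBr k (conjField V)) :=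
      hk.lieBr hV.conj fun y hy => hC.lieBr_leviKernel_conj hy hk hV.of_leviKernel.conj
    refine mem_leviKernel hx hA fun Y hY => ?_
    have hs := hkV.sub (hA.to_contact.add hB.conj_to_contact)
    have h0 := hC.contact.lieBr_mem_of_eq_zero hs hx (by simp [hAB]) (conjField Y)
    rw [lieBr_sub_left (hkV.differentiableAt hx)
      ((hA.differentiableAt hx).add (hB.differentiableAt hx)),
      lieBr_add_left (hA.differentiableAt hx) (hB.differentiableAt hx)] at h0
    have hB' : CRGeom.lieBr B (conjField Y) x ∈ contactDistr H x :=
      Submodule.mem_sup_right (hC.lieBr_conj_conj hx hB hY.conj)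
    have h := lieBr_lieBr (hk.contDiffAt hx) (hV.conj.contDiffAt hx) (hY.conj.contDiffAt hx)
    have h1 := hC.lieBr_leviKernel_contact hx hk
      (hV.conj.lieBr hY.conj (D := contactDistr H) fun y hy => Submodule.mem_sup_right
        (hC.lieBr_conj_conj hy hV.of_leviKernel.conj hY.conj))
    have h2 := hC.lieBr_conj_leviKernel_contact hx hV.conj
      (hk.lieBr hY.conj fun y hy => hC.lieBr_leviKernel_conj hy hk hY.conj)
    have h3 : CRGeom.lieBr (CRGeom.lieBr k (conjField V)) (conjField Y) x ∈ contactDistr H x := by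
      rw [eq_sub_of_add_eq h.symm]
      exact Submodule.sub_mem _ h1 h2
    have := Submodule.sub_mem _ (Submodule.sub_mem _ h3 h0) hB'
    simpa using this
  obtain ⟨a, ha, b, hb, hab⟩ :=
    Submodule.mem_sup.1 (hC.lieBr_leviKernel_conj hx hk hV.of_leviKernel.conj)
  obtain ⟨A, hA, rfl⟩ := hC.distribution.smooth x hx a ha
  obtain ⟨B, hB, rfl⟩ := hC.distribution.conj.smooth x hx b hb
  rw [← hab]
  refine Submodule.add_mem _ (Submodule.mem_sup_left (key hk hV hA hB hab))
    (Submodule.mem_sup_right ?_)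
  -- Conjugation turns [k, V̄] into [−V, k̄] and exchanges the two components, so the same claim
  -- covers the H̄-component.
  refine key (k := -V) (V := k) (A := conjField B) (B := conjField A) ?_ hk hB.of_conj hA.conj ?_
  · simpa using hV.smul (-1)
  · have h1 : CRGeom.lieBr (-V) (conjField k) x = -CRGeom.lieBr V (conjField k) x := by
      simpa using lieBr_smul_left (W := conjField k) (-1) (hV.differentiableAt hx)
    have h2 := lieBr_conjField (hk.conj.differentiableAt hx) (hV.differentiableAt hx)
    rw [conjField_conjField] at h2
    rw [h1, lieBr_swap, neg_neg, ← conjField_conjField V,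
      lieBr_conjField (hk.differentiableAt hx) (hV.conj.differentiableAt hx), ← hab]
    simp [add_comm]

/-- A complex vector field whose real and imaginary parts are infinitesimal symmetries of `H`. -/
structure IsComplexSymmetry (U : TopologicalSpace.Opens (Fin (2 * n + 1) → ℝ))
    (H : Distr (2 * n + 1)) (X : VField (2 * n + 1)) : Prop where
  smooth : ContDiffOn ℝ ∞ X U
  lieBr_mem : ∀ V, IsSection U H V → ∀ x ∈ U, lieBr X V x ∈ H x
  lieBr_conj_mem : ∀ V, IsSection U H V → ∀ x ∈ U, lieBr (conjField X) V x ∈ H x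

/-! ### The algebra of complexified symmetries and the distributions they preserve. -/

namespace IsComplexSymmetry

variable {Y : VField (2 * n + 1)}

theorem contDiffAt (hX : IsComplexSymmetry U H X) (hx : x ∈ U) : ContDiffAt ℝ ∞ X x :=
  hX.smooth.contDiffAt (U.isOpen.mem_nhds hx)

theorem differentiableAt (hX : IsComplexSymmetry U H X) (hx : x ∈ U) : DifferentiableAt ℝ X x :=
  (hX.contDiffAt hx).differentiableAt (by simp)

theorem conj (hX : IsComplexSymmetry U H X) : IsComplexSymmetry U H (conjField X) :=
  ⟨hX.smooth.conjField, hX.lieBr_conj_mem, by simpa using hX.lieBr_mem⟩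

theorem zero : IsComplexSymmetry U H (0 : VField (2 * n + 1)) := by
  have h : ∀ V : VField (2 * n + 1), ∀ x, CRGeom.lieBr (0 : VField (2 * n + 1)) V x = 0 := by
    intro V x
    rw [lieBr_of_left_eq_zero (by simp)]
    simp [dirDerivL_apply, dirDeriv_eq]
  have h' : conjField (0 : VField (2 * n + 1)) = 0 := by funext x; simp
  exact ⟨contDiffOn_const, fun V _ x _ => by simp [h], fun V _ x _ => by simp [h, h']⟩

theorem add (hX : IsComplexSymmetry U H X) (hY : IsComplexSymmetry U H Y) :
    IsComplexSymmetry U H (X + Y) := by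
  refine ⟨hX.smooth.add hY.smooth, fun V hV x hx => ?_, fun V hV x hx => ?_⟩
  · rw [lieBr_add_left (hX.differentiableAt hx) (hY.differentiableAt hx)]
    exact (H x).add_mem (hX.lieBr_mem V hV x hx) (hY.lieBr_mem V hV x hx)
  · have h : conjField (X + Y) = conjField X + conjField Y := by funext x; simp
    rw [h, lieBr_add_left (hX.conj.differentiableAt hx) (hY.conj.differentiableAt hx)]
    exact (H x).add_mem (hX.lieBr_conj_mem V hV x hx) (hY.lieBr_conj_mem V hV x hx)

theorem smul (c : ℂ) (hX : IsComplexSymmetry U H X) : IsComplexSymmetry U H (c • X) := by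
  refine ⟨hX.smooth.const_smul c, fun V hV x hx => ?_, fun V hV x hx => ?_⟩
  · rw [lieBr_smul_left c (hX.differentiableAt hx)]
    exact (H x).smul_mem c (hX.lieBr_mem V hV x hx)
  · have h : conjField (c • X) = star c • conjField X := by funext x; simp
    rw [h, lieBr_smul_left _ (hX.conj.differentiableAt hx)]
    exact (H x).smul_mem _ (hX.lieBr_conj_mem V hV x hx)

theorem sum {ι : Type*} (s : Finset ι) {F : ι → VField (2 * n + 1)}
    (hF : ∀ i ∈ s, IsComplexSymmetry U H (F i)) : IsComplexSymmetry U H (∑ i ∈ s, F i) :=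
  Finset.sum_induction _ (IsComplexSymmetry U H) (fun _ _ => add) zero hF

theorem isSection_lieBr (hX : IsComplexSymmetry U H X) (hV : IsSection U H V) :
    IsSection U H (CRGeom.lieBr X V) :=
  ⟨contDiffOn_lieBr U.isOpen hX.smooth hV.1, hX.lieBr_mem V hV⟩

theorem lieBr (hX : IsComplexSymmetry U H X) (hY : IsComplexSymmetry U H Y) :
    IsComplexSymmetry U H (CRGeom.lieBr X Y) := by
  have key : ∀ {X Y : VField (2 * n + 1)}, IsComplexSymmetry U H X → IsComplexSymmetry U H Y →
      ∀ V, IsSection U H V → ∀ x ∈ U, CRGeom.lieBr (CRGeom.lieBr X Y) V x ∈ H x := by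
    intro X Y hX hY V hV x hx
    have h := lieBr_lieBr (hX.contDiffAt hx) (hY.contDiffAt hx) (hV.contDiffAt hx)
    rw [eq_sub_of_add_eq h.symm]
    exact (H x).sub_mem (hX.lieBr_mem _ (hY.isSection_lieBr hV) x hx)
      (hY.lieBr_mem _ (hX.isSection_lieBr hV) x hx)
  refine ⟨contDiffOn_lieBr U.isOpen hX.smooth hY.smooth, key hX hY, fun V hV x hx => ?_⟩
  -- Conjugation commutes with the bracket where the fields are differentiable, which is known on U;
  -- an equality of germs at x suffices.
  have h : conjField (CRGeom.lieBr X Y) =ᶠ[nhds x]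
      CRGeom.lieBr (conjField X) (conjField Y) := by
    filter_upwards [U.isOpen.mem_nhds hx] with y hy
    exact (lieBr_conjField (hX.differentiableAt hy) (hY.differentiableAt hy)).symm
  rw [lieBr_congr_left h]
  exact key hX.conj hY.conj V hV x hx

theorem lieBr_conj (hX : IsComplexSymmetry U H X) (hV : IsSection U (conjDistr H) V)
    (hx : x ∈ U) : CRGeom.lieBr X V x ∈ conjDistr H x := by
  have h := hX.lieBr_conj_mem _ hV.of_conj x hx
  rwa [lieBr_conjField (hX.differentiableAt hx) (hV.differentiableAt hx)] at h

theorem lieBr_contact (hX : IsComplexSymmetry U H X) (hC : IsCRStructure U H)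
    (hV : IsSection U (contactDistr H) V) (hx : x ∈ U) :
    CRGeom.lieBr X V x ∈ contactDistr H x :=
  hC.distribution.lieBr_mem_of_sup hC.distribution.conj hC.contact hV hx le_rfl
    (fun A hA => Submodule.mem_sup_left (hX.lieBr_mem A hA x hx))
    (fun _ hA => Submodule.mem_sup_right (hX.lieBr_conj hA hx))

/-- Symmetries preserve the Levi kernel. -/
theorem lieBr_leviKernel (hX : IsComplexSymmetry U H X) (hC : IsCRStructure U H)
    (hV : IsSection U (leviKernel U H) V) (hx : x ∈ U) :
    CRGeom.lieBr X V x ∈ leviKernel U H x := by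
  refine mem_leviKernel hx (hX.isSection_lieBr hV.of_leviKernel) fun Y hY => ?_
  have h := lieBr_lieBr (hX.contDiffAt hx) (hV.contDiffAt hx) (hY.conj.contDiffAt hx)
  have h1 := hX.lieBr_contact hC
    (hV.lieBr hY.conj fun y hy => hC.lieBr_leviKernel_conj hy hV hY.conj) hx
  have hXY : IsSection U (conjDistr H) (CRGeom.lieBr X (conjField Y)) :=
    ⟨contDiffOn_lieBr U.isOpen hX.smooth hY.conj.1, fun y hy => hX.lieBr_conj hY.conj hy⟩
  have h2 := hC.lieBr_leviKernel_conj hx hV hXY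
  rw [eq_sub_of_add_eq h.symm]
  exact Submodule.sub_mem _ h1 h2

theorem lieBr_conj_leviKernel (hX : IsComplexSymmetry U H X) (hC : IsCRStructure U H)
    (hV : IsSection U (conjDistr (leviKernel U H)) V) (hx : x ∈ U) :
    CRGeom.lieBr X V x ∈ conjDistr (leviKernel U H) x := by
  have h := hX.conj.lieBr_leviKernel hC hV.of_conj hx
  rwa [lieBr_conjField (hX.differentiableAt hx) (hV.differentiableAt hx)] at h

end IsComplexSymmetry

/-- Vectors of K_p are complex, so matching them requires combinations X + iY of real symmetries. -/
theorem IsLocallyHomogeneous.exists_isComplexSymmetry (hH : IsLocallyHomogeneous U H) (hx : x ∈ U)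
    (v : Fin (2 * n + 1) → ℂ) : ∃ X, IsComplexSymmetry U H X ∧ X x = v := by
  have key : ∀ X : (Fin (2 * n + 1) → ℝ) → (Fin (2 * n + 1) → ℝ),
      IsInfinitesimalSymmetry U H X → IsComplexSymmetry U H (fun y => toComplex (X y)) := by
    intro X hX
    have hc : conjField (fun y => toComplex (X y)) = fun y => toComplex (X y) := by
      funext y k; simp [toComplex]
    refine ⟨?_, hX.2, by rw [hc]; exact hX.2⟩
    rw [contDiffOn_pi]
    exact fun k => Complex.ofRealCLM.contDiff.comp_contDiffOn (contDiffOn_pi.1 hX.1 k)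
  obtain ⟨X, hX, hXx⟩ := hH x hx (rePart _ v)
  obtain ⟨Y, hY, hYx⟩ := hH x hx (imPart _ v)
  refine ⟨_, (key X hX).add ((key Y hY).smul Complex.I), ?_⟩
  funext k
  simp only [Pi.add_apply, Pi.smul_apply, hXx, hYx, toComplex, smul_eq_mul, rePart, imPart]
  exact (congrArg _ (mul_comm _ _)).trans (Complex.re_add_im (v k))

/-- A vector field that preserves `H`, `H ⊕ conj H`, the Levi kernel `K`, and `K ⊕ conj K`, as far
as brackets with sections of `H`, `conj H`, `K` and `conj K` are concerned. -/
structure IsAdapted (U : TopologicalSpace.Opens (Fin (2 * n + 1) → ℝ))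
    (H : Distr (2 * n + 1)) (E : VField (2 * n + 1)) : Prop where
  smooth : ContDiffOn ℝ ∞ E U
  lieBr_mem : ∀ V, IsSection U H V → ∀ x ∈ U, lieBr E V x ∈ H x
  lieBr_conj : ∀ V, IsSection U (conjDistr H) V → ∀ x ∈ U, lieBr E V x ∈ contactDistr H x
  lieBr_leviKernel : ∀ V, IsSection U (leviKernel U H) V → ∀ x ∈ U,
    lieBr E V x ∈ leviKernel U H x
  lieBr_conj_leviKernel : ∀ V, IsSection U (conjDistr (leviKernel U H)) V → ∀ x ∈ U,
    lieBr E V x ∈ contactDistr (leviKernel U H) x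

theorem IsComplexSymmetry.isAdapted (hX : IsComplexSymmetry U H X) (hC : IsCRStructure U H) :
    IsAdapted U H X where
  smooth := hX.smooth
  lieBr_mem := hX.lieBr_mem
  lieBr_conj _ hV _ hx := Submodule.mem_sup_right (hX.lieBr_conj hV hx)
  lieBr_leviKernel _ hV _ hx := hX.lieBr_leviKernel hC hV hx
  lieBr_conj_leviKernel _ hV _ hx := Submodule.mem_sup_right (hX.lieBr_conj_leviKernel hC hV hx)

/-- Sections of K move H̄ only into H ⊕ H̄, and K̄ only into K ⊕ K̄. This is why the two conditions
on conjugate distributions in `IsAdapted` are weaker than those satisfied by symmetries. -/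
theorem IsSection.isAdapted (hk : IsSection U (leviKernel U H) k) (hC : IsCRStructure U H) :
    IsAdapted U H k where
  smooth := hk.1
  lieBr_mem V hV x hx := hC.involutive _ _ hk.of_leviKernel hV x hx
  lieBr_conj _ hV _ hx := hC.lieBr_leviKernel_conj hx hk hV
  lieBr_leviKernel _ hV _ hx := hC.lieBr_leviKernel_leviKernel hx hk hV
  lieBr_conj_leviKernel V hV _ hx := by
    have := hC.lieBr_leviKernel_conj_leviKernel hx hk hV.of_conj
    rwa [conjField_conjField] at this

theorem IsAdapted.sub {E' : VField (2 * n + 1)} (hE : IsAdapted U H E) (hE' : IsAdapted U H E') :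
    IsAdapted U H (E - E') := by
  have h : ∀ V, ∀ x ∈ U, lieBr (E - E') V x = lieBr E V x - lieBr E' V x := fun V x hx =>
    lieBr_sub_left ((hE.smooth.contDiffAt (U.isOpen.mem_nhds hx)).differentiableAt (by simp))
      ((hE'.smooth.contDiffAt (U.isOpen.mem_nhds hx)).differentiableAt (by simp))
  refine ⟨hE.smooth.sub hE'.smooth, ?_, ?_, ?_, ?_⟩ <;> intro V hV x hx <;> rw [h V x hx] <;>
    apply Submodule.sub_mem
  exacts [hE.2 V hV x hx, hE'.2 V hV x hx, hE.3 V hV x hx, hE'.3 V hV x hx,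
    hE.4 V hV x hx, hE'.4 V hV x hx, hE.5 V hV x hx, hE'.5 V hV x hx]

end LeviKernel

/-! ## Matrices of operators on a subquotient -/

section Represents

variable {T I : Type*} [AddCommGroup T] [Module ℂ T] [Fintype I]
  {b : I → T} {S : Submodule ℂ T} {M M' : T →ₗ[ℂ] T} {A A' : Matrix I I ℂ}

/-- `M` preserves `S` and acts modulo `S` on the span of the vectors `b i` by the matrix `A`. -/
structure Represents (b : I → T) (S : Submodule ℂ T) (M : T →ₗ[ℂ] T) (A : Matrix I I ℂ) :
    Prop where
  map_mem : ∀ v ∈ S, M v ∈ S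
  map_basis : ∀ j, M (b j) - ∑ i, A i j • b i ∈ S

theorem Represents.add (h : Represents b S M A) (h' : Represents b S M' A') :
    Represents b S (M + M') (A + A') where
  map_mem v hv := S.add_mem (h.map_mem v hv) (h'.map_mem v hv)
  map_basis j := by
    convert S.add_mem (h.map_basis j) (h'.map_basis j) using 1
    simp only [LinearMap.add_apply, Matrix.add_apply, add_smul, Finset.sum_add_distrib]
    abel

theorem Represents.smul (c : ℂ) (h : Represents b S M A) : Represents b S (c • M) (c • A) where
  map_mem v hv := S.smul_mem c (h.map_mem v hv)
  map_basis j := by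
    convert S.smul_mem c (h.map_basis j) using 1
    simp only [LinearMap.smul_apply, Matrix.smul_apply, smul_sub, Finset.smul_sum, smul_smul,
      smul_eq_mul]

theorem Represents.zero : Represents b S 0 0 where
  map_mem v _ := by simp
  map_basis j := by simp

theorem Represents.sub (h : Represents b S M A) (h' : Represents b S M' A') :
    Represents b S (M - M') (A - A') := by
  simpa [sub_eq_add_neg] using h.add (h'.smul (-1))

theorem Represents.sum {ι : Type*} (s : Finset ι) {M : ι → T →ₗ[ℂ] T} {A : ι → Matrix I I ℂ}
    (h : ∀ i ∈ s, Represents b S (M i) (A i)) :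
    Represents b S (∑ i ∈ s, M i) (∑ i ∈ s, A i) := by
  classical
  induction s using Finset.induction_on with
  | empty => simpa using Represents.zero
  | insert a s ha ih =>
    rw [Finset.sum_insert ha, Finset.sum_insert ha]
    exact (h a (Finset.mem_insert_self a s)).add
      (ih fun i hi => h i (Finset.mem_insert_of_mem hi))

theorem Represents.mul (h : Represents b S M A) (h' : Represents b S M' A') :
    Represents b S (M ∘ₗ M') (A * A') where
  map_mem v hv := h.map_mem _ (h'.map_mem v hv)
  map_basis j := by
    have h1 := h.map_mem _ (h'.map_basis j)
    have h2 : ∑ i, A' i j • (M (b i) - ∑ k, A k i • b k) ∈ S :=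
      S.sum_mem fun i _ => S.smul_mem _ (h.map_basis i)
    convert S.add_mem h1 h2 using 1
    simp only [map_sub, map_sum, map_smul, LinearMap.comp_apply, smul_sub, Finset.sum_sub_distrib,
      Matrix.mul_apply, Finset.sum_smul, Finset.smul_sum, smul_smul]
    rw [Finset.sum_comm]
    simp only [mul_comm (A' _ _)]
    abel

/-- Independence of the b i modulo S makes the matrix well defined, so that two computations of one
linear part yield a matrix equation. -/
theorem Represents.unique (hb : ∀ x : I → ℂ, ∑ i, x i • b i ∈ S → x = 0)
    (h : Represents b S M A) (h' : Represents b S M A') : A = A' := by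
  ext i j
  have h1 := S.sub_mem (h'.map_basis j) (h.map_basis j)
  have h2 : ∑ i, (A i j - A' i j) • b i ∈ S := by
    convert h1 using 1
    simp only [sub_smul, Finset.sum_sub_distrib]
    abel
  exact sub_eq_zero.1 (congrFun (hb _ h2) i)

end Represents

/-! ## The linearized isotropy action at a point -/

/-- Frames of `H / K` and of the Levi kernel `K` at the point `p`, a transversal real vector `z`,
and the matrix `G` of the Levi form. -/
structure IsLeviFrame {m r : ℕ} (U : TopologicalSpace.Opens (Fin (2 * (m + r) + 1) → ℝ))
    (H : Distr (2 * (m + r) + 1)) (p : Fin (2 * (m + r) + 1) → ℝ)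
    (e : Fin m → VField (2 * (m + r) + 1)) (k : Fin r → VField (2 * (m + r) + 1))
    (z : Fin (2 * (m + r) + 1) → ℂ) (G : Matrix (Fin m) (Fin m) ℂ) : Prop where
  cr : IsCRStructure U H
  kernel : IsDistribution U (leviKernel U H) r
  mem : p ∈ U
  sec : ∀ i, IsSection U H (e i)
  ker_sec : ∀ s, IsSection U (leviKernel U H) (k s)
  indep : LinearIndependent ℂ (Sum.elim (fun i => e i p) (fun s => k s p))
  transversal : z ∉ contactDistr H p
  levi : ∀ i j, leviBr (e i) (e j) p - G i j • z ∈ contactDistr H p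

/-- The linear part at `p` of the vector field `E`, acting on tangent vectors by the bracket when
`E p = 0`. -/
noncomputable def linPart {N : ℕ} (p : Fin N → ℝ) (E : VField N) :
    (Fin N → ℂ) →ₗ[ℂ] (Fin N → ℂ) := -dirDerivL E p

theorem linPart_apply {N : ℕ} {p : Fin N → ℝ} {E : VField N} (hE : E p = 0) (W : VField N) :
    linPart p E (W p) = lieBr E W p := by
  rw [lieBr_of_left_eq_zero hE]; rfl

/-- The vectors `e i` and their conjugates at the point `p`. -/
def realFrame {N : ℕ} {ι : Type*} (e : ι → VField N) (p : Fin N → ℝ) : ι ⊕ ι → (Fin N → ℂ) :=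
  Sum.elim (fun i => e i p) (fun i => star (e i p))

theorem linPart_add {N : ℕ} {p : Fin N → ℝ} {V W : VField N} (hV : DifferentiableAt ℝ V p)
    (hW : DifferentiableAt ℝ W p) : linPart p (V + W) = linPart p V + linPart p W := by
  refine LinearMap.ext fun u => ?_
  simp [linPart, dirDerivL_apply, dirDeriv_add hV hW]
  abel

theorem linPart_smul {N : ℕ} {p : Fin N → ℝ} {V : VField N} (c : ℂ)
    (hV : DifferentiableAt ℝ V p) : linPart p (c • V) = c • linPart p V := by
  refine LinearMap.ext fun u => ?_
  simp [linPart, dirDerivL_apply, dirDeriv_smul c hV]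

theorem linPart_sum {N : ℕ} {ι : Type*} {p : Fin N → ℝ} (s : Finset ι) {V : ι → VField N}
    (hV : ∀ i ∈ s, DifferentiableAt ℝ (V i) p) :
    linPart p (∑ i ∈ s, V i) = ∑ i ∈ s, linPart p (V i) := by
  classical
  induction s using Finset.induction_on with
  | empty =>
    refine LinearMap.ext fun u => ?_
    simp [linPart, dirDerivL_apply, dirDeriv_eq]
  | insert a s ha ih =>
    have h := fun i hi => hV i (Finset.mem_insert_of_mem hi)
    rw [Finset.sum_insert ha, Finset.sum_insert ha,
      linPart_add (hV a (Finset.mem_insert_self a s)) (DifferentiableAt.sum h), ih h]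

theorem linPart_conjField {N : ℕ} {p : Fin N → ℝ} {V : VField N} (hV : DifferentiableAt ℝ V p)
    (v : Fin N → ℂ) : linPart p (conjField V) v = star (linPart p V (star v)) := by
  simp [linPart, dirDerivL_apply, dirDeriv_conjField hV]

theorem linPart_lieBr {N : ℕ} {p : Fin N → ℝ} {V W : VField N} (hV : ContDiffAt ℝ ∞ V p)
    (hW : ContDiffAt ℝ ∞ W p) (hV0 : V p = 0) (hW0 : W p = 0) :
    linPart p (lieBr V W)
      = linPart p V ∘ₗ linPart p W - linPart p W ∘ₗ linPart p V := by
  refine LinearMap.ext fun u => ?_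
  simp [linPart, dirDerivL_lieBr hV hW hV0 hW0]

/-! ### Block matrices of fields vanishing at the point. -/

namespace IsLeviFrame

variable {m r : ℕ} {U : TopologicalSpace.Opens (Fin (2 * (m + r) + 1) → ℝ)}
  {H : Distr (2 * (m + r) + 1)} {p : Fin (2 * (m + r) + 1) → ℝ}
  {e : Fin m → VField (2 * (m + r) + 1)} {k : Fin r → VField (2 * (m + r) + 1)}
  {z : Fin (2 * (m + r) + 1) → ℂ} {G : Matrix (Fin m) (Fin m) ℂ}
  {E X Z : VField (2 * (m + r) + 1)}

theorem span_kernel (F : IsLeviFrame U H p e k z G) {v : Fin (2 * (m + r) + 1) → ℂ}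
    (hv : v ∈ leviKernel U H p) : ∃ a : Fin r → ℂ, v = ∑ s, a s • k s p := by
  have hli : LinearIndependent ℂ (fun s => k s p) := F.indep.comp _ Sum.inr_injective
  have hle : Submodule.span ℂ (Set.range fun s => k s p) ≤ leviKernel U H p := by
    rw [Submodule.span_le]
    rintro _ ⟨s, rfl⟩
    exact (F.ker_sec s).2 p F.mem
  have heq : Submodule.span ℂ (Set.range fun s => k s p) = leviKernel U H p :=
    Submodule.eq_of_le_of_finrank_eq hle (by
      rw [finrank_span_eq_card hli, F.kernel.rank p F.mem, Fintype.card_fin])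
  rw [← heq] at hv
  obtain ⟨a, ha⟩ := (Submodule.mem_span_range_iff_exists_fun ℂ).1 hv
  exact ⟨a, ha.symm⟩

theorem span_H (F : IsLeviFrame U H p e k z G) {v : Fin (2 * (m + r) + 1) → ℂ}
    (hv : v ∈ H p) : ∃ x : Fin m → ℂ, v - ∑ i, x i • e i p ∈ leviKernel U H p := by
  have hle : Submodule.span ℂ (Set.range (Sum.elim (fun i => e i p) (fun s => k s p))) ≤ H p := by
    rw [Submodule.span_le]
    rintro _ ⟨i | s, rfl⟩
    · exact (F.sec i).2 p F.mem
    · exact (F.ker_sec s).of_leviKernel.2 p F.mem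
  have heq := Submodule.eq_of_le_of_finrank_eq hle (by
      rw [finrank_span_eq_card F.indep, F.cr.distribution.rank p F.mem]; simp)
  rw [← heq] at hv
  obtain ⟨a, rfl⟩ := (Submodule.mem_span_range_iff_exists_fun ℂ).1 hv
  refine ⟨fun i => a (Sum.inl i), ?_⟩
  simp only [Fintype.sum_sum_type, Sum.elim_inl, Sum.elim_inr, add_sub_cancel_left]
  exact Submodule.sum_mem _ fun s _ => Submodule.smul_mem _ _ ((F.ker_sec s).2 p F.mem)

/-- The H̄-component vanishes because H ∩ H̄ = 0; what remains is a relation in the frame of H_p. -/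
theorem eq_zero_of_mem (F : IsLeviFrame U H p e k z G) {x : Fin m → ℂ}
    (hx : ∑ i, x i • e i p ∈ leviKernel U H p ⊔ conjDistr H p) : x = 0 := by
  obtain ⟨κ, hκ, h, hh, hsum⟩ := Submodule.mem_sup.1 hx
  have hH : ∑ i, x i • e i p ∈ H p :=
    Submodule.sum_mem _ fun i _ => Submodule.smul_mem _ _ ((F.sec i).2 p F.mem)
  have h0 : h = 0 := by
    have : h ∈ H p ⊓ conjSub (H p) := by
      refine ⟨?_, hh⟩
      rw [eq_sub_of_add_eq' hsum]
      exact (H p).sub_mem hH (leviKernel_le F.mem hκ)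
    rwa [F.cr.totallyReal p F.mem, Submodule.mem_bot] at this
  rw [h0, add_zero] at hsum
  obtain ⟨a, rfl⟩ := F.span_kernel hκ
  have := Fintype.linearIndependent_iff.1 F.indep (Sum.elim x (-a)) (by
    simp [Fintype.sum_sum_type, ← hsum])
  funext i
  exact this (Sum.inl i)

theorem star_sum_smul {N : ℕ} {ι : Type*} [Fintype ι] (x : ι → ℂ) (v : ι → (Fin N → ℂ)) :
    star (∑ i, x i • v i) = ∑ i, star (x i) • star (v i) := by
  rw [star_sum]; simp only [star_smul]

theorem realFrame_indep (F : IsLeviFrame U H p e k z G) (x : Fin m ⊕ Fin m → ℂ)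
    (hx : ∑ i, x i • realFrame e p i ∈ contactDistr (leviKernel U H) p) : x = 0 := by
  have key : ∀ x : Fin m ⊕ Fin m → ℂ,
      ∑ i, x i • realFrame e p i ∈ contactDistr (leviKernel U H) p → ∀ i, x (Sum.inl i) = 0 := by
    intro x hx i
    refine congrFun (F.eq_zero_of_mem (x := fun i => x (Sum.inl i)) ?_) i
    rw [Fintype.sum_sum_type] at hx
    have h1 : ∑ i, x (Sum.inr i) • star (e i p) ∈ conjDistr H p := by
      refine Submodule.sum_mem _ fun i _ => Submodule.smul_mem _ _ ?_
      exact (F.sec i).conj.2 p F.mem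
    have h2 : contactDistr (leviKernel U H) p ≤ leviKernel U H p ⊔ conjDistr H p :=
      sup_le_sup_left (fun _ hv => leviKernel_le F.mem hv) _
    have := Submodule.sub_mem _ (h2 hx) (Submodule.mem_sup_right h1)
    simpa [realFrame] using this
  funext i
  rcases i with i | i
  · exact key x hx i
  -- Conjugation exchanges the two halves of the frame, so the coefficients of the ē_i are handled
  -- by `key` after a swap.
  · have h : ∑ j, star (x j.swap) • realFrame e p j ∈ contactDistr (leviKernel U H) p := by
      have : _ ∈ contactDistr (leviKernel U H) p := star_mem_sup_conj hx
      rw [star_sum_smul] at this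
      convert this using 1
      simp [Fintype.sum_sum_type, realFrame, add_comm]
    simpa using key (fun j => star (x j.swap)) h i

theorem span_contact (F : IsLeviFrame U H p e k z G) {v : Fin (2 * (m + r) + 1) → ℂ}
    (hv : v ∈ contactDistr H p) : ∃ x y : Fin m → ℂ,
      v - (∑ i, x i • e i p + ∑ i, y i • star (e i p)) ∈ contactDistr (leviKernel U H) p := by
  obtain ⟨a, ha, b, hb, rfl⟩ := Submodule.mem_sup.1 hv
  obtain ⟨x, hx⟩ := F.span_H ha
  obtain ⟨y, hy⟩ := F.span_H (show star b ∈ H p from hb)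
  refine ⟨x, fun i => star (y i), ?_⟩
  have hy' : b - ∑ i, star (y i) • star (e i p) ∈ conjDistr (leviKernel U H) p := by
    change star _ ∈ leviKernel U H p
    rw [star_sub, star_sum_smul]
    simpa using hy
  have : _ ∈ contactDistr (leviKernel U H) p :=
    Submodule.add_mem _ (Submodule.mem_sup_left hx) (Submodule.mem_sup_right hy')
  convert this using 1
  abel

/-- H ⊕ H̄ has rank 2(m + r) in dimension 2(m + r) + 1, so it is a hyperplane. -/
theorem exists_smul_transversal (F : IsLeviFrame U H p e k z G)
    (v : Fin (2 * (m + r) + 1) → ℂ) : ∃ c : ℂ, v - c • z ∈ contactDistr H p := by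
  have h1 : Module.finrank ℂ (Submodule.span ℂ {z}) = 1 :=
    finrank_span_singleton (by rintro rfl; exact F.transversal (Submodule.zero_mem _))
  have h2 : contactDistr H p ⊓ Submodule.span ℂ {z} = ⊥ := by
    rw [eq_bot_iff]
    rintro w ⟨hw, hw'⟩
    obtain ⟨c, rfl⟩ := Submodule.mem_span_singleton.1 hw'
    by_cases hc : c = 0
    · simp [hc]
    · exact (F.transversal (((contactDistr H p).smul_mem_iff hc).1 hw)).elim
  have h3 := Submodule.finrank_sup_add_finrank_inf_eq (contactDistr H p) (Submodule.span ℂ {z})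
  rw [h2, finrank_bot, add_zero, h1, F.cr.contact.rank p F.mem] at h3
  have h4 : contactDistr H p ⊔ Submodule.span ℂ {z} = ⊤ :=
    Submodule.eq_top_of_finrank_eq (by rw [h3, Module.finrank_fin_fun]; ring)
  obtain ⟨a, ha, b, hb, rfl⟩ := Submodule.mem_sup.1 (h4 ▸ Submodule.mem_top (x := v))
  obtain ⟨c, rfl⟩ := Submodule.mem_span_singleton.1 hb
  exact ⟨c, by simpa using ha⟩

/-- The action of an adapted vector field vanishing at `p` on `(H ⊕ conj H) / (K ⊕ conj K)`. -/
theorem represents_adapted (F : IsLeviFrame U H p e k z G) (hE : IsAdapted U H E)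
    (hE0 : E p = 0) : ∃ A B D : Matrix (Fin m) (Fin m) ℂ,
      (∀ j, lieBr E (e j) p - ∑ i, A i j • e i p ∈ leviKernel U H p) ∧
      Represents (realFrame e p) (contactDistr (leviKernel U H) p) (linPart p E)
        (Matrix.fromBlocks A B 0 D) := by
  -- As E preserves H, the images of the e_j have no ē-components; this is the zero block.
  choose a ha using fun j => F.span_H (hE.lieBr_mem _ (F.sec j) p F.mem)
  choose x y hxy using fun j => F.span_contact (hE.lieBr_conj _ (F.sec j).conj p F.mem)
  refine ⟨Matrix.of fun i j => a j i, Matrix.of fun i j => x j i,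
    Matrix.of fun i j => y j i, ha, ?_, ?_⟩
  · intro v hv
    obtain ⟨u, hu, w, hw, rfl⟩ := Submodule.mem_sup.1 hv
    obtain ⟨V, hV, rfl⟩ := F.kernel.smooth p F.mem u hu
    obtain ⟨W, hW, rfl⟩ := F.kernel.conj.smooth p F.mem w hw
    rw [map_add, linPart_apply hE0, linPart_apply hE0]
    exact Submodule.add_mem _ (Submodule.mem_sup_left (hE.lieBr_leviKernel V hV p F.mem))
      (hE.lieBr_conj_leviKernel W hW p F.mem)
  · rintro (j | j)
    · refine Submodule.mem_sup_left ?_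
      have := ha j
      rw [← linPart_apply hE0] at this
      simpa [Fintype.sum_sum_type, realFrame] using this
    · have := hxy j
      rw [← linPart_apply hE0] at this
      simpa [Fintype.sum_sum_type, realFrame] using this

/-- Adapted vector fields vanishing at `p` preserve the Levi form up to scale. -/
theorem conformal_of_represents (F : IsLeviFrame U H p e k z G) (hE : IsAdapted U H E)
    (hE0 : E p = 0) {A B D : Matrix (Fin m) (Fin m) ℂ}
    (hA : ∀ j, lieBr E (e j) p - ∑ i, A i j • e i p ∈ leviKernel U H p)
    (h : Represents (realFrame e p) (contactDistr (leviKernel U H) p) (linPart p E)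
        (Matrix.fromBlocks A B 0 D)) : ∃ c : ℂ, c • G = Aᵀ * G + G * D := by
  -- E acts on the transversal line by a scalar c modulo H ⊕ H̄. The claim is the Jacobi identity
  -- for E, e_i, ē_j, read on that line.
  obtain ⟨c, hc⟩ := F.exists_smul_transversal (linPart p E z)
  refine ⟨c, ?_⟩
  have hp := F.mem
  set S := contactDistr H p with hS
  have hdiff := fun i => (F.sec i).differentiableAt hp
  have hcdiff := fun i => (F.sec i).conj.differentiableAt hp
  -- Undoing the factor i/2 of the Levi form: [e_i, ē_j] ≡ −2i G_ij z.
  have hlevi : ∀ i j, lieBr (e i) (conjField (e j)) p + (2 * Complex.I * G i j) • z ∈ S := by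
    intro i j
    have := S.smul_mem (-2 * Complex.I) (F.levi i j)
    convert this using 1
    rw [leviBr, smul_sub, smul_smul, smul_smul]
    have : -2 * Complex.I * (Complex.I / 2) = 1 := by
      linear_combination -Complex.I_mul_I
    rw [this, one_smul]
    simp only [neg_mul, neg_smul, sub_neg_eq_add]
  have hSmap : ∀ v ∈ S, linPart p E v ∈ S := by
    intro v hv
    obtain ⟨u, hu, w, hw, rfl⟩ := Submodule.mem_sup.1 hv
    obtain ⟨V, hV, rfl⟩ := F.cr.distribution.smooth p hp u hu
    obtain ⟨W, hW, rfl⟩ := F.cr.distribution.conj.smooth p hp w hw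
    rw [map_add, linPart_apply hE0, linPart_apply hE0]
    exact S.add_mem (Submodule.mem_sup_left (hE.lieBr_mem V hV p hp)) (hE.lieBr_conj W hW p hp)
  ext i j
  have h1 : lieBr (lieBr E (e i)) (conjField (e j)) p
      - ∑ a, A a i • lieBr (e a) (conjField (e j)) p ∈ S := by
    have hs : IsSection U H (lieBr E (e i) - ∑ a, A a i • e a) := IsSection.sub
      ⟨contDiffOn_lieBr U.isOpen hE.smooth (F.sec i).1, hE.lieBr_mem _ (F.sec i)⟩
      (IsSection.sum _ fun a _ => (F.sec a).smul _)
    have hs' := F.cr.lieBr_mem_contact_of_leviKernel hp hs (by simpa using hA i) (F.sec j)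
    have hcl : ∀ s : Finset (Fin m), lieBr (∑ a ∈ s, A a i • e a) (conjField (e j)) p
        = ∑ a ∈ s, A a i • lieBr (e a) (conjField (e j)) p := by
      intro s
      induction s using Finset.induction_on with
      | empty => simp [lieBr, dirDeriv_eq]
      | insert a s ha ih =>
        rw [Finset.sum_insert ha, Finset.sum_insert ha, lieBr_add_left ((hdiff a).const_smul _)
          (DifferentiableAt.sum fun a _ => (hdiff a).const_smul _), ih,
          lieBr_smul_left _ (hdiff a)]
    rw [lieBr_sub_left ((contDiffOn_lieBr U.isOpen hE.smooth (F.sec i).1).contDiffAt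
      (U.isOpen.mem_nhds hp) |>.differentiableAt (by simp))
      (DifferentiableAt.sum fun a _ => (hdiff a).const_smul _), hcl] at hs'
    exact hs'
  have h2 : lieBr (e i) (lieBr E (conjField (e j))) p
      - ∑ a, D a j • lieBr (e i) (conjField (e a)) p ∈ S := by
    have hV : IsSection U (contactDistr H) (lieBr E (conjField (e j))) :=
      ⟨contDiffOn_lieBr U.isOpen hE.smooth (F.sec j).conj.1, hE.lieBr_conj _ (F.sec j).conj⟩
    have hVp := h.map_basis (Sum.inr j)
    simp only [realFrame, Sum.elim_inr, Fintype.sum_sum_type, Sum.elim_inl,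
      Matrix.fromBlocks_apply₁₂, Matrix.fromBlocks_apply₂₂] at hVp
    rw [show star (e j p) = conjField (e j) p from rfl, linPart_apply hE0] at hVp
    obtain ⟨u, hu, w, hw, huw⟩ := Submodule.mem_sup.1 hVp
    obtain ⟨P, hP, rfl⟩ := F.kernel.smooth p hp u hu
    obtain ⟨Q, hQ, rfl⟩ := F.kernel.conj.smooth p hp w hw
    have hb : IsSection U H (∑ a, B a j • e a) := IsSection.sum _ fun a _ => (F.sec a).smul _
    have hd : IsSection U (conjDistr H) (∑ a, D a j • conjField (e a)) :=
      IsSection.sum _ fun a _ => (F.sec a).conj.smul _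
    -- Fields with the same H- and H̄-components at p are subtracted from [E, ē_j]. The rest
    -- vanishes at p, so its bracket is harmless; the H-part brackets with e_i into H, and Q, a
    -- section of K̄, brackets with it into H ⊕ H̄.
    have hV1 := hV.sub ((hb.add hP.of_leviKernel).to_contact)
    have hV2 := hV1.sub (hd.add hQ.conj_of_leviKernel).conj_to_contact
    have h0 := F.cr.contact.lieBr_mem_of_right_eq_zero hV2 hp (by
      simp only [Pi.sub_apply, Pi.add_apply, Finset.sum_apply, Pi.smul_apply, conjField_apply]
      rw [show P p = _ from eq_sub_of_add_eq huw]
      abel) (e i)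
    rw [lieBr_sub_right (hV1.differentiableAt hp) ((hd.differentiableAt hp).add
      (hQ.differentiableAt hp)), lieBr_sub_right (hV.differentiableAt hp)
      ((hb.differentiableAt hp).add (hP.differentiableAt hp)),
      lieBr_add_right (hd.differentiableAt hp) (hQ.differentiableAt hp)] at h0
    have h3 : lieBr (e i) (∑ a, B a j • e a + P) p ∈ S :=
      Submodule.mem_sup_left (F.cr.involutive _ _ (F.sec i) (hb.add hP.of_leviKernel) p hp)
    have h4 : lieBr (e i) Q p ∈ S := by
      rw [lieBr_swap]
      exact S.neg_mem (F.cr.lieBr_conj_leviKernel hp hQ (F.sec i))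
    have hcl : ∀ s : Finset (Fin m), lieBr (e i) (∑ a ∈ s, D a j • conjField (e a)) p
        = ∑ a ∈ s, D a j • lieBr (e i) (conjField (e a)) p := by
      intro s
      induction s using Finset.induction_on with
      | empty => simp [lieBr, dirDeriv_eq]
      | insert a s ha ih =>
        rw [Finset.sum_insert ha, Finset.sum_insert ha, lieBr_add_right ((hcdiff a).const_smul _)
          (DifferentiableAt.sum fun a _ => (hcdiff a).const_smul _), ih,
          lieBr_smul_right _ (hcdiff a)]
    rw [hcl] at h0
    convert S.add_mem h0 (S.add_mem h3 h4) using 1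
    abel
  have hJ := lieBr_lieBr (hE.smooth.contDiffAt (U.isOpen.mem_nhds hp)) ((F.sec i).contDiffAt hp)
    ((F.sec j).conj.contDiffAt hp)
  rw [← linPart_apply hE0] at hJ
  have h3 := hSmap _ (hlevi i j)
  rw [map_add, map_smul, hJ] at h3
  have h4 := S.smul_mem (2 * Complex.I * G i j) hc
  have h5 : ∑ a, A a i • (lieBr (e a) (conjField (e j)) p + (2 * Complex.I * G a j) • z) ∈ S :=
    S.sum_mem fun a _ => S.smul_mem _ (hlevi a j)
  have h6 : ∑ a, D a j • (lieBr (e i) (conjField (e a)) p + (2 * Complex.I * G i a) • z) ∈ S :=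
    S.sum_mem fun a _ => S.smul_mem _ (hlevi i a)
  have h7 : (2 * Complex.I * (c * G i j - (∑ a, A a i * G a j + ∑ a, G i a * D a j))) • z ∈ S := by
    have := S.add_mem (S.add_mem (S.sub_mem (S.sub_mem (S.sub_mem h3 h4) h1) h2)
      (S.neg_mem h5)) (S.neg_mem h6)
    convert this using 1
    simp only [smul_add, Finset.sum_add_distrib, smul_sub, smul_smul, ← Finset.sum_smul]
    have e1 : ∑ a, A a i * (2 * Complex.I * G a j) = 2 * Complex.I * ∑ a, A a i * G a j := by
      rw [Finset.mul_sum]; exact Finset.sum_congr rfl fun _ _ => by ring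
    have e2 : ∑ a, D a j * (2 * Complex.I * G i a) = 2 * Complex.I * ∑ a, G i a * D a j := by
      rw [Finset.mul_sum]; exact Finset.sum_congr rfl fun _ _ => by ring
    rw [e1, e2]
    have e3 : 2 * Complex.I * (c * G i j - (∑ a, A a i * G a j + ∑ a, G i a * D a j))
      = 2 * Complex.I * G i j * c - 2 * Complex.I * ∑ a, A a i * G a j
        - 2 * Complex.I * ∑ a, G i a * D a j := by ring
    rw [e3, sub_smul, sub_smul]
    abel
  -- Since z is transversal, the coefficient of z in `h7` must vanish.
  by_contra hne
  refine F.transversal ((S.smul_mem_iff ?_).1 h7)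
  simp only [ne_eq, mul_eq_zero, OfNat.ofNat_ne_zero, Complex.I_ne_zero, or_self, false_or]
  intro h8
  apply hne
  simpa [Matrix.mul_apply, sub_eq_zero] using h8

/-- The action of the conjugate of a vector field. -/
theorem represents_conj (hE : DifferentiableAt ℝ E p) {A B D : Matrix (Fin m) (Fin m) ℂ}
    (h : Represents (realFrame e p) (contactDistr (leviKernel U H) p) (linPart p E)
        (Matrix.fromBlocks A B 0 D)) :
    Represents (realFrame e p) (contactDistr (leviKernel U H) p) (linPart p (conjField E))
        (Matrix.fromBlocks (D.map star) 0 (B.map star) (A.map star)) := by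
  refine ⟨fun v hv => ?_, ?_⟩
  · rw [linPart_conjField hE]
    exact star_mem_sup_conj (h.map_mem _ (star_mem_sup_conj hv))
  · rintro (j | j)
    · have : _ ∈ contactDistr (leviKernel U H) p := star_mem_sup_conj (h.map_basis (Sum.inr j))
      rw [star_sub, star_sum_smul] at this
      rw [linPart_conjField hE]
      convert this using 2
      · simp [realFrame]
      · simp [Fintype.sum_sum_type, realFrame, add_comm]
    · have : _ ∈ contactDistr (leviKernel U H) p := star_mem_sup_conj (h.map_basis (Sum.inl j))
      rw [star_sub, star_sum_smul] at this
      rw [linPart_conjField hE]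
      convert this using 2
      · simp [realFrame]
      · simp [Fintype.sum_sum_type, realFrame]

/-- Modulo K ⊕ H̄ only the e-components of [E, ē_j] survive, and they form the upper right block. -/
theorem eq_of_represents (F : IsLeviFrame U H p e k z G) (hE0 : E p = 0)
    {A B D C : Matrix (Fin m) (Fin m) ℂ}
    (h : Represents (realFrame e p) (contactDistr (leviKernel U H) p) (linPart p E)
        (Matrix.fromBlocks A B 0 D))
    (hC : ∀ j, lieBr E (conjField (e j)) p - ∑ i, C i j • e i p
      ∈ leviKernel U H p ⊔ conjDistr H p) : B = C := by
  ext i j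
  have h1 := h.map_basis (Sum.inr j)
  simp only [realFrame, Sum.elim_inr, Fintype.sum_sum_type, Sum.elim_inl,
      Matrix.fromBlocks_apply₁₂, Matrix.fromBlocks_apply₂₂] at h1
  rw [show star (e j p) = conjField (e j) p from rfl, linPart_apply hE0] at h1
  have h2 : contactDistr (leviKernel U H) p ≤ leviKernel U H p ⊔ conjDistr H p :=
      sup_le_sup_left (fun _ hv => leviKernel_le F.mem hv) _
  have h3 : ∑ i, D i j • star (e i p) ∈ leviKernel U H p ⊔ conjDistr H p :=
    Submodule.mem_sup_right (Submodule.sum_mem _ fun i _ => Submodule.smul_mem _ _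
      ((F.sec i).conj.2 p F.mem))
  have h4 : ∑ i, (B i j - C i j) • e i p ∈ leviKernel U H p ⊔ conjDistr H p := by
    convert Submodule.sub_mem _ (Submodule.sub_mem _ (hC j) (h2 h1)) h3 using 1
    simp only [sub_smul, Finset.sum_sub_distrib]
    abel
  exact sub_eq_zero.1 (congrFun (F.eq_zero_of_mem h4) i)

/-- Symmetries preserve H̄ as well as H, so the upper right block vanishes too. -/
theorem represents_symmetry (F : IsLeviFrame U H p e k z G) (hZ : IsComplexSymmetry U H Z)
    (hZ0 : Z p = 0) : ∃ A D : Matrix (Fin m) (Fin m) ℂ, (∃ c : ℂ, c • G = Aᵀ * G + G * D) ∧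
      Represents (realFrame e p) (contactDistr (leviKernel U H) p) (linPart p Z)
        (Matrix.fromBlocks A 0 0 D) := by
  obtain ⟨A, B, D, hA, h⟩ := F.represents_adapted (hZ.isAdapted F.cr) hZ0
  have hB : B = 0 := F.eq_of_represents hZ0 h fun j => by
    simpa using Submodule.mem_sup_right (hZ.lieBr_conj (F.sec j).conj F.mem)
  exact ⟨A, D, F.conformal_of_represents (hZ.isAdapted F.cr) hZ0 hA h, hB ▸ h⟩

/-- Subtracting the symmetry makes the field vanish at p and does not change the upper right block,
as [X, H̄] ⊆ H̄. This is how the symbol operator enters a linear action at p. -/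
theorem represents_kernel_sub_symmetry (F : IsLeviFrame U H p e k z G)
    (hX : IsComplexSymmetry U H X) {s : Fin r} (hXs : X p = k s p)
    {C : Matrix (Fin m) (Fin m) ℂ}
    (hC : ∀ j, lieBr (k s) (conjField (e j)) p - ∑ i, C i j • e i p
      ∈ leviKernel U H p ⊔ conjDistr H p) :
    ∃ A D : Matrix (Fin m) (Fin m) ℂ, (∃ c : ℂ, c • G = Aᵀ * G + G * D) ∧
      Represents (realFrame e p) (contactDistr (leviKernel U H) p) (linPart p (k s - X))
        (Matrix.fromBlocks A C 0 D) := by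
  have hE := ((F.ker_sec s).isAdapted F.cr).sub (hX.isAdapted F.cr)
  have hE0 : (k s - X) p = 0 := by simp [hXs]
  obtain ⟨A, B, D, hA, h⟩ := F.represents_adapted hE hE0
  have hB : B = C := F.eq_of_represents hE0 h fun j => by
    rw [lieBr_sub_left ((F.ker_sec s).differentiableAt F.mem) (hX.differentiableAt F.mem),
      sub_right_comm]
    exact Submodule.sub_mem _ (hC j)
      (Submodule.mem_sup_right (hX.lieBr_conj (F.sec j).conj F.mem))
  exact ⟨A, D, F.conformal_of_represents hE hE0 hA h, hB ▸ h⟩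

end IsLeviFrame

/-! ### Structure equations of a homogeneous model at a point. -/

namespace IsLeviFrame

variable {m r : ℕ} {U : TopologicalSpace.Opens (Fin (2 * (m + r) + 1) → ℝ)}
  {H : Distr (2 * (m + r) + 1)} {p : Fin (2 * (m + r) + 1) → ℝ}
  {e : Fin m → VField (2 * (m + r) + 1)} {k X : Fin r → VField (2 * (m + r) + 1)}
  {z : Fin (2 * (m + r) + 1) → ℂ} {G : Matrix (Fin m) (Fin m) ℂ}
  {V Z : VField (2 * (m + r) + 1)}

theorem distribution_kernel_sup_conj (F : IsLeviFrame U H p e k z G) :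
    IsDistribution U (contactDistr (leviKernel U H)) (r + r) :=
  F.kernel.sup F.kernel.conj fun x hx => by
    rw [eq_bot_iff, ← F.cr.totallyReal x hx]
    exact inf_le_inf (leviKernel_le hx) fun v hv =>
      leviKernel_le (H := H) hx (show star v ∈ leviKernel U H x from hv)

theorem span_kernel_sup_conj (F : IsLeviFrame U H p e k z G)
    {v : Fin (2 * (m + r) + 1) → ℂ} (hv : v ∈ contactDistr (leviKernel U H) p) :
    ∃ a b : Fin r → ℂ, v = ∑ s, a s • k s p + ∑ s, b s • star (k s p) := by
  obtain ⟨u, hu, w, hw, rfl⟩ := Submodule.mem_sup.1 hv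
  obtain ⟨a, rfl⟩ := F.span_kernel hu
  obtain ⟨b, hb⟩ := F.span_kernel (show star w ∈ leviKernel U H p from hw)
  refine ⟨a, fun s => star (b s), ?_⟩
  rw [← star_star w, hb, star_sum_smul]

/-- The differential of a section of K ⊕ K̄ at a zero takes values in K ⊕ K̄, hence it dies in the
quotient. -/
theorem represents_zero (F : IsLeviFrame U H p e k z G)
    (hV : IsSection U (contactDistr (leviKernel U H)) V) (hV0 : V p = 0) :
    Represents (realFrame e p) (contactDistr (leviKernel U H) p) (linPart p V) 0 := by
  have h : ∀ u, linPart p V u ∈ contactDistr (leviKernel U H) p := fun u =>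
    Submodule.neg_mem _ (F.distribution_kernel_sup_conj.dirDeriv_mem hV F.mem hV0 u)
  exact ⟨fun v _ => h v, fun j => by simpa using h _⟩

/-- A vector field that vanishes at `p` and is the sum of a section of `K ⊕ conj K` and of a
complex symmetry has the same linear action at `p` as a combination of the fields `k s - X s`, of
their conjugates, and of a complex symmetry vanishing at `p`. -/
theorem represents_decomposition (F : IsLeviFrame U H p e k z G)
    (hX : ∀ s, IsComplexSymmetry U H (X s)) (hXp : ∀ s, X s p = k s p)
    {A C D : Fin r → Matrix (Fin m) (Fin m) ℂ}
    (hE : ∀ s, Represents (realFrame e p) (contactDistr (leviKernel U H) p)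
      (linPart p (k s - X s)) (Matrix.fromBlocks (A s) (C s) 0 (D s)))
    (hV : ContDiffOn ℝ ∞ V U) (hV0 : V p = 0) (hZ : IsComplexSymmetry U H Z)
    (hVZ : ∀ x ∈ U, V x - Z x ∈ contactDistr (leviKernel U H) x) :
    ∃ (a b : Fin r → ℂ) (Z' : VField (2 * (m + r) + 1)), IsComplexSymmetry U H Z' ∧ Z' p = 0 ∧
      ∀ M, Represents (realFrame e p) (contactDistr (leviKernel U H) p) (linPart p Z') M →
        Represents (realFrame e p) (contactDistr (leviKernel U H) p) (linPart p V)
          ((∑ s, a s • Matrix.fromBlocks (A s) (C s) 0 (D s)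
            + ∑ s, b s • Matrix.fromBlocks ((D s).map star) 0 ((C s).map star) ((A s).map star))
            + M) := by
  have hp := F.mem
  obtain ⟨a, b, hab⟩ := F.span_kernel_sup_conj (hVZ p hp)
  -- The coefficients a, b are those of V(p) − Z(p) in the frame k, k̄. As V(p) = 0 and X_s(p) =
  -- k_s(p), the added symmetries cancel Z at p.
  set Z' := Z + ((∑ s, a s • X s) + ∑ s, b s • conjField (X s)) with hZ'
  set κ := (∑ s, a s • k s) + ∑ s, b s • conjField (k s) with hκ
  have hκs : IsSection U (contactDistr (leviKernel U H)) κ :=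
    (IsSection.to_contact (IsSection.sum _ fun s _ => (F.ker_sec s).smul _)).add
      (IsSection.conj_to_contact (IsSection.sum _ fun s _ => (F.ker_sec s).conj.smul _))
  have hVZs : IsSection U (contactDistr (leviKernel U H)) (V - Z) := ⟨hV.sub hZ.smooth, hVZ⟩
  have hZs : IsComplexSymmetry U H Z' := hZ.add
    ((IsComplexSymmetry.sum _ fun s _ => (hX s).smul _).add
      (IsComplexSymmetry.sum _ fun s _ => (hX s).conj.smul _))
  refine ⟨a, b, Z', hZs, ?_, fun M hM => ?_⟩
  · have : Z p = V p - κ p := by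
      have : κ p = V p - Z p := by rw [hab]; simp [hκ]
      rw [this]; abel
    simp only [hZ', Pi.add_apply, this, hV0, hκ, Finset.sum_apply, Pi.smul_apply, hXp,
      conjField_apply]
    abel
  · have hκ0 : (V - Z - κ) p = 0 := by
      rw [Pi.sub_apply, Pi.sub_apply, hab]; simp [hκ]
    have h0 := F.represents_zero (hVZs.sub hκs) hκ0
    have hd : ∀ s, DifferentiableAt ℝ (k s - X s) p := fun s =>
      ((F.ker_sec s).differentiableAt hp).sub ((hX s).differentiableAt hp)
    -- The first summand is a section of K ⊕ K̄ vanishing at p, so it acts by zero.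
    have h1 : V = (V - Z - κ) + ((∑ s, a s • (k s - X s)
        + ∑ s, b s • conjField (k s - X s)) + Z') := by
      have : ∀ s, conjField (k s - X s) = conjField (k s) - conjField (X s) := by
        intro s; funext x; simp
      simp only [this, smul_sub, Finset.sum_sub_distrib, hκ, hZ']
      abel
    have h2 : ∀ s ∈ Finset.univ, DifferentiableAt ℝ (a s • (k s - X s)) p :=
      fun s _ => (hd s).const_smul _
    have h3 : ∀ s ∈ Finset.univ, DifferentiableAt ℝ (b s • conjField (k s - X s)) p :=
      fun s _ => (hd s).conjField.const_smul _
    have h4 : linPart p V = linPart p (V - Z - κ) + ((∑ s, a s • linPart p (k s - X s)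
        + ∑ s, b s • linPart p (conjField (k s - X s))) + linPart p Z') := by
      conv_lhs => rw [h1]
      rw [linPart_add ((hVZs.sub hκs).differentiableAt hp)
        (((DifferentiableAt.sum h2).add (DifferentiableAt.sum h3)).add (hZs.differentiableAt hp)),
        linPart_add ((DifferentiableAt.sum h2).add (DifferentiableAt.sum h3))
          (hZs.differentiableAt hp),
        linPart_add (DifferentiableAt.sum h2) (DifferentiableAt.sum h3), linPart_sum _ h2,
        linPart_sum _ h3]
      simp only [linPart_smul _ (hd _), linPart_smul _ (hd _).conjField]
    rw [h4]
    have h5 := h0.add (((Represents.sum Finset.univ fun s _ => (hE s).smul (a s)).add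
      (Represents.sum Finset.univ fun s _ => (represents_conj (hd s) (hE s)).smul (b s))).add hM)
    rwa [zero_add] at h5

/-- The structure equations of a homogeneous CR structure at the point `p`. -/
theorem structure_equations (F : IsLeviFrame U H p e k z G) (hH : IsLocallyHomogeneous U H)
    {C : Fin r → Matrix (Fin m) (Fin m) ℂ}
    (hC : ∀ s j, lieBr (k s) (conjField (e j)) p - ∑ i, C s i j • e i p
      ∈ leviKernel U H p ⊔ conjDistr H p) :
    ∃ A D : Fin r → Matrix (Fin m) (Fin m) ℂ, (∀ s, ∃ c : ℂ, c • G = (A s)ᵀ * G + G * D s) ∧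
      ∀ t s, ∃ (a b : Fin r → ℂ) (P Q : Matrix (Fin m) (Fin m) ℂ),
        (∃ c : ℂ, c • G = Pᵀ * G + G * Q) ∧
        (∀ u, P * C u - C u * Q ∈ Submodule.span ℂ (Set.range C)) ∧
        (D t).map star * A s - (A s * (D t).map star + C s * (C t).map star)
          = ∑ u, a u • A u + ∑ u, b u • (D u).map star + P ∧
        (D t).map star * C s - C s * (A t).map star = ∑ u, a u • C u := by
  have hp := F.mem
  choose X hX hXp using fun s => hH.exists_isComplexSymmetry hp (k s p)
  choose A D hcon hE using fun s => F.represents_kernel_sub_symmetry (hX s) (hXp s) (hC s)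
  refine ⟨A, D, hcon, fun t s => ?_⟩
  have hEs : ∀ s, ContDiffOn ℝ ∞ (k s - X s) U := fun s => (F.ker_sec s).1.sub (hX s).smooth
  have hE0 : ∀ s, (k s - X s) p = 0 := fun s => by simp [hXp]
  have hcE0 : ∀ s, conjField (k s - X s) p = 0 := fun s => by simp [hXp]
  have hnhds : ∀ {V : VField (2 * (m + r) + 1)}, ContDiffOn ℝ ∞ V U → ContDiffAt ℝ ∞ V p :=
    fun h => h.contDiffAt (U.isOpen.mem_nhds hp)
  have hlie0 : ∀ {V W : VField (2 * (m + r) + 1)}, V p = 0 → W p = 0 → lieBr V W p = 0 := by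
    intro V W hV hW
    rw [lieBr_of_left_eq_zero hV, hW, map_zero, neg_zero]
  have hconj : ∀ s, conjField (k s - X s) = conjField (k s) - conjField (X s) := by
    intro s; funext x; simp
  -- In the expansion of [k̄_t − X̄_t, k_s − X_s] every term but [X̄_t, X_s] lies in K ⊕ K̄, by
  -- involutivity and by invariance under symmetries.
  obtain ⟨a, b, Z, hZ, hZ0, hrep⟩ := F.represents_decomposition hX hXp hE
    (V := lieBr (conjField (k t - X t)) (k s - X s)) (Z := lieBr (conjField (X t)) (X s))
    (contDiffOn_lieBr U.isOpen (hEs t).conjField (hEs s)) (hlie0 (hcE0 t) (hE0 s))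
    ((hX t).conj.lieBr (hX s)) (by
      intro x hx
      have d1 := (F.ker_sec t).conj.differentiableAt hx
      have d2 := (hX t).conj.differentiableAt hx
      have d3 := (F.ker_sec s).differentiableAt hx
      have d4 := (hX s).differentiableAt hx
      rw [hconj, lieBr_sub_left d1 d2, lieBr_sub_right d3 d4, lieBr_sub_right d3 d4]
      have h1 := Submodule.neg_mem _
        (F.cr.lieBr_leviKernel_conj_leviKernel hx (F.ker_sec s) (F.ker_sec t))
      rw [← lieBr_swap] at h1
      have h2 : lieBr (X s) (conjField (k t)) x ∈ contactDistr (leviKernel U H) x :=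
        Submodule.mem_sup_right ((hX s).lieBr_conj_leviKernel F.cr (F.ker_sec t).conj hx)
      have h3 : lieBr (conjField (X t)) (k s) x ∈ contactDistr (leviKernel U H) x :=
        Submodule.mem_sup_left ((hX t).conj.lieBr_leviKernel F.cr (F.ker_sec s) hx)
      rw [lieBr_swap (conjField (k t)) (X s)]
      convert Submodule.sub_mem _ (Submodule.add_mem _ h1 h2) h3 using 1
      abel)
  obtain ⟨P, Q, hPQ, hZrep⟩ := F.represents_symmetry hZ hZ0
  refine ⟨a, b, P, Q, hPQ, fun u => ?_, ?_⟩
  -- The decomposition is now applied to [Z, E_u]. The upper right block of the commutator is P C_u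
  -- − C_u Q; on the other side only the C_v contribute to that block.
  · obtain ⟨a', b', Z', hZ', hZ0', hrep'⟩ := F.represents_decomposition hX hXp hE
      (V := lieBr Z (k u - X u)) (Z := (-1 : ℂ) • lieBr Z (X u))
      (contDiffOn_lieBr U.isOpen hZ.smooth (hEs u)) (hlie0 hZ0 (hE0 u))
      ((hZ.lieBr (hX u)).smul (-1)) (by
        intro x hx
        rw [lieBr_sub_right ((F.ker_sec u).differentiableAt hx) ((hX u).differentiableAt hx)]
        have h : lieBr Z (k u) x ∈ contactDistr (leviKernel U H) x :=
          Submodule.mem_sup_left (hZ.lieBr_leviKernel F.cr (F.ker_sec u) hx)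
        simpa using h)
    obtain ⟨P', Q', -, hZrep'⟩ := F.represents_symmetry hZ' hZ0'
    have h1 := hrep' _ hZrep'
    rw [linPart_lieBr (hZ.contDiffAt hp) (hnhds (hEs u)) hZ0 (hE0 u)] at h1
    have h2 := ((hZrep.mul (hE u)).sub ((hE u).mul hZrep)).unique F.realFrame_indep h1
    have h3 := congrArg Matrix.toBlocks₁₂ h2
    have h4 : P * C u - C u * Q = ∑ v, a' v • C v := by
      ext i j
      simpa [Matrix.fromBlocks_multiply, Matrix.toBlocks₁₂, Matrix.sum_apply] using
        congrFun (congrFun h3 i) j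
    rw [h4]
    exact Submodule.sum_mem _ fun v _ =>
      Submodule.smul_mem _ _ (Submodule.subset_span ⟨v, rfl⟩)
  · have h1 := hrep _ hZrep
    rw [linPart_lieBr (hnhds (hEs t).conjField) (hnhds (hEs s)) (hcE0 t) (hE0 s)] at h1
    have hEt := represents_conj (hnhds (hEs t) |>.differentiableAt (by simp)) (hE t)
    have h2 := ((hEt.mul (hE s)).sub ((hE s).mul hEt)).unique F.realFrame_indep h1
    constructor
    · ext i j
      simpa [Matrix.fromBlocks_multiply, Matrix.toBlocks₁₁, Matrix.sum_apply] using
        congrFun (congrFun (congrArg Matrix.toBlocks₁₁ h2) i) j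
    · ext i j
      simpa [Matrix.fromBlocks_multiply, Matrix.toBlocks₁₂, Matrix.sum_apply] using
        congrFun (congrFun (congrArg Matrix.toBlocks₁₂ h2) i) j

end IsLeviFrame

/-! ## Consequences of the structure equations -/

section Algebra

variable {m : ℕ} {G A B C D : Matrix (Fin m) (Fin m) ℂ}

theorem map_star_mul (A B : Matrix (Fin m) (Fin m) ℂ) :
    (A * B).map star = A.map star * B.map star := by
  ext i j; simp [Matrix.mul_apply]

theorem transpose_conjTranspose (A : Matrix (Fin m) (Fin m) ℂ) : Aᵀᴴ = Aᴴᵀ := rfl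

theorem map_star_one : (1 : Matrix (Fin m) (Fin m) ℂ).map star = 1 := by
  ext i j; simp [Matrix.one_apply, apply_ite]

theorem map_star_smul (c : ℂ) (A : Matrix (Fin m) (Fin m) ℂ) :
    (c • A).map star = star c • A.map star := by
  ext i j; simp

theorem map_star_add (A B : Matrix (Fin m) (Fin m) ℂ) :
    (A + B).map star = A.map star + B.map star := by
  ext i j; simp

theorem map_star_map_star (A : Matrix (Fin m) (Fin m) ℂ) : (A.map star).map star = A := by
  ext i j; simp

/-- `H`-adjoint pairs are stable under conjugation and exchange. -/
theorem conformal_conj (hG : G.IsHermitian) {c : ℂ} (h : c • G = Aᵀ * G + G * D) :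
    star c • G = (D.map star)ᵀ * G + G * A.map star := by
  have := congrArg Matrix.conjTranspose h
  rw [Matrix.conjTranspose_smul, hG.eq, Matrix.conjTranspose_add, Matrix.conjTranspose_mul,
    Matrix.conjTranspose_mul, hG.eq] at this
  rw [this, add_comm]
  rfl

theorem eq_of_conformal (hdet : IsUnit G.det) {c : ℂ} (h : c • G = Aᵀ * G + G * D) :
    D = c • 1 - G⁻¹ * Aᵀ * G := by
  have h1 := congrArg (G⁻¹ * ·) h
  simp only [Matrix.mul_add, Matrix.mul_smul, ← Matrix.mul_assoc,
    Matrix.nonsing_inv_mul _ hdet, Matrix.one_mul] at h1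
  rw [h1, add_sub_cancel_left]

/-- The spaces of matrices whose infinitesimal stabilizer, for the action of `𝔤𝔩(m)` on operators
that are self-adjoint with respect to `G`, consists of scalar matrices. -/
def HasScalarStabilizer (G : Matrix (Fin m) (Fin m) ℂ)
    (W : Submodule ℂ (Matrix (Fin m) (Fin m) ℂ)) : Prop :=
  ∀ B : Matrix (Fin m) (Fin m) ℂ, (∀ X ∈ W, B * X + X * (G⁻¹ * Bᵀ * G) ∈ W) →
    B ∈ Submodule.span ℂ {(1 : Matrix (Fin m) (Fin m) ℂ)}

/-- Conformality determines D as c − G⁻¹AᵀG, so A X − X D differs from the action in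
`HasScalarStabilizer` by c X, which is in W. -/
theorem HasScalarStabilizer.mem_of_conformal {W : Submodule ℂ (Matrix (Fin m) (Fin m) ℂ)}
    (hW : HasScalarStabilizer G W) (hdet : IsUnit G.det) {c : ℂ} (h : c • G = Aᵀ * G + G * D)
    (hA : ∀ X ∈ W, A * X - X * D ∈ W) : A ∈ Submodule.span ℂ {(1 : Matrix (Fin m) (Fin m) ℂ)} := by
  refine hW A fun X hX => ?_
  have := W.add_mem (hA X hX) (W.smul_mem c hX)
  rw [eq_of_conformal hdet h, Matrix.mul_sub, Matrix.mul_smul, Matrix.mul_one] at this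
  convert this using 1
  abel

/-- The last equation says that D̄_t, paired with Ā_t, stabilizes W, so D̄_t is scalar and
conformality makes A_t scalar; P is scalar because it stabilizes W. The commutator in the remaining
equation then cancels and isolates C_s C̄_t. -/
theorem HasScalarStabilizer.mul_conj_mem {r : ℕ} (hG : G.IsHermitian) (hdet : IsUnit G.det)
    {C A D : Fin r → Matrix (Fin m) (Fin m) ℂ}
    (hW : HasScalarStabilizer G (Submodule.span ℂ (Set.range C)))
    (hcon : ∀ s, ∃ c : ℂ, c • G = (A s)ᵀ * G + G * D s)
    (h : ∀ t s, ∃ (a b : Fin r → ℂ) (P Q : Matrix (Fin m) (Fin m) ℂ),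
        (∃ c : ℂ, c • G = Pᵀ * G + G * Q) ∧
        (∀ u, P * C u - C u * Q ∈ Submodule.span ℂ (Set.range C)) ∧
        (D t).map star * A s - (A s * (D t).map star + C s * (C t).map star)
          = ∑ u, a u • A u + ∑ u, b u • (D u).map star + P ∧
        (D t).map star * C s - C s * (A t).map star = ∑ u, a u • C u) (t s : Fin r) :
    C s * (C t).map star ∈ Submodule.span ℂ {(1 : Matrix (Fin m) (Fin m) ℂ)} := by
  set W := Submodule.span ℂ (Set.range C)
  set S := Submodule.span ℂ {(1 : Matrix (Fin m) (Fin m) ℂ)}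
  have hspan : ∀ X Y : Matrix (Fin m) (Fin m) ℂ, (∀ u, X * C u - C u * Y ∈ W) →
      ∀ Z ∈ W, X * Z - Z * Y ∈ W := by
    intro X Y hXY Z hZ
    induction hZ using Submodule.span_induction with
    | mem Z hZ => obtain ⟨u, rfl⟩ := hZ; exact hXY u
    | zero => simp
    | add Z Z' _ _ h h' =>
      convert W.add_mem h h' using 1
      rw [Matrix.mul_add, Matrix.add_mul]; abel
    | smul c Z _ h =>
      convert W.smul_mem c h using 1
      rw [Matrix.mul_smul, Matrix.smul_mul, smul_sub]
  have hD : ∀ t, (D t).map star ∈ S := by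
    intro t
    obtain ⟨c, hc⟩ := hcon t
    refine hW.mem_of_conformal hdet (conformal_conj hG hc) (hspan _ _ fun u => ?_)
    obtain ⟨a, b, P, Q, -, -, -, h4⟩ := h t u
    rw [h4]
    exact Submodule.sum_mem _ fun v _ =>
      Submodule.smul_mem _ _ (Submodule.subset_span ⟨v, rfl⟩)
  have hA : ∀ s, A s ∈ S := by
    intro s
    obtain ⟨c, hc⟩ := hcon s
    obtain ⟨d, hd⟩ := Submodule.mem_span_singleton.1 (hD s)
    have h1 := eq_of_conformal hdet (conformal_conj hG hc)
    rw [← hd] at h1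
    simp only [Matrix.transpose_smul, Matrix.transpose_one, Matrix.mul_smul, Matrix.mul_one,
      Matrix.smul_mul, Matrix.nonsing_inv_mul _ hdet] at h1
    refine Submodule.mem_span_singleton.2 ⟨star (star c - d), ?_⟩
    rw [← map_star_map_star (A s), h1, ← sub_smul, map_star_smul, map_star_one]
  obtain ⟨a, b, P, Q, ⟨c, hc⟩, h2, h3, -⟩ := h t s
  have hP : P ∈ S := hW.mem_of_conformal hdet hc (hspan _ _ h2)
  have hcomm : (D t).map star * A s = A s * (D t).map star := by
    obtain ⟨d, hd⟩ := Submodule.mem_span_singleton.1 (hD t)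
    rw [← hd, Matrix.smul_mul, Matrix.one_mul, Matrix.mul_smul, Matrix.mul_one]
  rw [hcomm, sub_add_cancel_left] at h3
  rw [← neg_neg (C s * _), h3]
  exact S.neg_mem (S.add_mem (S.add_mem (S.sum_mem fun u _ => S.smul_mem _ (hA u))
    (S.sum_mem fun u _ => S.smul_mem _ (hD u))) hP)

/-- For an invertible X in W, scalarity of X Z̄ puts Z̄ on the line of X⁻¹ for every Z in W. As X̄
is a nonzero point of that line, W is spanned by X. -/
theorem finrank_le_one_of_mul_conj_scalar {r : ℕ} (hm : 0 < m)
    {C : Fin r → Matrix (Fin m) (Fin m) ℂ}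
    (h : ∀ t s, C s * (C t).map star ∈ Submodule.span ℂ {(1 : Matrix (Fin m) (Fin m) ℂ)})
    {X : Matrix (Fin m) (Fin m) ℂ} (hX : X ∈ Submodule.span ℂ (Set.range C))
    (hXdet : IsUnit X.det) : Module.finrank ℂ (Submodule.span ℂ (Set.range C)) ≤ 1 := by
  set W := Submodule.span ℂ (Set.range C)
  set S := Submodule.span ℂ {(1 : Matrix (Fin m) (Fin m) ℂ)}
  have h1 : ∀ t, ∀ Z ∈ W, Z * (C t).map star ∈ S := by
    intro t Z hZ
    induction hZ using Submodule.span_induction with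
    | mem Z hZ => obtain ⟨u, rfl⟩ := hZ; exact h t u
    | zero => simp
    | add Z Z' _ _ h h' => rw [Matrix.add_mul]; exact S.add_mem h h'
    | smul c Z _ h => rw [Matrix.smul_mul]; exact S.smul_mem c h
  have h2 : ∀ Z ∈ W, X * Z.map star ∈ S := by
    intro Z hZ
    induction hZ using Submodule.span_induction with
    | mem Z hZ => obtain ⟨u, rfl⟩ := hZ; exact h1 u X hX
    | zero => simp
    | add Z Z' _ _ h h' => rw [map_star_add, Matrix.mul_add]; exact S.add_mem h h'
    | smul c Z _ h => rw [map_star_smul, Matrix.mul_smul]; exact S.smul_mem _ h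
  obtain ⟨c, hc⟩ := Submodule.mem_span_singleton.1 (h2 X hX)
  have hXs : X.map star = c • X⁻¹ := by
    have := congrArg (X⁻¹ * ·) hc
    simp only [← Matrix.mul_assoc, Matrix.nonsing_inv_mul _ hXdet, Matrix.one_mul,
      Matrix.mul_smul, Matrix.mul_one] at this
    exact this.symm
  have hc0 : c ≠ 0 := by
    rintro rfl
    have hX0 : X = 0 := by rw [← map_star_map_star X, hXs, zero_smul]; ext; simp
    have : Nonempty (Fin m) := ⟨⟨0, hm⟩⟩
    rw [hX0, Matrix.det_zero] at hXdet
    exact not_isUnit_zero hXdet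
  refine finrank_le_one (⟨X, hX⟩ : W) fun Z => ?_
  obtain ⟨d, hd⟩ := Submodule.mem_span_singleton.1 (h2 Z.1 Z.2)
  refine ⟨star (d / c), ?_⟩
  have hZs : Z.1.map star = (d / c) • X.map star := by
    have := congrArg (X⁻¹ * ·) hd
    simp only [← Matrix.mul_assoc, Matrix.nonsing_inv_mul _ hXdet, Matrix.one_mul,
      Matrix.mul_smul, Matrix.mul_one] at this
    rw [← this, hXs, smul_smul, div_mul_cancel₀ _ hc0]
  ext1
  rw [← map_star_map_star Z.1, hZs, map_star_smul, map_star_map_star]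
  rfl

/-- A is conjugate to −Aᵀ through C. -/
theorem trace_eq_zero_of_skew (hC : IsUnit C.det) (h : A * C + C * Aᵀ = 0) : A.trace = 0 := by
  have h1 : A = -(C * Aᵀ * C⁻¹) := by
    rw [← eq_neg_iff_add_eq_zero] at h
    rw [← Matrix.neg_mul, ← h, Matrix.mul_assoc, Matrix.mul_nonsing_inv _ hC, Matrix.mul_one]
  have h2 : A.trace = -A.trace := by
    conv_lhs => rw [h1]
    rw [Matrix.trace_neg, Matrix.trace_mul_comm, ← Matrix.mul_assoc,
      Matrix.nonsing_inv_mul _ hC, Matrix.one_mul, Matrix.trace_transpose]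
  exact self_eq_neg.1 h2

/-- A C is antisymmetric and Cᴴ is symmetric. -/
theorem trace_mul_eq_zero_of_skew (hC : C.IsSymm) (h : A * C + C * Aᵀ = 0) :
    (A * (C * Cᴴ)).trace = 0 := by
  rw [← eq_neg_iff_add_eq_zero] at h
  have hCs : (Cᴴ)ᵀ = Cᴴ := by
    rw [← transpose_conjTranspose, hC.eq]
  have h2 : (A * (C * Cᴴ)).trace = -(A * (C * Cᴴ)).trace := by
    conv_lhs => rw [← Matrix.mul_assoc, h, Matrix.neg_mul, Matrix.trace_neg,
      ← Matrix.trace_transpose, Matrix.transpose_mul, Matrix.transpose_mul, hCs,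
      Matrix.transpose_transpose, hC.eq, Matrix.trace_mul_comm, Matrix.mul_assoc]
  exact self_eq_neg.1 h2

/-- The key trace identity in the definite case, in an orthonormal basis. -/
theorem trace_sq_of_commutator (hC : C.IsSymm) (hCdet : IsUnit C.det) {a b c : ℂ}
    (hA : A * C + C * Aᵀ = 0) (hB : B * C + C * Bᵀ = 0)
    (h : Aᴴ * A - A * Aᴴ - C * Cᴴ = a • Aᴴ + b • A + B + c • 1) :
    (m : ℂ) * (C * Cᴴ * (C * Cᴴ)).trace = (C * Cᴴ).trace ^ 2 := by
  set N := C * Cᴴ with hN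
  have hNH : Nᴴ = N := by simp [hN]
  have tA := trace_eq_zero_of_skew hCdet hA
  have tB := trace_eq_zero_of_skew hCdet hB
  have tAN := trace_mul_eq_zero_of_skew hC hA
  have tBN := trace_mul_eq_zero_of_skew hC hB
  rw [← hN] at tAN tBN
  have tAH : Aᴴ.trace = 0 := by rw [Matrix.trace_conjTranspose, tA, star_zero]
  have tAHN : (Aᴴ * N).trace = 0 := by
    rw [← hNH, ← Matrix.conjTranspose_mul, Matrix.trace_conjTranspose, Matrix.trace_mul_comm, tAN,
      star_zero]
  have h1 : -N.trace = c * m := by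
    have := congrArg Matrix.trace h
    simpa [Matrix.trace_sub, Matrix.trace_add, Matrix.trace_smul, tA, tB, tAH,
      Matrix.trace_mul_comm A] using this
  have h2 : (Aᴴ * A * N).trace - (A * Aᴴ * N).trace - (N * N).trace = c * N.trace := by
    have := congrArg (fun M => (M * N).trace) h
    simpa [Matrix.sub_mul, Matrix.add_mul, Matrix.trace_sub, Matrix.trace_add, Matrix.smul_mul,
      Matrix.trace_smul, tAHN, tBN, tAN] using this
  -- With this Y one gets tr((AᴴA − AAᴴ)N) = −½‖Y + Yᵀ‖² in the Hilbert–Schmidt norm.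
  set Y := Cᴴ * A with hY
  have hCs : (Cᴴ)ᵀ = Cᴴ := by
    rw [← transpose_conjTranspose, hC.eq]
  have e1 : (A * Aᴴ * N).trace = (Y * Yᴴ).trace := by
    rw [hY, Matrix.conjTranspose_mul, Matrix.conjTranspose_conjTranspose, hN,
      ← Matrix.mul_assoc, Matrix.trace_mul_comm]
    simp only [Matrix.mul_assoc]
  have e2 : (Aᴴ * A * N).trace = -(Y * Yᴴᵀ).trace := by
    rw [← eq_neg_iff_add_eq_zero] at hA
    have : Aᴴ * A * N = -(Aᴴ * (C * Aᵀ) * Cᴴ) := by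
      rw [hN, ← Matrix.neg_mul, ← Matrix.mul_neg, ← hA]
      simp only [Matrix.mul_assoc]
    rw [this, Matrix.trace_neg, hY, ← Matrix.trace_transpose (Cᴴ * A * _)]
    simp only [Matrix.transpose_mul, Matrix.transpose_transpose, Matrix.conjTranspose_mul,
      Matrix.conjTranspose_conjTranspose, hCs, hC.eq, Matrix.mul_assoc]
  have e3 : 0 ≤ ((Y + Yᵀ) * (Y + Yᵀ)ᴴ).trace :=
    (Matrix.posSemidef_self_mul_conjTranspose _).trace_nonneg
  have e4 : ((Y + Yᵀ) * (Y + Yᵀ)ᴴ).trace = 2 * (Y * Yᴴ).trace + 2 * (Y * Yᴴᵀ).trace := by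
    have f1 : (Yᵀ * Yᵀᴴ).trace = (Y * Yᴴ).trace := by
      rw [transpose_conjTranspose, ← Matrix.transpose_mul, Matrix.trace_transpose,
        Matrix.trace_mul_comm]
    have f2 : (Yᵀ * Yᴴ).trace = (Y * Yᴴᵀ).trace := by
      rw [← Matrix.trace_transpose, Matrix.transpose_mul, Matrix.transpose_transpose,
        Matrix.trace_mul_comm]
    rw [Matrix.conjTranspose_add, Matrix.add_mul, Matrix.mul_add, Matrix.mul_add,
      Matrix.trace_add, Matrix.trace_add, Matrix.trace_add, f1, f2,
      transpose_conjTranspose]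
    ring
  -- M is m times the trace-free part of N; its norm gives the Cauchy–Schwarz inequality (tr N)² ≤ m
  -- tr N².
  set M := (m : ℂ) • N - N.trace • (1 : Matrix (Fin m) (Fin m) ℂ) with hM
  have hNt : star N.trace = N.trace := by rw [← Matrix.trace_conjTranspose, hNH]
  have e5 : 0 ≤ (M * Mᴴ).trace := (Matrix.posSemidef_self_mul_conjTranspose _).trace_nonneg
  have e6 : (M * Mᴴ).trace = m * (m * (N * N).trace - N.trace ^ 2) := by
    have : Mᴴ = M := by
      rw [hM, Matrix.conjTranspose_sub, Matrix.conjTranspose_smul, Matrix.conjTranspose_smul, hNH,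
        hNt, Matrix.conjTranspose_one]
      simp
    rw [this, hM]
    simp only [Matrix.sub_mul, Matrix.mul_sub, Matrix.smul_mul, Matrix.mul_smul, Matrix.one_mul,
      Matrix.mul_one, Matrix.trace_sub, Matrix.trace_smul, Matrix.trace_one, Fintype.card_fin,
      smul_eq_mul, smul_sub]
    ring
  rcases Nat.eq_zero_or_pos m with rfl | hm
  · simp [Matrix.trace]
  have hm' : (0 : ℂ) < m := by exact_mod_cast hm
  rw [e6] at e5
  rw [e4] at e3
  -- Eliminating c between the trace of the equation and its trace against N leaves a negative
  -- multiple of ‖Y + Yᵀ‖², hence the opposite inequality.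
  have e7 : (m : ℂ) * (N * N).trace - N.trace ^ 2
      = -(m / 2) * (2 * (Y * Yᴴ).trace + 2 * (Y * Yᴴᵀ).trace) := by
    rw [e1, e2] at h2
    linear_combination -(m : ℂ) * h2 + N.trace * h1
  have e8 : (m : ℂ) * (N * N).trace - N.trace ^ 2 ≤ 0 := by
    rw [e7, neg_mul]
    exact neg_nonpos.2 (mul_nonneg (by positivity) e3)
  have hm'' : (0 : ℂ) ≤ (m : ℂ)⁻¹ := by
    rw [← Complex.ofReal_natCast, ← Complex.ofReal_inv]
    exact_mod_cast inv_nonneg.2 (Nat.cast_nonneg m)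
  have e9 := mul_nonneg hm'' e5
  rw [inv_mul_cancel_left₀ hm'.ne'] at e9
  exact sub_eq_zero.1 (le_antisymm e8 e9)

end Algebra

/-! ### Definite Levi forms: passage to an orthonormal basis. -/

section Definite

variable {m : ℕ} {G A B C D T : Matrix (Fin m) (Fin m) ℂ}

open scoped MatrixOrder in
theorem exists_eq_conjTranspose_mul_self (hA : A.PosSemidef) :
    ∃ T : Matrix (Fin m) (Fin m) ℂ, A = Tᴴ * T :=
  CStarAlgebra.nonneg_iff_eq_star_mul_self.1 hA.nonneg

/-- Conjugating A by T and D by S replaces the form TᵀS by the identity. It is applied with S = T̄,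
that is, in an orthonormal basis. -/
theorem conformal_conjugate {S : Matrix (Fin m) (Fin m) ℂ} (hT : IsUnit T.det)
    (hS : IsUnit S.det) {c : ℂ} (h : c • (Tᵀ * S) = Aᵀ * (Tᵀ * S) + (Tᵀ * S) * D) :
    S * D * S⁻¹ = c • 1 - (T * A * T⁻¹)ᵀ := by
  have hT' : (T⁻¹)ᵀ * Tᵀ = 1 := by
    rw [← Matrix.transpose_mul, Matrix.mul_nonsing_inv _ hT, Matrix.transpose_one]
  have h1 := congrArg (fun M => (T⁻¹)ᵀ * M * S⁻¹) h
  simp only [Matrix.mul_add, Matrix.add_mul, Matrix.mul_smul, Matrix.smul_mul] at h1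
  have e1 : (T⁻¹)ᵀ * (Tᵀ * S) * S⁻¹ = 1 := by
    rw [← Matrix.mul_assoc, hT', Matrix.one_mul, Matrix.mul_nonsing_inv _ hS]
  have e2 : (T⁻¹)ᵀ * (Tᵀ * S * D) * S⁻¹ = S * D * S⁻¹ := by
    rw [Matrix.mul_assoc Tᵀ, ← Matrix.mul_assoc, hT', Matrix.one_mul]
  have e3 : (T⁻¹)ᵀ * (Aᵀ * (Tᵀ * S)) * S⁻¹ = (T * A * T⁻¹)ᵀ := by
    simp only [Matrix.transpose_mul, Matrix.mul_assoc, Matrix.mul_nonsing_inv _ hS, Matrix.mul_one]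
  rw [e1, e2, e3] at h1
  rw [h1, add_sub_cancel_left]

theorem conj_nonsing_inv (T : Matrix (Fin m) (Fin m) ℂ) :
    (T⁻¹).map star = (T.map star)⁻¹ := by
  have h : ∀ A : Matrix (Fin m) (Fin m) ℂ, A.map star = (Aᴴ)ᵀ := fun _ => rfl
  rw [h, h, Matrix.conjTranspose_nonsing_inv, Matrix.transpose_nonsing_inv]

/-- In the pseudoconvex case with a Levi kernel of rank one, the structure equations force the
square of the antilinear operator to be a multiple of the identity, as seen by its traces. -/
theorem trace_sq_of_structure_equations (hG : G.PosDef) (hC : (Cᵀ * G).IsSymm)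
    (hCdet : IsUnit C.det) {P Q : Matrix (Fin m) (Fin m) ℂ} {a b c c' l : ℂ}
    (hcon : c • G = Aᵀ * G + G * D) (hcon' : c' • G = Pᵀ * G + G * Q)
    (hP : P * C - C * Q = l • C)
    (hUL : D.map star * A - (A * D.map star + C * C.map star) = a • A + b • D.map star + P)
    (hUR : D.map star * C - C * A.map star = a • C) :
    (m : ℂ) * (C * C.map star * (C * C.map star)).trace = (C * C.map star).trace ^ 2 := by
  -- Factoring Gᵀ = TᴴT gives G = TᵀT̄. Linear operators become T M T⁻¹, and the antilinear one
  -- becomes C' = T C T̄⁻¹, which is symmetric.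
  obtain ⟨T, hT⟩ := exists_eq_conjTranspose_mul_self hG.transpose.posSemidef
  set S := T.map star with hS
  have hGT : Gᵀ = Sᵀ * T := hT
  have hG' : G = Tᵀ * S := by
    rw [← Matrix.transpose_transpose G, hGT, Matrix.transpose_mul, Matrix.transpose_transpose]
  have hGdet : IsUnit G.det := hG.det_pos.ne'.isUnit
  have hdet : IsUnit (Tᵀ.det * S.det) := by rw [← Matrix.det_mul, ← hG']; exact hGdet
  have hTu : IsUnit T.det := by
    have := isUnit_of_mul_isUnit_left hdet; rwa [Matrix.det_transpose] at this
  have hSu : IsUnit S.det := isUnit_of_mul_isUnit_right hdet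
  have hTT := Matrix.nonsing_inv_mul _ hTu
  have hSS := Matrix.nonsing_inv_mul _ hSu
  have hSS' := Matrix.mul_nonsing_inv _ hSu
  have hTi : (T⁻¹).map star = S⁻¹ := conj_nonsing_inv T
  have hSi : (S⁻¹).map star = T⁻¹ := by rw [← hTi, map_star_map_star]
  set C' := T * C * S⁻¹ with hC'
  set X := T * D.map star * T⁻¹ with hX
  set P' := T * P * T⁻¹ with hP'
  have hCsymm : C'.IsSymm := by
    have h1 : Cᵀ * Tᵀ * S = Sᵀ * T * C := by
      have := hC.eq
      rw [Matrix.transpose_mul, Matrix.transpose_transpose, hGT, hG', ← Matrix.mul_assoc] at this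
      exact this.symm
    have h2 := congrArg (fun M => (S⁻¹)ᵀ * M * S⁻¹) h1
    have hS' : (S⁻¹)ᵀ * Sᵀ = 1 := by
      rw [← Matrix.transpose_mul, hSS', Matrix.transpose_one]
    have e1 : (S⁻¹)ᵀ * (Cᵀ * Tᵀ * S) * S⁻¹ = C'ᵀ := by
      simp only [hC', Matrix.transpose_mul, Matrix.mul_assoc, hSS', Matrix.mul_one]
    have e2 : (S⁻¹)ᵀ * (Sᵀ * T * C) * S⁻¹ = C' := by
      rw [Matrix.mul_assoc Sᵀ, ← Matrix.mul_assoc, hS', Matrix.one_mul]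
    exact e1.symm.trans (h2.trans e2)
  have hCdet' : IsUnit C'.det := by
    rw [hC', Matrix.det_mul, Matrix.det_mul]
    exact (hTu.mul hCdet).mul ((Matrix.isUnit_nonsing_inv_det_iff).2 hSu)
  have hconj : ∀ M N : Matrix (Fin m) (Fin m) ℂ, T * (M * N) * T⁻¹
      = (T * M * T⁻¹) * (T * N * T⁻¹) := by
    intro M N
    simp only [Matrix.mul_assoc]
    rw [← Matrix.mul_assoc T⁻¹ T, hTT, Matrix.one_mul]
  have hconj2 : ∀ M, T * (M * C) * S⁻¹ = (T * M * T⁻¹) * C' := by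
    intro M
    simp only [hC', Matrix.mul_assoc]
    rw [← Matrix.mul_assoc T⁻¹ T, hTT, Matrix.one_mul]
  have hconj3 : ∀ M, T * (C * M) * S⁻¹ = C' * (S * M * S⁻¹) := by
    intro M
    simp only [hC', Matrix.mul_assoc]
    rw [← Matrix.mul_assoc S⁻¹ S, hSS, Matrix.one_mul]
  have hCC : C'ᴴ = C'.map star := by
    change C'ᵀ.map star = _
    rw [hCsymm.eq]
  have hN : T * (C * C.map star) * T⁻¹ = C' * C'ᴴ := by
    rw [hCC, hC', map_star_mul, map_star_mul, hSi]
    simp only [Matrix.mul_assoc]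
    rw [← hS, ← Matrix.mul_assoc S⁻¹ S, hSS, Matrix.one_mul]
  -- the four structure equations in an orthonormal basis
  have r1 : T * A * T⁻¹ = c • 1 - Xᴴ := by
    have h := conformal_conjugate hTu hSu (hG' ▸ hcon)
    have e : S * D * S⁻¹ = X.map star := by
      rw [hX, map_star_mul, map_star_mul, map_star_map_star, hTi]
    rw [e, eq_sub_iff_add_eq, ← eq_sub_iff_add_eq'] at h
    have h' := congrArg Matrix.transpose h
    rw [Matrix.transpose_transpose] at h'
    rw [h', Matrix.transpose_sub, Matrix.transpose_smul, Matrix.transpose_one]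
    rfl
  have r2 : X * C' + C' * Xᵀ = (a + star c) • C' := by
    have h := conformal_conjugate hTu hSu (hG' ▸ conformal_conj hG.isHermitian hcon)
    have h' := congrArg (fun M => T * M * S⁻¹) hUR
    simp only [Matrix.mul_sub, Matrix.sub_mul, hconj2, hconj3, h] at h'
    simp only [Matrix.mul_smul, Matrix.mul_one, Matrix.smul_mul, ← hC', ← hX] at h'
    rw [add_smul, ← h']
    abel
  have r3 : P' * C' + C' * P'ᵀ = (l + c') • C' := by
    have h := conformal_conjugate hTu hSu (hG' ▸ hcon')
    have h' := congrArg (fun M => T * M * S⁻¹) hP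
    simp only [Matrix.mul_sub, Matrix.sub_mul, hconj2, hconj3, h] at h'
    simp only [Matrix.mul_smul, Matrix.mul_one, Matrix.smul_mul, ← hC', ← hP'] at h'
    rw [add_smul, ← h']
    abel
  have r4 : X * (c • 1 - Xᴴ) - ((c • 1 - Xᴴ) * X + C' * C'ᴴ)
      = a • (c • 1 - Xᴴ) + b • X + P' := by
    have h := congrArg (fun M => T * M * T⁻¹) hUL
    rw [← r1, ← hN]
    simpa only [Matrix.mul_sub, Matrix.sub_mul, Matrix.mul_add, Matrix.add_mul, hconj,
      Matrix.mul_smul, Matrix.smul_mul, ← hX, ← hP'] using h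
  -- A scalar w acts on C' as 2w, so half of the eigenvalue is subtracted.
  have hskew : ∀ (M : Matrix (Fin m) (Fin m) ℂ) (d : ℂ), M * C' + C' * Mᵀ = d • C' →
      (M - (d / 2) • 1) * C' + C' * (M - (d / 2) • 1)ᵀ = 0 := by
    intro M d h
    simp only [Matrix.transpose_sub, Matrix.transpose_smul, Matrix.transpose_one, Matrix.sub_mul,
      Matrix.mul_sub, Matrix.smul_mul, Matrix.mul_smul, Matrix.one_mul, Matrix.mul_one]
    have e : (d / 2) • C' + (d / 2) • C' = d • C' := by rw [← add_smul, add_halves]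
    rw [← sub_eq_zero] at h
    rw [← h, ← e]
    abel
  -- The scalar c collects what is left when X and P' are replaced by X − w and P' − (l + c')/2,
  -- where w = (a + c̄)/2.
  have key := trace_sq_of_commutator (a := -a) (b := b)
    (c := a * c - a * star ((a + star c) / 2) + b * ((a + star c) / 2) + (l + c') / 2)
    hCsymm hCdet' (hskew X _ r2) (hskew P' _ r3) (by
      generalize (a + star c) / 2 = w
      rw [Matrix.conjTranspose_sub, Matrix.conjTranspose_smul, Matrix.conjTranspose_one]
      have r5 : Xᴴ * X - X * Xᴴ - C' * C'ᴴ = a • (c • 1 - Xᴴ) + b • X + P' := by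
        rw [← r4]
        simp only [Matrix.mul_sub, Matrix.sub_mul, Matrix.mul_smul, Matrix.smul_mul,
          Matrix.one_mul, Matrix.mul_one]
        abel
      have r6 : (Xᴴ - star w • 1) * (X - w • 1) - (X - w • 1) * (Xᴴ - star w • 1)
          = Xᴴ * X - X * Xᴴ := by
        simp only [Matrix.mul_sub, Matrix.sub_mul, Matrix.mul_smul, Matrix.smul_mul,
          Matrix.one_mul, Matrix.mul_one, smul_sub, smul_smul, mul_comm w]
        abel
      rw [r6, r5]
      module)
  rw [← hN] at key
  have ht : ∀ M, (T * M * T⁻¹).trace = M.trace := by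
    intro M
    rw [Matrix.trace_mul_comm, ← Matrix.mul_assoc, hTT, Matrix.one_mul]
  rwa [← hconj, ht, ht] at key

end Definite

/-! ## Polynomial functions of the real and imaginary parts of the entries -/

section Polynomials

variable {m r : ℕ}

/-- Complex valued functions on tuples of matrices whose real and imaginary parts are real
polynomials in the real and imaginary parts of the entries. -/
def IsPolyFun (f : (Fin r → Matrix (Fin m) (Fin m) ℂ) → ℂ) : Prop :=
  ∃ P Q : MvPolynomial (Fin r × Fin m × Fin m × Bool) ℝ, ∀ C,
    f C = MvPolynomial.eval (realCoords C) P + MvPolynomial.eval (realCoords C) Q * Complex.I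

variable {f g : (Fin r → Matrix (Fin m) (Fin m) ℂ) → ℂ}

theorem IsPolyFun.const (c : ℂ) :
    IsPolyFun (fun _ : Fin r → Matrix (Fin m) (Fin m) ℂ => c) :=
  ⟨MvPolynomial.C c.re, MvPolynomial.C c.im, fun C => by simp⟩

theorem IsPolyFun.add (hf : IsPolyFun f) (hg : IsPolyFun g) : IsPolyFun (fun C => f C + g C) := by
  obtain ⟨P, Q, h⟩ := hf
  obtain ⟨P', Q', h'⟩ := hg
  refine ⟨P + P', Q + Q', fun C => ?_⟩
  change f C + g C = _
  rw [h, h']; push_cast [map_add]; ring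

theorem IsPolyFun.mul (hf : IsPolyFun f) (hg : IsPolyFun g) : IsPolyFun (fun C => f C * g C) := by
  obtain ⟨P, Q, h⟩ := hf
  obtain ⟨P', Q', h'⟩ := hg
  refine ⟨P * P' - Q * Q', P * Q' + Q * P', fun C => ?_⟩
  change f C * g C = _
  rw [h, h']; push_cast [map_add, map_mul, map_sub]
  linear_combination (MvPolynomial.eval (realCoords C) Q : ℂ)
    * (MvPolynomial.eval (realCoords C) Q' : ℂ) * Complex.I_mul_I

theorem IsPolyFun.sum {ι : Type*} (s : Finset ι)
    {f : ι → (Fin r → Matrix (Fin m) (Fin m) ℂ) → ℂ} (hf : ∀ i ∈ s, IsPolyFun (f i)) :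
    IsPolyFun (fun C => ∑ i ∈ s, f i C) := by
  classical
  induction s using Finset.induction_on with
  | empty => simpa using IsPolyFun.const 0
  | insert a s ha ih =>
    simp only [Finset.sum_insert ha]
    exact (hf a (Finset.mem_insert_self a s)).add
      (ih fun i hi => hf i (Finset.mem_insert_of_mem hi))

theorem IsPolyFun.prod {ι : Type*} (s : Finset ι)
    {f : ι → (Fin r → Matrix (Fin m) (Fin m) ℂ) → ℂ} (hf : ∀ i ∈ s, IsPolyFun (f i)) :
    IsPolyFun (fun C => ∏ i ∈ s, f i C) := by
  classical
  induction s using Finset.induction_on with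
  | empty => simpa using IsPolyFun.const 1
  | insert a s ha ih =>
    simp only [Finset.prod_insert ha]
    exact (hf a (Finset.mem_insert_self a s)).mul
      (ih fun i hi => hf i (Finset.mem_insert_of_mem hi))

theorem IsPolyFun.sub (hf : IsPolyFun f) (hg : IsPolyFun g) : IsPolyFun (fun C => f C - g C) := by
  simpa [sub_eq_add_neg] using hf.add ((IsPolyFun.const (-1)).mul hg)

theorem IsPolyFun.entry (s : Fin r) (i j : Fin m) :
    IsPolyFun (fun C : Fin r → Matrix (Fin m) (Fin m) ℂ => C s i j) :=
  ⟨MvPolynomial.X (s, i, j, false), MvPolynomial.X (s, i, j, true), fun C => by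
    simp [realCoords]⟩

theorem IsPolyFun.star_entry (s : Fin r) (i j : Fin m) :
    IsPolyFun (fun C : Fin r → Matrix (Fin m) (Fin m) ℂ => star (C s i j)) :=
  ⟨MvPolynomial.X (s, i, j, false), -MvPolynomial.X (s, i, j, true), fun C => by
    apply Complex.ext <;> simp [realCoords]⟩

theorem IsPolyFun.det {ι : Type*} [Fintype ι] [DecidableEq ι]
    {M : (Fin r → Matrix (Fin m) (Fin m) ℂ) → Matrix ι ι ℂ}
    (hM : ∀ i j, IsPolyFun (fun C => M C i j)) : IsPolyFun (fun C => (M C).det) := by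
  simp only [Matrix.det_apply']
  exact IsPolyFun.sum _ fun σ _ => (IsPolyFun.const _).mul (IsPolyFun.prod _ fun i _ => hM _ _)

theorem IsPolyFun.linear (φ : (Fin r → Matrix (Fin m) (Fin m) ℂ) →ₗ[ℂ] ℂ) : IsPolyFun φ := by
  have h : ∀ C, φ C = ∑ s, ∑ i, ∑ j, C s i j * φ (Pi.single s (Matrix.single i j 1)) := by
    intro C
    conv_lhs => rw [← Finset.univ_sum_single C, map_sum]
    refine Finset.sum_congr rfl fun s _ => ?_
    conv_lhs => rw [Matrix.matrix_eq_sum_single (C s)]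
    rw [← LinearMap.single_apply ℂ, map_sum, map_sum]
    refine Finset.sum_congr rfl fun i _ => ?_
    rw [map_sum, map_sum]
    refine Finset.sum_congr rfl fun j _ => ?_
    have : Matrix.single i j (C s i j) = C s i j • Matrix.single i j (1 : ℂ) := by simp
    rw [this, map_smul, map_smul, smul_eq_mul]
    rfl
  have h' : IsPolyFun (fun C => ∑ s, ∑ i, ∑ j,
      C s i j * φ (Pi.single s (Matrix.single i j 1))) :=
    IsPolyFun.sum _ fun s _ => IsPolyFun.sum _ fun i _ => IsPolyFun.sum _ fun j _ =>
      (IsPolyFun.entry s i j).mul (IsPolyFun.const _)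
  simpa only [← h] using h'

/-- Non-vanishing of a polynomial function is non-vanishing of a real polynomial. -/
theorem IsPolyFun.exists_polynomial (hf : IsPolyFun f) :
    ∃ P : MvPolynomial (Fin r × Fin m × Fin m × Bool) ℝ,
      ∀ C, MvPolynomial.eval (realCoords C) P ≠ 0 ↔ f C ≠ 0 := by
  obtain ⟨P, Q, h⟩ := hf
  -- The polynomial is |f|².
  refine ⟨P * P + Q * Q, fun C => not_congr ?_⟩
  rw [h, map_add, map_mul, map_mul, ← Complex.normSq_eq_zero, Complex.normSq_add_mul_I, sq, sq]

end Polynomials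

/-! ## Generic tuples of operators -/

section Generic

variable {m r : ℕ} {G : Matrix (Fin m) (Fin m) ℂ}

/-- The linear system for the infinitesimal stabilizer of the span of a tuple of operators. -/
noncomputable def stabilizerSystem (G : Matrix (Fin m) (Fin m) ℂ) :
    (Fin r → Matrix (Fin m) (Fin m) ℂ) →ₗ[ℂ]
      (Matrix (Fin m) (Fin m) ℂ × Matrix (Fin r) (Fin r) ℂ) →ₗ[ℂ]
        (Fin r → Matrix (Fin m) (Fin m) ℂ) :=
  LinearMap.mk₂ ℂ
    (fun C v s => v.1 * C s + C s * (G⁻¹ * v.1ᵀ * G) - ∑ t, v.2 s t • C t)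
    (fun C C' v => by
      funext s
      simp only [Pi.add_apply, Matrix.mul_add, Matrix.add_mul, smul_add, Finset.sum_add_distrib]
      abel)
    (fun c C v => by
      funext s
      simp only [Pi.smul_apply, Matrix.mul_smul, Matrix.smul_mul, smul_sub, smul_add,
        Finset.smul_sum, smul_comm c])
    (fun C v v' => by
      funext s
      simp only [Pi.add_apply, Prod.fst_add, Prod.snd_add, Matrix.transpose_add, Matrix.mul_add,
        Matrix.add_mul, Matrix.add_apply, add_smul, Finset.sum_add_distrib]
      abel)
    (fun c C v => by
      funext s
      simp only [Pi.smul_apply, Prod.smul_fst, Prod.smul_snd, Matrix.transpose_smul,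
        Matrix.mul_smul, Matrix.smul_mul, Matrix.smul_apply, smul_sub, smul_add, Finset.smul_sum,
        smul_assoc])

theorem stabilizerSystem_apply (C : Fin r → Matrix (Fin m) (Fin m) ℂ)
    (v : Matrix (Fin m) (Fin m) ℂ × Matrix (Fin r) (Fin r) ℂ) (s : Fin r) :
    stabilizerSystem G C v s = v.1 * C s + C s * (G⁻¹ * v.1ᵀ * G) - ∑ t, v.2 s t • C t := rfl

/-- The stabilizer system together with the trace. -/
noncomputable def tracedSystem (G : Matrix (Fin m) (Fin m) ℂ)
    (C : Fin r → Matrix (Fin m) (Fin m) ℂ) :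
    (Matrix (Fin m) (Fin m) ℂ × Matrix (Fin r) (Fin r) ℂ) →ₗ[ℂ]
      (Fin r → Matrix (Fin m) (Fin m) ℂ) × ℂ :=
  (stabilizerSystem G C).prod (Matrix.traceLinearMap (Fin m) ℂ ℂ ∘ₗ LinearMap.fst ℂ _ _)

/-- Removing the scalar part d = tr B / m from a stabilizing B gives a kernel element of the system.
The scalar d acts on operators as 2d, hence the shift of the coefficients by 2d. -/
theorem hasScalarStabilizer_of_injective (hdet : IsUnit G.det)
    {C : Fin r → Matrix (Fin m) (Fin m) ℂ} (h : Function.Injective (tracedSystem G C)) :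
    HasScalarStabilizer G (Submodule.span ℂ (Set.range C)) := by
  intro B hB
  rcases Nat.eq_zero_or_pos m with rfl | hm
  · convert Submodule.zero_mem _
    exact Subsingleton.elim _ _
  have hm' : (m : ℂ) ≠ 0 := by exact_mod_cast hm.ne'
  choose c hc using fun s => (Submodule.mem_span_range_iff_exists_fun ℂ).1
    (hB (C s) (Submodule.subset_span ⟨s, rfl⟩))
  set d := B.trace / m with hd
  have h0 : tracedSystem G C (B - d • 1, Matrix.of c - (2 * d) • 1) = 0 := by
    refine Prod.ext (funext fun s => ?_) ?_
    · change stabilizerSystem G C _ s = 0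
      rw [stabilizerSystem_apply]
      have e1 : G⁻¹ * (B - d • (1 : Matrix (Fin m) (Fin m) ℂ))ᵀ * G
          = G⁻¹ * Bᵀ * G - d • 1 := by
        simp only [Matrix.transpose_sub, Matrix.transpose_smul, Matrix.transpose_one,
          Matrix.mul_sub, Matrix.sub_mul, Matrix.mul_smul, Matrix.smul_mul, Matrix.mul_one,
          Matrix.nonsing_inv_mul _ hdet]
      have e2 : ∑ t, (Matrix.of c - (2 * d) • (1 : Matrix (Fin r) (Fin r) ℂ)) s t • C t
          = ∑ t, c s t • C t - (2 * d) • C s := by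
        simp [sub_smul, Finset.sum_sub_distrib, Matrix.one_apply, ite_smul]
      simp only [e1, e2, hc s]
      simp only [Matrix.sub_mul, Matrix.mul_sub, Matrix.smul_mul, Matrix.mul_smul, Matrix.one_mul,
        Matrix.mul_one]
      module
    · change (B - d • 1).trace = 0
      rw [Matrix.trace_sub, Matrix.trace_smul, Matrix.trace_one, Fintype.card_fin, smul_eq_mul, hd,
        div_mul_cancel₀ _ hm', sub_self]
  have h1 := h (h0.trans (map_zero _).symm)
  have h2 : B - d • 1 = 0 := congrArg Prod.fst h1
  exact Submodule.mem_span_singleton.2 ⟨d, (sub_eq_zero.1 h2).symm⟩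

/-- The trace component removes the scalars, and independence of C then removes the coefficients.
Injectivity at one tuple supplies the left inverse from which the polynomial is built. -/
theorem injective_of_hasScalarStabilizer (hm : 0 < m)
    {C : Fin r → Matrix (Fin m) (Fin m) ℂ} (hC : LinearIndependent ℂ C)
    (h : HasScalarStabilizer G (Submodule.span ℂ (Set.range C))) :
    Function.Injective (tracedSystem G C) := by
  rw [← LinearMap.ker_eq_bot, LinearMap.ker_eq_bot']
  rintro ⟨B, c⟩ h0
  have h1 : ∀ s, B * C s + C s * (G⁻¹ * Bᵀ * G) = ∑ t, c s t • C t := fun s =>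
    sub_eq_zero.1 (congrFun (congrArg Prod.fst h0) s)
  have h2 : B.trace = 0 := congrArg Prod.snd h0
  have hm' : (m : ℂ) ≠ 0 := by exact_mod_cast hm.ne'
  obtain ⟨d, rfl⟩ := Submodule.mem_span_singleton.1 (h B fun X hX => by
    induction hX using Submodule.span_induction with
    | mem X hX =>
      obtain ⟨s, rfl⟩ := hX
      rw [h1]
      exact Submodule.sum_mem _ fun t _ =>
        Submodule.smul_mem _ _ (Submodule.subset_span ⟨t, rfl⟩)
    | zero => simp
    | add X Y _ _ h h' =>
      convert Submodule.add_mem _ h h' using 1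
      rw [Matrix.mul_add, Matrix.add_mul]; abel
    | smul a X _ h =>
      convert Submodule.smul_mem _ a h using 1
      rw [Matrix.mul_smul, Matrix.smul_mul, smul_add])
  rw [Matrix.trace_smul, Matrix.trace_one, Fintype.card_fin, smul_eq_mul] at h2
  have hd : d = 0 := (mul_eq_zero.1 h2).resolve_right hm'
  subst hd
  refine Prod.ext (zero_smul _ _) (Matrix.ext fun s t => ?_)
  have h3 := h1 s
  simp only [zero_smul, Matrix.zero_mul, Matrix.transpose_zero, Matrix.mul_zero, add_zero] at h3
  exact Fintype.linearIndependent_iff.1 hC _ h3.symm t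

/-- The condition of having a scalar stabilizer contains the non-vanishing set of a polynomial
that does not vanish at a given tuple with this property. -/
theorem exists_isPolyFun_hasScalarStabilizer (hdet : IsUnit G.det) (hm : 0 < m)
    {C₀ : Fin r → Matrix (Fin m) (Fin m) ℂ} (hC : LinearIndependent ℂ C₀)
    (h : HasScalarStabilizer G (Submodule.span ℂ (Set.range C₀))) :
    ∃ f : (Fin r → Matrix (Fin m) (Fin m) ℂ) → ℂ, IsPolyFun f ∧ f C₀ ≠ 0 ∧
      ∀ C, f C ≠ 0 → HasScalarStabilizer G (Submodule.span ℂ (Set.range C)) := by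
  -- J is frozen at C₀. The determinant of J ∘ `tracedSystem G C` is polynomial in C, equals 1 at
  -- C₀, and its non-vanishing forces injectivity at C.
  obtain ⟨J, hJ⟩ := LinearMap.exists_leftInverse_of_injective (tracedSystem G C₀)
    (LinearMap.ker_eq_bot.2 (injective_of_hasScalarStabilizer hm hC h))
  let b := Module.finBasis ℂ (Matrix (Fin m) (Fin m) ℂ × Matrix (Fin r) (Fin r) ℂ)
  refine ⟨fun C => (LinearMap.toMatrix b b (J ∘ₗ tracedSystem G C)).det, ?_, ?_, fun C hC => ?_⟩
  · refine IsPolyFun.det fun i j => ?_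
    have e : ∀ C : Fin r → Matrix (Fin m) (Fin m) ℂ,
        LinearMap.toMatrix b b (J ∘ₗ tracedSystem G C) i j
        = (b.coord i ∘ₗ J ∘ₗ LinearMap.inl ℂ _ ℂ ∘ₗ (stabilizerSystem G).flip (b j)) C
          + b.coord i (J (0, (b j).1.trace)) := by
      intro C
      rw [LinearMap.toMatrix_apply]
      simp only [LinearMap.comp_apply, LinearMap.flip_apply, LinearMap.inl_apply,
        Module.Basis.coord_apply, ← Finsupp.add_apply, ← map_add]
      simp [tracedSystem]
    simp only [e]
    exact (IsPolyFun.linear _).add (IsPolyFun.const _)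
  · simp [hJ]
  · refine hasScalarStabilizer_of_injective hdet ?_
    rw [← LinearMap.ker_eq_bot, LinearMap.ker_eq_bot']
    intro v hv
    by_contra hv0
    have h1 : LinearMap.det (J ∘ₗ tracedSystem G C) ≠ 0 := by
      rw [← LinearMap.det_toMatrix b]; exact hC
    have h2 := LinearMap.isUnit_iff_isUnit_det (J ∘ₗ tracedSystem G C) |>.2 h1.isUnit
    have h3 := (Module.End.isUnit_iff _).1 h2
    exact hv0 (h3.1 (by simp [hv]))

end Generic

/-! ### Explicit symbols at which the polynomials do not vanish. -/

section Examples

variable {m r : ℕ} {G : Matrix (Fin m) (Fin m) ℂ}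

/-- The CR symbol with a given basis of its space of operators. -/
def CRSymbol.ofBasis (hG : G.IsHermitian) (hdet : IsUnit G.det)
    (C : Fin r → Matrix (Fin m) (Fin m) ℂ) (hC : ∀ s, ((C s)ᵀ * G).IsSymm)
    (hli : LinearIndependent ℂ C) : CRSymbol m r where
  levi := G
  levi_hermitian := hG
  levi_nondegenerate := hdet
  ops := Submodule.span ℂ (Set.range C)
  ops_selfAdjoint X hX := by
    induction hX using Submodule.span_induction with
    | mem X hX => obtain ⟨s, rfl⟩ := hX; exact hC s
    | zero => simp [Matrix.IsSymm]
    | add X Y _ _ h h' => rw [Matrix.transpose_add, Matrix.add_mul]; exact h.add h'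
    | smul a X _ h => rw [Matrix.transpose_smul, Matrix.smul_mul]; exact h.smul a
  finrank_ops := by rw [finrank_span_eq_card hli, Fintype.card_fin]

/-- Self-adjoint operators whose matrices of bilinear forms are diagonal with entries the powers
`i ^ s`. -/
noncomputable def powerTuple (r : ℕ) (G : Matrix (Fin m) (Fin m) ℂ) :
    Fin r → Matrix (Fin m) (Fin m) ℂ :=
  fun s => (G⁻¹)ᵀ * Matrix.diagonal fun i : Fin m => ((i : ℕ) : ℂ) ^ (s : ℕ)

theorem powerTuple_isSymm (hdet : IsUnit G.det) (s : Fin r) :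
    ((powerTuple r G s)ᵀ * G).IsSymm := by
  rw [powerTuple, Matrix.transpose_mul, Matrix.transpose_transpose, Matrix.mul_assoc,
    Matrix.nonsing_inv_mul _ hdet, Matrix.mul_one, Matrix.diagonal_transpose]
  exact Matrix.isSymm_diagonal _

open Polynomial in
-- Up to the factor from G, the span consists of the values at 0, …, m − 1 of polynomials of degree
-- < r (with 0 ^ 0 = 1), so interpolation applies.
theorem sum_smul_powerTuple (c : Fin r → ℂ) :
    ∑ s, c s • powerTuple r G s = (G⁻¹)ᵀ * Matrix.diagonal
      fun i : Fin m => (∑ s : Fin r, C (c s) * X ^ (s : ℕ) : ℂ[X]).eval ((i : ℕ) : ℂ) := by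
  simp only [powerTuple, ← Matrix.mul_smul, ← Finset.mul_sum]
  congr 1
  ext i j
  by_cases h : i = j
  · subst h
    simp [Matrix.sum_apply, eval_finsetSum]
  · simp [Matrix.sum_apply, h]

open Polynomial in
theorem degree_sum_lt (c : Fin r → ℂ) :
    (∑ s : Fin r, C (c s) * X ^ (s : ℕ) : ℂ[X]).degree < r := by
  refine (degree_sum_le _ _).trans_lt ((Finset.sup_lt_iff (WithBot.bot_lt_coe r)).2 fun s _ => ?_)
  exact (degree_C_mul_X_pow_le _ _).trans_lt (WithBot.coe_lt_coe.2 s.2)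

open Polynomial in
theorem eq_of_eval_fin {p q : ℂ[X]} (hp : p.degree < m) (hq : q.degree < m)
    (h : ∀ i : Fin m, p.eval ((i : ℕ) : ℂ) = q.eval ((i : ℕ) : ℂ)) : p = q := by
  refine Polynomial.eq_of_degrees_lt_of_eval_index_eq (Finset.univ : Finset (Fin m))
    (v := fun i : Fin m => ((i : ℕ) : ℂ)) ?_ (by simpa using hp) (by simpa using hq) fun i _ => h i
  intro i _ j _ hij
  exact Fin.ext (Nat.cast_injective (R := ℂ) hij)

theorem eq_of_mul_left_eq (hdet : IsUnit G.det) {A B : Matrix (Fin m) (Fin m) ℂ}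
    (h : (G⁻¹)ᵀ * A = (G⁻¹)ᵀ * B) : A = B := by
  have hG : Gᵀ * (G⁻¹)ᵀ = 1 := by
    rw [← Matrix.transpose_mul, Matrix.nonsing_inv_mul _ hdet, Matrix.transpose_one]
  have := congrArg (Gᵀ * ·) h
  simpa only [← Matrix.mul_assoc, hG, Matrix.one_mul] using this

open Polynomial in
theorem powerTuple_linearIndependent (hdet : IsUnit G.det) (hrm : r ≤ m) :
    LinearIndependent ℂ (powerTuple r G) := by
  rw [Fintype.linearIndependent_iff]
  intro c hc
  rw [sum_smul_powerTuple, ← Matrix.mul_zero ((G⁻¹)ᵀ)] at hc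
  have h1 := eq_of_mul_left_eq hdet hc
  have h2 : (∑ s : Fin r, C (c s) * X ^ (s : ℕ) : ℂ[X]) = 0 := by
    refine eq_of_eval_fin (m := m) ((degree_sum_lt c).trans_le (by exact_mod_cast hrm))
      (by simp) fun i => ?_
    simpa using congrFun (congrFun h1 i) i
  intro s
  have h3 := congrArg (fun p : ℂ[X] => p.coeff s) h2
  simpa [finsetSum_coeff, coeff_C_mul, coeff_X_pow, Fin.val_inj] using h3

open Polynomial in
/-- The polynomials of degree less than `r`, as functions on more than `r` points, are only
stable under multiplication by constants. -/
theorem eval_eq_of_mul_stable (hrm : r < m) {q : ℂ[X]} (hq : q.degree < r)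
    (h : ∀ s < r, ∃ p : ℂ[X], p.degree < r ∧
      ∀ i : Fin m, q.eval ((i : ℕ) : ℂ) * ((i : ℕ) : ℂ) ^ s = p.eval ((i : ℕ) : ℂ)) :
    ∃ c : ℂ, q = C c := by
  by_contra hc
  have hd : 0 < q.natDegree := by
    by_contra h0
    exact hc ⟨_, eq_C_of_natDegree_eq_zero (Nat.eq_zero_of_not_pos h0)⟩
  have hq0 : q ≠ 0 := by rintro rfl; simp at hd
  have hdr : q.natDegree < r := (natDegree_lt_iff_degree_lt hq0).2 hq
  -- The exponent raises the degree of the product to exactly r: too large for p, but still below m,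
  -- so that the m values determine the polynomial.
  obtain ⟨p, hp, hpe⟩ := h (r - q.natDegree) (by omega)
  have hdeg : (q * X ^ (r - q.natDegree)).degree = (r : WithBot ℕ) := by
    rw [degree_mul, degree_X_pow, degree_eq_natDegree hq0]
    exact_mod_cast (by omega : q.natDegree + (r - q.natDegree) = r)
  have heq : q * X ^ (r - q.natDegree) = p := by
    refine eq_of_eval_fin (m := m) (by rw [hdeg]; exact_mod_cast hrm)
      (hp.trans (by exact_mod_cast hrm)) fun i => ?_
    rw [eval_mul, eval_pow, eval_X, hpe i]
  rw [← heq, hdeg] at hp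
  exact lt_irrefl _ hp

open Polynomial in
-- On diagonal forms, the exponents 0 and 1, both available as 1 < r, force B' to be diagonal. Its
-- diagonal then multiplies polynomials of degree < r into themselves on m > r points, so it is
-- constant.
theorem powerTuple_hasScalarStabilizer (hdet : IsUnit G.det) (hr : 1 < r) (hrm : r < m) :
    HasScalarStabilizer G (Submodule.span ℂ (Set.range (powerTuple r G))) := by
  intro B hB
  have hG : Gᵀ * (G⁻¹)ᵀ = 1 := by
    rw [← Matrix.transpose_mul, Matrix.nonsing_inv_mul _ hdet, Matrix.transpose_one]
  have hG' : (G⁻¹)ᵀ * Gᵀ = 1 := by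
    rw [← Matrix.transpose_mul, Matrix.mul_nonsing_inv _ hdet, Matrix.transpose_one]
  -- Left multiplication by Gᵀ turns operators into bilinear forms Λ, on which B acts by B'Λ + ΛB'ᵀ.
  set B' := Gᵀ * B * (G⁻¹)ᵀ with hB'
  have hBt : B'ᵀ = G⁻¹ * Bᵀ * G := by
    simp only [hB', Matrix.transpose_mul, Matrix.transpose_transpose, Matrix.mul_assoc]
  have key : ∀ s < r, ∃ p : ℂ[X], p.degree < r ∧ ∀ i j : Fin m,
      B' i j * ((j : ℕ) : ℂ) ^ s + ((i : ℕ) : ℂ) ^ s * B' j i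
        = if i = j then p.eval ((i : ℕ) : ℂ) else 0 := by
    intro s hs
    obtain ⟨c, hc⟩ := (Submodule.mem_span_range_iff_exists_fun ℂ).1
      (hB _ (Submodule.subset_span ⟨⟨s, hs⟩, rfl⟩))
    refine ⟨_, degree_sum_lt c, fun i j => ?_⟩
    rw [sum_smul_powerTuple] at hc
    have h1 : (G⁻¹)ᵀ * (B' * Matrix.diagonal (fun i : Fin m => ((i : ℕ) : ℂ) ^ s)
        + Matrix.diagonal (fun i : Fin m => ((i : ℕ) : ℂ) ^ s) * B'ᵀ)
        = B * powerTuple r G ⟨s, hs⟩ + powerTuple r G ⟨s, hs⟩ * (G⁻¹ * Bᵀ * G) := by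
      rw [← hBt, powerTuple, Matrix.mul_add]
      congr 1
      · rw [hB', ← Matrix.mul_assoc, ← Matrix.mul_assoc, ← Matrix.mul_assoc, hG', Matrix.one_mul,
          Matrix.mul_assoc]
      · rw [Matrix.mul_assoc]
    have h2 := eq_of_mul_left_eq hdet (h1.trans hc.symm)
    have h3 := congrFun (congrFun h2 i) j
    simpa [Matrix.mul_diagonal, Matrix.diagonal_mul, Matrix.diagonal_apply] using h3
  have hoff : ∀ i j, i ≠ j → B' i j = 0 := by
    intro i j hij
    obtain ⟨p, -, h0⟩ := key 0 (by omega)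
    obtain ⟨q, -, h1⟩ := key 1 hr
    have h0' := h0 i j
    have h1' := h1 i j
    rw [if_neg hij] at h0' h1'
    have h2 : B' i j * (((j : ℕ) : ℂ) - ((i : ℕ) : ℂ)) = 0 := by
      linear_combination h1' - ((i : ℕ) : ℂ) * h0'
    refine (mul_eq_zero.1 h2).resolve_right fun h => hij ?_
    exact Fin.ext (by exact_mod_cast (sub_eq_zero.1 h).symm)
  obtain ⟨q, hq, hqe⟩ := key 0 (by omega)
  have hdiag : ∀ i : Fin m, q.eval ((i : ℕ) : ℂ) = 2 * B' i i := by
    intro i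
    have := hqe i i
    rw [if_pos rfl] at this
    rw [← this]; ring
  obtain ⟨c, rfl⟩ := eval_eq_of_mul_stable hrm hq fun s hs => by
    obtain ⟨p, hp, hpe⟩ := key s hs
    refine ⟨p, hp, fun i => ?_⟩
    have := hpe i i
    rw [if_pos rfl] at this
    rw [hdiag, ← this]; ring
  have hBc : B' = (c / 2) • 1 := by
    ext i j
    by_cases hij : i = j
    · subst hij
      have := hdiag i
      rw [eval_C] at this
      simp [this]
    · simp [hoff i j hij, hij]
  refine Submodule.mem_span_singleton.2 ⟨c / 2, ?_⟩
  have h1 : B = (G⁻¹)ᵀ * B' * Gᵀ := by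
    rw [hB']
    simp only [Matrix.mul_assoc, hG', Matrix.mul_one]
    rw [← Matrix.mul_assoc, hG', Matrix.one_mul]
  rw [h1, hBc, Matrix.mul_smul, Matrix.mul_one, Matrix.smul_mul, hG']

theorem powerTuple_zero_det (hdet : IsUnit G.det) (hr : 0 < r) :
    (powerTuple r G ⟨0, hr⟩).det ≠ 0 := by
  simp only [powerTuple, pow_zero, Matrix.det_mul, Matrix.det_transpose]
  simpa using ((Matrix.isUnit_nonsing_inv_det_iff).2 hdet).ne_zero

/-- A self-adjoint antilinear operator whose square is not a multiple of the identity. -/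
theorem exists_trace_sq_ne (hG : G.PosDef) (hm : 1 < m) :
    ∃ C : Matrix (Fin m) (Fin m) ℂ, (Cᵀ * G).IsSymm ∧ C.det ≠ 0 ∧
      (m : ℂ) * (C * C.map star * (C * C.map star)).trace ≠ (C * C.map star).trace ^ 2 := by
  obtain ⟨T, hT⟩ := exists_eq_conjTranspose_mul_self hG.transpose.posSemidef
  set S := T.map star with hS
  have hGT : Gᵀ = Sᵀ * T := hT
  have hG' : G = Tᵀ * S := by
    rw [← Matrix.transpose_transpose G, hGT, Matrix.transpose_mul, Matrix.transpose_transpose]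
  have hdet : IsUnit (Tᵀ.det * S.det) := by
    rw [← Matrix.det_mul, ← hG']; exact hG.det_pos.ne'.isUnit
  have hTu : IsUnit T.det := by
    have := isUnit_of_mul_isUnit_left hdet; rwa [Matrix.det_transpose] at this
  have hSu : IsUnit S.det := isUnit_of_mul_isUnit_right hdet
  have hTT' := Matrix.mul_nonsing_inv _ hTu
  have hSS' := Matrix.mul_nonsing_inv _ hSu
  have hTi : (T⁻¹).map star = S⁻¹ := conj_nonsing_inv T
  let i₀ : Fin m := ⟨0, by omega⟩
  -- In an orthonormal basis the operator is diag(2, 1, …, 1). The discriminating quantity is then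
  -- m(m + 15) − (m + 3)² = 9(m − 1).
  let d : Fin m → ℂ := fun i => if i = i₀ then 2 else 1
  set R : Matrix (Fin m) (Fin m) ℂ := Matrix.diagonal d with hR
  have hd : ∀ i, d i ≠ 0 := fun i => by simp only [d]; split_ifs <;> norm_num
  have hRs : R.map star = R := by
    rw [hR]
    ext i j
    simp only [Matrix.map_apply, Matrix.diagonal_apply, d]
    split_ifs <;> simp
  have hN : (T⁻¹ * R * S) * (T⁻¹ * R * S).map star = T⁻¹ * (R * R) * T := by
    rw [map_star_mul, map_star_mul, hTi, hRs, hS, map_star_map_star, ← hS]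
    simp only [Matrix.mul_assoc]
    rw [← Matrix.mul_assoc S, hSS', Matrix.one_mul]
  have hN2 : T⁻¹ * (R * R) * T * (T⁻¹ * (R * R) * T) = T⁻¹ * (R * R * (R * R)) * T := by
    simp only [Matrix.mul_assoc]
    rw [← Matrix.mul_assoc T, hTT', Matrix.one_mul]
  have ht : ∀ M, (T⁻¹ * M * T).trace = M.trace := by
    intro M
    rw [Matrix.trace_mul_comm, ← Matrix.mul_assoc, hTT', Matrix.one_mul]
  refine ⟨T⁻¹ * R * S, ?_, ?_, ?_⟩
  · have e : (T⁻¹ * R * S)ᵀ * G = Sᵀ * R * S := by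
      have hT' : (T⁻¹)ᵀ * Tᵀ = 1 := by
        rw [← Matrix.transpose_mul, hTT', Matrix.transpose_one]
      rw [hG', Matrix.transpose_mul, Matrix.transpose_mul, hR, Matrix.diagonal_transpose]
      simp only [Matrix.mul_assoc]
      rw [← Matrix.mul_assoc (T⁻¹)ᵀ, hT', Matrix.one_mul]
    rw [e, Matrix.IsSymm, Matrix.transpose_mul, Matrix.transpose_mul, Matrix.transpose_transpose,
      hR, Matrix.diagonal_transpose, Matrix.mul_assoc]
  · rw [Matrix.det_mul, Matrix.det_mul]
    refine mul_ne_zero (mul_ne_zero ((Matrix.isUnit_nonsing_inv_det_iff).2 hTu).ne_zero ?_)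
      hSu.ne_zero
    rw [hR, Matrix.det_diagonal]
    exact Finset.prod_ne_zero_iff.2 fun i _ => hd i
  · rw [hN, hN2, ht, ht, hR]
    simp only [Matrix.diagonal_mul_diagonal, Matrix.trace_diagonal]
    have e1 : ∑ i, d i * d i = (m : ℂ) + 3 := by
      have : ∀ i, d i * d i = 1 + if i = i₀ then 3 else 0 := fun i => by
        simp only [d]; split_ifs <;> norm_num
      simp [this, Finset.sum_add_distrib]
    have e2 : ∑ i, d i * d i * (d i * d i) = (m : ℂ) + 15 := by
      have : ∀ i, d i * d i * (d i * d i) = 1 + if i = i₀ then 15 else 0 := fun i => by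
        simp only [d]; split_ifs <;> norm_num
      simp [this, Finset.sum_add_distrib]
    rw [e1, e2]
    intro h
    have h1 : (m : ℂ) = 1 := by linear_combination h / 9
    exact hm.ne' (by exact_mod_cast h1)

end Examples

/-! ### Genericity for r > 1, and for r = 1 with a definite form. -/

section Main

variable {m r : ℕ} {G : Matrix (Fin m) (Fin m) ℂ}

/-- The structure equations at a point of a homogeneous model with a given symbol. -/
theorem CRSymbol.HasHomogeneousModel.structure_equations {σ : CRSymbol m r}
    (hσ : σ.HasHomogeneousModel) :
    ∃ C A D : Fin r → Matrix (Fin m) (Fin m) ℂ, Submodule.span ℂ (Set.range C) = σ.ops ∧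
      (∀ s, ∃ c : ℂ, c • σ.levi = (A s)ᵀ * σ.levi + σ.levi * D s) ∧
      ∀ t s, ∃ (a b : Fin r → ℂ) (P Q : Matrix (Fin m) (Fin m) ℂ),
        (∃ c : ℂ, c • σ.levi = Pᵀ * σ.levi + σ.levi * Q) ∧
        (∀ u, P * C u - C u * Q ∈ Submodule.span ℂ (Set.range C)) ∧
        (D t).map star * A s - (A s * (D t).map star + C s * (C t).map star)
          = ∑ u, a u • A u + ∑ u, b u • (D u).map star + P ∧
        (D t).map star * C s - C s * (A t).map star = ∑ u, a u • C u := by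
  obtain ⟨U, H, hCR, hK, -, hH, p, hp, e, k, z, C, he, hk, hli, hz, hlevi, hspan, hC⟩ := hσ
  have F : IsLeviFrame U H p e k (toComplex z) σ.levi := ⟨hCR, hK, hp, he, hk, hli, hz, hlevi⟩
  obtain ⟨A, D, h1, h2⟩ := F.structure_equations hH hC
  exact ⟨C, A, D, hspan, h1, h2⟩

theorem isGeneric_of_one_lt (hG : G.IsHermitian) (hdet : IsUnit G.det) (hr : 1 < r) (hrm : r < m) :
    IsGenericForLevi G {σ : CRSymbol m r | ¬ σ.HasHomogeneousModel} := by
  have hm : 0 < m := by omega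
  have hr0 : 0 < r := by omega
  have hli := powerTuple_linearIndependent hdet hrm.le (G := G)
  obtain ⟨f, hf, hf0, hfC⟩ := exists_isPolyFun_hasScalarStabilizer hdet hm hli
    (powerTuple_hasScalarStabilizer hdet hr hrm)
  have hd : IsPolyFun (fun C : Fin r → Matrix (Fin m) (Fin m) ℂ => (C ⟨0, hr0⟩).det) :=
    IsPolyFun.det fun i j => IsPolyFun.entry _ i j
  -- The factor f ensures a scalar stabilizer, and the determinant an invertible element of the
  -- span.
  obtain ⟨P, hP⟩ := (hf.mul hd).exists_polynomial
  refine ⟨P, ⟨CRSymbol.ofBasis hG hdet _ (powerTuple_isSymm hdet) hli, powerTuple r G, rfl,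
    ⟨hli, rfl⟩, (hP _).2 (mul_ne_zero hf0 (powerTuple_zero_det hdet hr0))⟩, ?_⟩
  rintro σ C rfl ⟨-, hspan⟩ hPC hσ
  have h := (hP C).1 hPC
  have hW := hfC C (left_ne_zero_of_mul h)
  obtain ⟨C', A, D, hspan', hcon, heq⟩ := hσ.structure_equations
  -- The tuple C' produced by the model need not be C, but the stabilizer condition depends only on
  -- the common span.
  rw [hspan, ← hspan'] at hW
  have hX : C ⟨0, hr0⟩ ∈ Submodule.span ℂ (Set.range C') := by
    rw [hspan', ← hspan]
    exact Submodule.subset_span ⟨_, rfl⟩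
  have hle := finrank_le_one_of_mul_conj_scalar hm
    (hW.mul_conj_mem σ.levi_hermitian σ.levi_nondegenerate hcon heq) hX
    (right_ne_zero_of_mul h).isUnit
  rw [hspan', σ.finrank_ops] at hle
  omega

theorem IsPolyFun.matrix_mul {M N : (Fin r → Matrix (Fin m) (Fin m) ℂ) → Matrix (Fin m) (Fin m) ℂ}
    (hM : ∀ i j, IsPolyFun fun C => M C i j) (hN : ∀ i j, IsPolyFun fun C => N C i j)
    (i j : Fin m) : IsPolyFun fun C => (M C * N C) i j := by
  simp only [Matrix.mul_apply]
  exact IsPolyFun.sum _ fun l _ => (hM i l).mul (hN l j)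

theorem IsPolyFun.trace {M : (Fin r → Matrix (Fin m) (Fin m) ℂ) → Matrix (Fin m) (Fin m) ℂ}
    (hM : ∀ i j, IsPolyFun fun C => M C i j) : IsPolyFun fun C => (M C).trace := by
  simp only [Matrix.trace, Matrix.diag_apply]
  exact IsPolyFun.sum _ fun i _ => hM i i

theorem isGeneric_of_definite (hG : G.IsHermitian) (hdet : IsUnit G.det) (hm : 1 < m)
    (hdef : G.PosDef ∨ (-G).PosDef) :
    IsGenericForLevi G {σ : CRSymbol m 1 | ¬ σ.HasHomogeneousModel} := by
  -- Symmetry and conformality are insensitive to a nonzero factor of G, so a negative definite form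
  -- is replaced by its opposite.
  have hneg : ∃ ε : ℂ, ε ≠ 0 ∧ (ε • G).PosDef := by
    rcases hdef with h | h
    · exact ⟨1, one_ne_zero, by simpa using h⟩
    · exact ⟨-1, by simp, by simpa using h⟩
  obtain ⟨ε, hε, hpos⟩ := hneg
  have hsymm : ∀ X : Matrix (Fin m) (Fin m) ℂ, (Xᵀ * (ε • G)).IsSymm ↔ (Xᵀ * G).IsSymm := by
    intro X
    rw [Matrix.mul_smul, Matrix.IsSymm, Matrix.IsSymm, Matrix.transpose_smul]
    exact (smul_right_injective _ hε).eq_iff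
  have hconf : ∀ {X Y : Matrix (Fin m) (Fin m) ℂ} {c : ℂ}, c • G = Xᵀ * G + G * Y →
      c • (ε • G) = Xᵀ * (ε • G) + (ε • G) * Y := by
    intro X Y _ h
    rw [smul_comm, h, Matrix.mul_smul, Matrix.smul_mul, smul_add]
  set N : (Fin 1 → Matrix (Fin m) (Fin m) ℂ) → Matrix (Fin m) (Fin m) ℂ :=
    fun C => C 0 * (C 0).map star with hN
  have hNp : ∀ i j, IsPolyFun fun C => N C i j := IsPolyFun.matrix_mul
    (fun i j => IsPolyFun.entry 0 i j) (fun i j => IsPolyFun.star_entry 0 i j)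
  have hf : IsPolyFun fun C : Fin 1 → Matrix (Fin m) (Fin m) ℂ => (C 0).det *
      ((m : ℂ) * (N C * N C).trace - (N C).trace * (N C).trace) :=
    (IsPolyFun.det fun i j => IsPolyFun.entry 0 i j).mul
      (((IsPolyFun.const _).mul (IsPolyFun.trace (IsPolyFun.matrix_mul hNp hNp))).sub
        ((IsPolyFun.trace hNp).mul (IsPolyFun.trace hNp)))
  obtain ⟨P, hP⟩ := hf.exists_polynomial
  obtain ⟨C₀, hC₀, hdet₀, htr₀⟩ := exists_trace_sq_ne hpos hm
  have hne : C₀ ≠ 0 := by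
    rintro rfl
    have : Nonempty (Fin m) := ⟨⟨0, by omega⟩⟩
    exact hdet₀ Matrix.det_zero
  have hli : LinearIndependent ℂ fun _ : Fin 1 => C₀ :=
    linearIndependent_unique_iff.2 hne
  refine ⟨P, ⟨CRSymbol.ofBasis hG hdet _ (fun _ => (hsymm C₀).1 hC₀) hli, fun _ => C₀, rfl,
    ⟨hli, rfl⟩, (hP _).2 (mul_ne_zero hdet₀ (sub_ne_zero.2 ?_))⟩, ?_⟩
  · rw [sq] at htr₀; exact htr₀
  rintro σ C rfl ⟨-, hspan⟩ hPC hσ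
  have h := (hP C).1 hPC
  obtain ⟨C', A, D, hspan', hcon, heq⟩ := hσ.structure_equations
  have hrange : Set.range C' = {C' 0} := Set.range_unique
  have hspan1 : ∀ X ∈ Submodule.span ℂ (Set.range C'), ∃ l : ℂ, X = l • C' 0 := by
    intro X hX
    rw [hrange] at hX
    obtain ⟨l, hl⟩ := Submodule.mem_span_singleton.1 hX
    exact ⟨l, hl.symm⟩
  -- As r = 1, the given operator is l times that of the model, which multiplies both sides of the
  -- trace identity by |l|⁴.
  obtain ⟨l, hl⟩ := hspan1 (C 0) (by
    rw [hspan', ← hspan]; exact Submodule.subset_span ⟨0, rfl⟩)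
  have hdetC := left_ne_zero_of_mul h
  have hdetC' : IsUnit (C' 0).det := by
    rw [hl, Matrix.det_smul] at hdetC
    exact (right_ne_zero_of_mul hdetC).isUnit
  obtain ⟨c, hc⟩ := hcon 0
  obtain ⟨a, b, P', Q', ⟨c', hc'⟩, h2, h3, h4⟩ := heq 0 0
  obtain ⟨l', hl'⟩ := hspan1 _ (h2 0)
  simp only [Fin.sum_univ_one] at h3 h4
  have hsC : ((C' 0)ᵀ * σ.levi).IsSymm :=
    σ.ops_selfAdjoint _ (hspan' ▸ Submodule.subset_span ⟨0, rfl⟩)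
  have key := trace_sq_of_structure_equations hpos ((hsymm _).2 hsC) hdetC' (hconf hc) (hconf hc')
    hl' h3 h4
  apply right_ne_zero_of_mul h
  simp only [hN, hl, map_star_smul, Matrix.smul_mul, Matrix.mul_smul, Matrix.trace_smul,
    smul_eq_mul]
  linear_combination (l * star l) ^ 2 * key

end Main

end CRGeom

/-- Here `m` is the rank of `H / K` and `r` that of the Levi kernel `K`, so that the dimension of
the CR manifolds is `2 (m + r) + 1`; the matrix `G` fixes the reduced Levi form, whose signature is
arbitrary for `r > 1` and definite for `r = 1`. -/
theorem mainTheorem4 (m r : ℕ) (hdim : 4 * r + 1 < 2 * (m + r) + 1)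
    (G : Matrix (Fin m) (Fin m) ℂ) (hG : G.IsHermitian) (hdet : IsUnit G.det)
    (hr : 1 < r ∨ (r = 1 ∧ (G.PosDef ∨ (-G).PosDef))) :
    CRGeom.IsGenericForLevi G {σ : CRGeom.CRSymbol m r | ¬ σ.HasHomogeneousModel} := by
  -- The dimension inequality amounts to r < m.
  rcases hr with hr | ⟨rfl, hdef⟩
  · exact CRGeom.isGeneric_of_one_lt hG hdet hr (by omega)
  · exact CRGeom.isGeneric_of_definite hG hdet (by omega) hdef
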